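/- **PD-codes.** Let $\mu\ge 0$ and $n_1,\dots,n_\mu\ge 1$, and consider the labels $(i,j)$, $1\le i\le\mu$, $1\le j\le n_i$; the label following $(i,j)$ is $(i,j+1)$, with $j+1$ taken modulo $n_i$. A *PD-code* is a finite set $C$ of quadruples $[q_0,q_1,q_2,q_3]$ of signed labels such that 1. every label occurs exactly once with sign $+$ and exactly once with sign $-$ in the quadruples of $C$; 2. every quadruple has two positive and two negative entries, and $q_0$ is positive; 3. the labels of the non-adjacent entries $q_k,q_{k+2}$ (indices modulo $4$) have the same first coordinate, and their second coordinates are consecutive modulo $n_i$; 4. $q_k$ and $q_{k+2}$ have opposite signs, and the label of the negative one is the one that follows the label of the positive one. **The associated cell complex.** The successor map on signed labels is $s(q_k)=-q_{k+1}$ (indices modulo $4$, $q\in C$). For every orbit of $s$ take an oriented $k$-gon in the plane, where $k\ge1$ is the size of the orbit (a closed disc whose boundary circle is cut into $k$ arcs), and label its sides clockwise by $x,s(x),s^2(x),\dots$ for some $x$ in the orbit. For every label $e$, glue the side $+e$ to the side $-e$ so that the clockwise direction of one corresponds to the counterclockwise direction of the other. Call the quotient space $X(C)$. It has one face for each orbit,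 one edge for each label (directed clockwise along the side $+e$) and one vertex for each quadruple. **Diagrams.** A *labeled oriented link diagram* on a smooth closed oriented, not necessarily connected (possibly empty), surface $S$ is a smooth immersion $d:\bigsqcup_{i=1}^{\mu}S^1\to S$ of ordered oriented circles whose only self-intersections are finitely many transverse double points (the crossings), with a sign in $\{1,-1\}$ at every crossing, and a labeling of the edges (the arcs between consecutive passages through crossings) of the $i$-th circle by $(i,1),\dots,(i,n_i)$ in the cyclic order in which they are run through. Two diagrams, on surfaces $S$ and $S'$, are *equivalent* if some orientation preserving homeomorphism $S\to S'$ carries one to the other (up to reparametrization of the circles), respecting the order and orientation of the circles, the edge labels and the crossing signs, and is a diffeomorphism off the diagrams. A diagram on $S$ is *obtained from the 1-skeleton of the cell decomposition of $C$* if there is a homeomorphism $X(C)\to S$ that is smooth with positive Jacobian on the interior of every polygon, and that carries the vertices bijectively to the crossings and each edge $e$, with its direction, to the edge of the diagram labeled $e$, such that at the crossing of a quadruple $[q_0,q_1,q_2,q_3]$ the edge ends $q_0,q_1,q_2,q_3$ leave the crossing in this counterclockwise order ($+$ for the end at which an edge comes in, $-$ for the end at which it goes out), and the sign of the crossing is $1$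 if the quadruple has the form $[+\alpha,-\gamma,-\beta,+\delta]$ and $-1$ if it has the form $[+\alpha,+\gamma,-\beta,-\delta]$. **Proposition.** Every PD-code $C$ determines a well-defined labeled oriented link diagram on an orientable surface: for every choice of the labels at which the numbering of the sides of the polygons starts, there are a smooth closed oriented surface $S$ and a labeled oriented link diagram on $S$ that is obtained from the 1-skeleton of the cell decomposition of $C$; and any two such diagrams (also for different choices) are equivalent. -/

import Mathlib

open scoped Manifold ContDiff

noncomputable section

/-! ## PD-codes -/

/-- The edge labels `(i, j)`: component `i` out of `μ` carries `n i` edges.  Both coordinates are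
counted from `0` here, so that `(i, j)` stands for the label usually written `(i + 1, j + 1)`. -/
abbrev EdgeLabel {μ : ℕ} (n : Fin μ → ℕ) : Type := Σ i : Fin μ, Fin (n i)

/-- The label following `l` in the cyclic order of the edges of its component:
`(i, j) ↦ (i, j + 1 mod n i)`. -/
def EdgeLabel.next {μ : ℕ} {n : Fin μ → ℕ} (l : EdgeLabel n) : EdgeLabel n :=
  ⟨l.1, finRotate (n l.1) l.2⟩

/-- Edge labels with a sign. -/
abbrev SignedLabel {μ : ℕ} (n : Fin μ → ℕ) : Type := EdgeLabel n × ℤˣ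

/-- The same label with the opposite sign. -/
def SignedLabel.flip {μ : ℕ} {n : Fin μ → ℕ} (x : SignedLabel n) : SignedLabel n := (x.1, -x.2)

/-- Quadruples `[q 0, q 1, q 2, q 3]` of signed labels. The entries `q k` and `q (k + 2)` are the
non-adjacent ones (indices modulo `4`). -/
abbrev Quad {μ : ℕ} (n : Fin μ → ℕ) : Type := Fin 4 → SignedLabel n

/-- PD-codes on the labels `(1,1), …, (1,n₁), …, (μ,1), …, (μ,n_μ)`. -/
structure PDCode {μ : ℕ} (n : Fin μ → ℕ) where
  /-- the quadruples -/
  quads : Finset (Quad n)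
  /-- every component carries at least one label -/
  pos : ∀ i, 0 < n i
  /-- every edge label occurs exactly once positively and exactly once negatively -/
  once : ∀ x : SignedLabel n, ∃! p : Quad n × Fin 4, p.1 ∈ quads ∧ p.1 p.2 = x
  /-- every quadruple has two positive and two negative entries, and begins with a positive one -/
  signs : ∀ q ∈ quads, {k : Fin 4 | (q k).2 = 1}.ncard = 2 ∧ {k : Fin 4 | (q k).2 = -1}.ncard = 2 ∧
    (q 0).2 = 1
  /-- non-adjacent labels lie on the same component and are consecutive on it -/
  consecutive : ∀ q ∈ quads, ∀ k : Fin 4,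
    (q (k + 2)).1 = (q k).1.next ∨ (q k).1 = (q (k + 2)).1.next
  /-- non-adjacent labels have opposite signs, and the positive one is the one that precedes the
  other in the cyclic order of the edges of the component -/
  opposite : ∀ q ∈ quads, ∀ k : Fin 4, (q (k + 2)).2 = -(q k).2 ∧
    ((q k).2 = 1 → (q (k + 2)).1 = (q k).1.next)

namespace PDCode

variable {μ : ℕ} {n : Fin μ → ℕ} (C : PDCode n)

/-- A signed label is the same thing as a place in a quadruple of the code (an edge end). -/
def endEquiv : C.quads × Fin 4 ≃ SignedLabel n :=
  Equiv.ofBijective (fun p => p.1.1 p.2) (by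
    constructor
    · rintro ⟨⟨q, hq⟩, k⟩ ⟨⟨q', hq'⟩, k'⟩ h
      have h2 := (C.once (q k)).unique (y₁ := (q, k)) (y₂ := (q', k')) ⟨hq, rfl⟩ ⟨hq', h.symm⟩
      simp only [Prod.mk.injEq] at h2
      obtain ⟨rfl, rfl⟩ := h2
      rfl
    · intro x
      obtain ⟨⟨q, k⟩, ⟨hq, hx⟩, -⟩ := C.once x
      exact ⟨(⟨q, hq⟩, k), hx⟩)

/-- The successor map `s (q k) = - q (k + 1 mod 4)`. -/
def succ : Equiv.Perm (SignedLabel n) :=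
  (C.endEquiv.symm.trans ((Equiv.refl _).prodCongr (finRotate 4))).trans
    (C.endEquiv.trans
      ⟨SignedLabel.flip, SignedLabel.flip, fun x => by simp [SignedLabel.flip],
        fun x => by simp [SignedLabel.flip]⟩)

/-- The successor map has the defining property. -/
theorem succ_apply {q : Quad n} (hq : q ∈ C.quads) (k : Fin 4) :
    C.succ (q k) = (q (k + 1)).flip := by
  have h : C.endEquiv.symm (q k) = (⟨q, hq⟩, k) := by
    rw [Equiv.symm_apply_eq]; rfl
  simp only [succ, Equiv.trans_apply, h]
  change (q (finRotate 4 k)).flip = _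
  rw [finRotate_apply]

/-! ## The associated cell complex -/

/-- The faces are the orbits of the successor map. -/
def Face : Type := Quotient (Equiv.Perm.SameCycle.setoid C.succ)

/-- A choice, for every face, of the label of the side at which the numbering of the sides of the
corresponding polygon starts. -/
def Start : Type :=
  {b : C.Face → SignedLabel n // ∀ f, Quotient.mk (Equiv.Perm.SameCycle.setoid C.succ) (b f) = f}

variable {C}

/-- The label of the `m`-th side of the polygon `f`: the `m`-th iterate of the successor map. The
sides are numbered from `0`, and `m` matters only modulo the number of sides. -/
def Start.side (b : C.Start) (f : C.Face) (m : ℕ) : SignedLabel n := (C.succ ^ m) (b.1 f)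

/-- The number of sides of the polygon `f`, that is, the size of the orbit. -/
def Start.numSides (b : C.Start) (f : C.Face) : ℕ := Function.minimalPeriod C.succ (b.1 f)

/-- The `k`-gon is the closed unit disc (`k ≥ 1`, so that monogons and bigons are included) whose
boundary circle is cut into `k` equal arcs, numbered clockwise. This is the point with parameter
`u ∈ [0, 1]` on the `m`-th side, again clockwise. -/
def sidePoint (k m : ℕ) (u : ℝ) : Metric.closedBall (0 : ℂ) 1 :=
  ⟨Circle.exp (-(2 * Real.pi * (m + u) / k)), by
    rw [mem_closedBall_zero_iff, Circle.norm_coe]⟩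

/-- The disjoint union of the polygons, one for each face. -/
abbrev Polygons (C : PDCode n) : Type := Σ _ : C.Face, Metric.closedBall (0 : ℂ) 1

/-- The gluing: the two sides labelled `x` and `-x` are identified, in opposite clockwise
directions. -/
inductive Start.Glue (b : C.Start) : Polygons C → Polygons C → Prop
  | side (f f' : C.Face) (m m' : ℕ) (h : b.side f' m' = (b.side f m).flip)
      (u : ℝ) (hu : u ∈ Set.Icc (0 : ℝ) 1) :
      Start.Glue b ⟨f, sidePoint (b.numSides f) m u⟩ ⟨f', sidePoint (b.numSides f') m' (1 - u)⟩

/-- The associated cell complex: the quotient space of the disjoint union of the polygons by the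
equivalence relation generated by the gluing. -/
def Start.Complex (b : C.Start) : Type := Quot b.Glue

instance (b : C.Start) : TopologicalSpace b.Complex :=
  inferInstanceAs (TopologicalSpace (Quot b.Glue))

/-- The point of the complex given by a point of the polygon `f`. -/
def Start.cell (b : C.Start) (f : C.Face) (z : Metric.closedBall (0 : ℂ) 1) : b.Complex :=
  Quot.mk _ ⟨f, z⟩

end PDCode

/-! ## Link diagrams on surfaces -/

/-- The determinant of two plane vectors. -/
def det2 (v w : EuclideanSpace ℝ (Fin 2)) : ℝ := v 0 * w 1 - v 1 * w 0

/-- Smooth closed oriented surfaces, not necessarily connected. The orientation is given by the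
atlas: all coordinate changes have positive Jacobian determinant. -/
structure ClosedOrientedSurface where
  /-- the points -/
  carrier : Type
  [top : TopologicalSpace carrier]
  [t2 : T2Space carrier]
  [compact : CompactSpace carrier]
  [charted : ChartedSpace (EuclideanSpace ℝ (Fin 2)) carrier]
  [smooth : IsManifold (𝓡 2) ∞ carrier]
  oriented : ∀ e ∈ atlas (EuclideanSpace ℝ (Fin 2)) carrier,
    ∀ e' ∈ atlas (EuclideanSpace ℝ (Fin 2)) carrier, ∀ x ∈ (e.symm.trans e').source,
      0 < (fderiv ℝ (e.symm.trans e') x).det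

attribute [instance] ClosedOrientedSurface.top ClosedOrientedSurface.t2
  ClosedOrientedSurface.compact ClosedOrientedSurface.charted ClosedOrientedSurface.smooth

instance : CoeSort ClosedOrientedSurface Type := ⟨ClosedOrientedSurface.carrier⟩

/-- The velocity at time `t` of the curve `s ↦ γ (exp (i s))`, in the chart of the (oriented) atlas
that is attached to the point `γ (exp (i t))`. -/
def circleVelocity {S : ClosedOrientedSurface} (γ : Circle → S) (t : ℝ) :
    EuclideanSpace ℝ (Fin 2) :=
  mfderiv 𝓘(ℝ, ℝ) (𝓡 2) (fun s : ℝ => γ (Circle.exp s)) t (1 : ℝ)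

/-- The points at which a family of closed curves meets itself. -/
def selfIntersections {S : Type} {μ : ℕ} (d : Fin μ → Circle → S) : Set S :=
  {p | ∃ a b : Fin μ × Circle, a ≠ b ∧ d a.1 a.2 = p ∧ d b.1 b.2 = p}

/-- Labeled oriented link diagrams on `S` with `μ` ordered components, the `i`-th of which has
`n i ≥ 1` edges. -/
structure LinkDiagram (S : ClosedOrientedSurface) {μ : ℕ} (n : Fin μ → ℕ) where
  /-- the map on the `i`-th circle, which carries its standard counterclockwise orientation -/
  map : Fin μ → Circle → S
  smooth : ∀ i, ContMDiff (𝓡 1) (𝓡 2) ∞ (map i)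
  immersion : ∀ i z, Function.Injective (mfderiv (𝓡 1) (𝓡 2) (map i) z)
  finite : (selfIntersections map).Finite
  /-- no point is passed more than twice -/
  double : ∀ a b c : Fin μ × Circle, map a.1 a.2 = map b.1 b.2 → map b.1 b.2 = map c.1 c.2 →
    a = b ∨ b = c ∨ a = c
  transverse : ∀ (i j : Fin μ) (s t : ℝ), (i, Circle.exp s) ≠ (j, Circle.exp t) →
    map i (Circle.exp s) = map j (Circle.exp t) →
    LinearIndependent ℝ ![circleVelocity (map i) s, circleVelocity (map j) t]
  /-- The labeling of the edges: the circle `i` passes through crossings exactly at the times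
  `mark i k`, `k ∈ ℤ`, and `(i, j)` is the label of the edge that is run through between the times
  `mark i j` and `mark i (j + 1)`. -/
  mark : Fin μ → ℤ → ℝ
  mark_strictMono : ∀ i, StrictMono (mark i)
  mark_add : ∀ i k, mark i (k + n i) = mark i k + 2 * Real.pi
  mark_range : ∀ i t, map i (Circle.exp t) ∈ selfIntersections map ↔ t ∈ Set.range (mark i)
  /-- the signs of the crossings -/
  sign : selfIntersections map → ℤˣ

namespace LinkDiagram

variable {S S' : ClosedOrientedSurface} {μ : ℕ} {n : Fin μ → ℕ}

/-- The crossings (vertices) of the diagram. -/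
abbrev crossings (D : LinkDiagram S n) : Set S := selfIntersections D.map

/-- The underlying point set of the diagram. -/
def image (D : LinkDiagram S n) : Set S := ⋃ i, Set.range (D.map i)

/-- The time at which the edge end `x` is at its crossing: the positive end of an edge is the one
at which the edge comes in, the negative end the one at which it goes out. -/
def endTime (D : LinkDiagram S n) (x : SignedLabel n) : ℝ :=
  if x.2 = 1 then D.mark x.1.1 ((x.1.2 : ℕ) + 1) else D.mark x.1.1 (x.1.2 : ℕ)

/-- The tangent vector to the edge end `x` at its crossing, pointing away from the crossing. -/
def outward (D : LinkDiagram S n) (x : SignedLabel n) : EuclideanSpace ℝ (Fin 2) :=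
  if x.2 = 1 then -circleVelocity (D.map x.1.1) (D.endTime x)
  else circleVelocity (D.map x.1.1) (D.endTime x)

/-- Equivalence of diagrams: there is an orientation preserving homeomorphism of the surfaces which
carries one diagram to the other and respects the order and the orientations of the components, the
labels of the edges and the signs of the crossings. Here `ψ i` is the lift to `ℝ` of the
reparametrization of the `i`-th circle. The homeomorphism is smooth, with smooth inverse, off the
diagrams (which are closed and nowhere dense), and preserving the orientation means that its
Jacobian determinant is positive there. -/
def Equivalent (D : LinkDiagram S n) (D' : LinkDiagram S' n) : Prop :=
  ∃ (h : S ≃ₜ S') (ψ : Fin μ → ℝ → ℝ),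
    (∀ i, Continuous (ψ i) ∧ StrictMono (ψ i) ∧ (∀ t, ψ i (t + 2 * Real.pi) = ψ i t + 2 * Real.pi))
    ∧ (∀ i t, h (D.map i (Circle.exp t)) = D'.map i (Circle.exp (ψ i t)))
    ∧ (∀ i k, ψ i (D.mark i k) = D'.mark i k)
    ∧ (∀ (p : D.crossings) (p' : D'.crossings), h p = p' → D'.sign p' = D.sign p)
    ∧ ContMDiffOn (𝓡 2) (𝓡 2) ∞ h D.imageᶜ
    ∧ ContMDiffOn (𝓡 2) (𝓡 2) ∞ h.symm D'.imageᶜ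
    ∧ ∀ p ∉ D.image, 0 < (mfderiv (𝓡 2) (𝓡 2) h p :
        EuclideanSpace ℝ (Fin 2) →L[ℝ] EuclideanSpace ℝ (Fin 2)).det

end LinkDiagram

/-- A presentation of the diagram `D` on the surface `S` as the diagram obtained from the
`1`-skeleton of the cell complex associated to a PD-code. -/
structure Presentation {S : ClosedOrientedSurface} {μ : ℕ} {n : Fin μ → ℕ} {C : PDCode n}
    (b : C.Start) (D : LinkDiagram S n) where
  /-- the surface is the associated cell complex -/
  homeo : b.Complex ≃ₜ S
  /-- the crossings are the quadruples of the code -/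
  vertex : C.quads ≃ D.crossings
  /-- On the interior of each polygon, `homeo` is smooth and preserves the orientation, where the
  polygon has the standard orientation of the plane. -/
  face : ∀ f : C.Face, ∃ g : ℂ → S, (∀ z : Metric.closedBall (0 : ℂ) 1, g z = homeo (b.cell f z)) ∧
    ContMDiffOn 𝓘(ℝ, ℂ) (𝓡 2) ∞ g (Metric.ball 0 1) ∧
    ∀ z ∈ Metric.ball (0 : ℂ) 1,
      0 < det2 (mfderiv 𝓘(ℝ, ℂ) (𝓡 2) g z (1 : ℂ)) (mfderiv 𝓘(ℝ, ℂ) (𝓡 2) g z Complex.I)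
  /-- The edge `l` of the complex, directed from its negative to its positive end, is the edge of
  the diagram with the label `l`, up to a reparametrization `ρ`. (A polygon side with the label `+l`
  runs along this edge in the direction of the edge.) -/
  edge : ∀ l : EdgeLabel n, ∃ ρ : ℝ → ℝ, ContinuousOn ρ (Set.Icc 0 1) ∧
    StrictMonoOn ρ (Set.Icc 0 1) ∧ ρ 0 = D.mark l.1 (l.2 : ℕ) ∧ ρ 1 = D.mark l.1 ((l.2 : ℕ) + 1) ∧
    ∀ (f : C.Face) (m : ℕ), b.side f m = (l, 1) → ∀ u ∈ Set.Icc (0 : ℝ) 1,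
      homeo (b.cell f (PDCode.sidePoint (b.numSides f) m u)) = D.map l.1 (Circle.exp (ρ u))
  /-- The corner of a polygon at the end of the side with the label `q k` is the crossing that
  corresponds to the quadruple `q`. -/
  corner : ∀ (q : C.quads) (k : Fin 4) (f : C.Face) (m : ℕ), b.side f m = q.1 k →
    homeo (b.cell f (PDCode.sidePoint (b.numSides f) m 1)) = vertex q
  /-- At its crossing, the edge end with the signed label `q k` is there, -/
  incident : ∀ (q : C.quads) (k : Fin 4),
    D.map (q.1 k).1.1 (Circle.exp (D.endTime (q.1 k))) = vertex q
  /-- and the four edge ends `q 0, q 1, q 2, q 3` follow one another counterclockwise, in the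
  orientation of the surface. -/
  cyclic : ∀ (q : C.quads) (k : Fin 4), 0 < det2 (D.outward (q.1 k)) (D.outward (q.1 (k + 1)))
  /-- crossings `[+α, -γ, -β, +δ]` have the sign `1` -/
  sign_pos : ∀ q : C.quads, (q.1 0).2 = 1 → (q.1 1).2 = -1 → (q.1 2).2 = -1 → (q.1 3).2 = 1 →
    D.sign (vertex q) = 1
  /-- crossings `[+α, +γ, -β, -δ]` have the sign `-1` -/
  sign_neg : ∀ q : C.quads, (q.1 0).2 = 1 → (q.1 1).2 = 1 → (q.1 2).2 = -1 → (q.1 3).2 = -1 →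
    D.sign (vertex q) = -1

end

/-!
The complex of a PD-code is turned into a Riemann surface, on which the edges form the diagram.

*Existence.* Along the side with the signed label `x`, a polygon with `k` sides has the holomorphic
coordinate `w` with `z = exp (-2πi (m + w) / k)` (`Start.pt`), in which the interior of the polygon is
the lower half plane and the side is `[0, 1]`. The gluing identifies `w` on the side `x` with `1 - w`
on the side `-x`, so the two half strips fit together to a strip, the chart of an edge. At a vertex,
the four corners are half planes in these coordinates; bent into quadrants by a square root, they
make up a disc, the chart of the vertex, in which the edge ends `q 0, q 1, q 2, q 3` are the rays
through `1, i, -1, -i`. All coordinate changes are affine maps, squares or exponentials, hence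
holomorphic, so that they are smooth and preserve the orientation. Every point lies in exactly one
open cell, and near each point each chart is related to that of the cell (`Start.exists_canonical`,
`Start.canonical_unique`); therefore continuity, openness and coordinate changes need only be
considered at these canonical charts (`Start.map_nhds_param`, `Start.exists_transition`). The
complex is a Hausdorff space because the identifications form a closed relation on the compact
polygons (`Start.isClosed_rel`).

A component that runs along an edge with the parameter `u = sin² (πτ/2)` is smooth and regular, and
near a crossing it is `± sin (π (τ - m) / 2)` times a fixed power of `i` in the chart of the vertex
(`Start.curve_near_crossing`). This gives transversality and the cyclic order of the edge ends.

*Uniqueness.* Rotating the polygons identifies the complexes of two numberings of the sides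
(`Start.changeHomeo`), and composing with the two given homeomorphisms gives a homeomorphism of the
surfaces that carries one diagram to the other. In the interior of a polygon it is a composition of
diffeomorphisms of positive Jacobian (`Presentation.surfaceHomeo_smooth`), and the parametrizations
of the single edges fit together to a reparametrization of each component (`Presentation.timeIso`).
-/

open Topology Filter

noncomputable section

/-! ### The polygons and their sides -/

namespace PDCode

variable {μ : ℕ} {n : Fin μ → ℕ} {C : PDCode n}

/-- The face one of whose sides carries the signed label `x`. -/
def faceOf (C : PDCode n) (x : SignedLabel n) : C.Face :=
  Quotient.mk (Equiv.Perm.SameCycle.setoid C.succ) x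

instance : Finite C.Face := Quotient.finite _

@[simp] theorem flip_flip (x : SignedLabel n) : x.flip.flip = x := by simp [SignedLabel.flip]

theorem flip_ne (x : SignedLabel n) : x.flip ≠ x := by
  intro h
  have := congrArg Prod.snd h
  exact neg_units_ne_self x.2 this

theorem faceOf_pow (m : ℕ) (x : SignedLabel n) : C.faceOf ((C.succ ^ m) x) = C.faceOf x :=
  Quotient.sound (Equiv.Perm.sameCycle_pow_left.2 (Equiv.Perm.SameCycle.refl _ _))

/-- The map `t ↦ exp (-2πit/k)`, which winds the lower half plane clockwise around the unit disc;
it carries the interval `[m, m + 1]` to the `m`-th side of the `k`-gon. -/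
def turn (k : ℕ) (t : ℂ) : ℂ := Complex.exp (-(2 * Real.pi * Complex.I * t / k))

theorem norm_turn (k : ℕ) (t : ℂ) : ‖turn k t‖ = Real.exp (2 * Real.pi * t.im / k) := by
  rw [turn, Complex.norm_exp]
  congr 1
  have : -(2 * Real.pi * Complex.I * t / k) = ((2 * Real.pi / k : ℝ) : ℂ) * (-(Complex.I * t)) := by
    push_cast; ring
  rw [this, Complex.re_ofReal_mul]
  simp
  ring

theorem norm_turn_le {k : ℕ} (hk : 0 < k) {t : ℂ} : ‖turn k t‖ ≤ 1 ↔ t.im ≤ 0 := by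
  have hk' : (0 : ℝ) < k := by exact_mod_cast hk
  rw [norm_turn, Real.exp_le_one_iff, div_nonpos_iff]
  have := Real.pi_pos
  constructor
  · rintro (h | h)
    · linarith [h.2]
    · nlinarith [h.1]
  · intro h
    exact Or.inr ⟨by nlinarith, hk'.le⟩

theorem norm_turn_lt {k : ℕ} (hk : 0 < k) {t : ℂ} : ‖turn k t‖ < 1 ↔ t.im < 0 := by
  have hk' : (0 : ℝ) < k := by exact_mod_cast hk
  rw [norm_turn, Real.exp_lt_one_iff, div_neg_iff]
  have := Real.pi_pos
  constructor
  · rintro (h | h)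
    · linarith [h.2]
    · nlinarith [h.1]
  · intro h
    exact Or.inr ⟨by nlinarith, hk'⟩

theorem turn_eq_turn_iff {k : ℕ} (hk : 0 < k) {s t : ℂ} :
    turn k s = turn k t ↔ ∃ j : ℤ, s = t + j * k := by
  have hk' : (k : ℂ) ≠ 0 := by exact_mod_cast hk.ne'
  have hpi : (2 * Real.pi * Complex.I : ℂ) ≠ 0 := Complex.two_pi_I_ne_zero
  rw [turn, turn, Complex.exp_eq_exp_iff_exists_int]
  constructor
  · rintro ⟨j, hj⟩
    refine ⟨-j, mul_left_cancel₀ hpi ?_⟩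
    field_simp at hj
    push_cast
    linear_combination (-(2 * Real.pi * Complex.I)) * hj
  · rintro ⟨j, rfl⟩
    refine ⟨-j, ?_⟩
    push_cast
    field_simp
    ring

theorem turn_natCast_add (k m : ℕ) (u : ℝ) :
    turn k (m + u) = (sidePoint k m u : ℂ) := by
  rw [turn, sidePoint]
  simp only [Circle.coe_exp]
  congr 1
  push_cast
  ring

theorem exists_turn_eq {k : ℕ} (hk : 0 < k) {z : ℂ} (hz : z ≠ 0) : ∃ t, turn k t = z := by
  have hk' : (k : ℂ) ≠ 0 := by exact_mod_cast hk.ne'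
  have hpi : (2 * Real.pi * Complex.I : ℂ) ≠ 0 := Complex.two_pi_I_ne_zero
  refine ⟨-(Complex.log z * k / (2 * Real.pi * Complex.I)), ?_⟩
  rw [turn]
  conv_rhs => rw [← Complex.exp_log hz]
  congr 1
  field_simp

theorem isOpenMap_turn {k : ℕ} (hk : 0 < k) : IsOpenMap (turn k) := by
  have hk' : (k : ℂ) ≠ 0 := by exact_mod_cast hk.ne'
  have hc : (-(2 * Real.pi * Complex.I) / k : ℂ) ≠ 0 :=
    div_ne_zero (neg_ne_zero.2 Complex.two_pi_I_ne_zero) hk'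
  have : turn k = Complex.exp ∘ fun t => (-(2 * Real.pi * Complex.I) / k : ℂ) * t := by
    ext t; simp only [turn, Function.comp]; congr 1; ring
  rw [this]
  exact Complex.isOpenMap_exp.comp (Homeomorph.mulLeft₀ _ hc).isOpenMap

theorem hasDerivAt_turn (k : ℕ) (t : ℂ) :
    HasDerivAt (turn k) (turn k t * (-(2 * Real.pi * Complex.I) / k)) t := by
  have h : HasDerivAt (fun t : ℂ => -(2 * Real.pi * Complex.I * t / k))
      (-(2 * Real.pi * Complex.I) / k) t := by
    have := ((hasDerivAt_id t).const_mul (-(2 * Real.pi * Complex.I) / k : ℂ))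
    simp only [mul_one] at this
    refine this.congr_of_eventuallyEq (Eventually.of_forall fun s => ?_)
    simp; ring
  exact h.cexp

theorem differentiable_turn (k : ℕ) : Differentiable ℂ (turn k) :=
  fun t => (hasDerivAt_turn k t).differentiableAt

@[fun_prop] theorem continuous_turn (k : ℕ) : Continuous (turn k) :=
  (differentiable_turn k).continuous

/-- The radial projection of the plane to the closed unit disc. -/
def discProj (z : ℂ) : Metric.closedBall (0 : ℂ) 1 :=
  ⟨z / (max 1 ‖z‖ : ℝ), by
    have h : 0 < max 1 ‖z‖ := lt_max_of_lt_left one_pos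
    rw [mem_closedBall_zero_iff, norm_div, Complex.norm_real, Real.norm_of_nonneg h.le,
      div_le_one h]
    exact le_max_right _ _⟩

@[fun_prop] theorem continuous_discProj : Continuous discProj := by
  refine Continuous.subtype_mk (continuous_id.div (by fun_prop) fun z => ?_) _
  exact_mod_cast (lt_max_of_lt_left one_pos : 0 < max 1 ‖z‖).ne'

theorem coe_discProj {z : ℂ} (hz : ‖z‖ ≤ 1) : (discProj z : ℂ) = z := by
  simp [discProj, max_eq_left hz]

@[simp] theorem discProj_coe (z : Metric.closedBall (0 : ℂ) 1) : discProj z = z :=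
  Subtype.ext (coe_discProj (mem_closedBall_zero_iff.1 z.2))

namespace Start

variable (b : C.Start)

theorem numSides_pos (f : C.Face) : 0 < b.numSides f :=
  Function.minimalPeriod_pos_of_mem_periodicPts
    (C.succ.injective.mem_periodicPts (b.1 f))

theorem faceOf_start (f : C.Face) : C.faceOf (b.1 f) = f := b.2 f

@[simp] theorem faceOf_side (f : C.Face) (m : ℕ) : C.faceOf (b.side f m) = f := by
  rw [side, faceOf_pow, faceOf_start]

theorem side_eq_side_iff (f : C.Face) (m m' : ℕ) :
    b.side f m = b.side f m' ↔ m ≡ m' [MOD b.numSides f] := by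
  simp only [side, Equiv.Perm.coe_pow]
  rw [← Function.iterate_mod_minimalPeriod_eq (n := m),
    ← Function.iterate_mod_minimalPeriod_eq (n := m')]
  exact Function.iterate_eq_iterate_iff_of_lt_minimalPeriod
    (Nat.mod_lt _ (b.numSides_pos f)) (Nat.mod_lt _ (b.numSides_pos f))

theorem exists_side_eq (x : SignedLabel n) : ∃ m, b.side (C.faceOf x) m = x := by
  have h : C.succ.SameCycle (b.1 (C.faceOf x)) x := Quotient.exact (b.2 (C.faceOf x))
  obtain ⟨i, hi⟩ := h.exists_nat_pow_eq
  exact ⟨i, hi⟩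

/-- The number of a side with the label `x` on its polygon. -/
def idx (x : SignedLabel n) : ℕ := (b.exists_side_eq x).choose

theorem side_idx (x : SignedLabel n) : b.side (C.faceOf x) (b.idx x) = x :=
  (b.exists_side_eq x).choose_spec

/-- The complex coordinate `w` along the side with the label `x`: the real interval `[0, 1]` is the
side itself, and the lower half plane winds around the interior of the polygon. Points of the upper
half plane are projected radially to the boundary of the polygon. -/
def pt (x : SignedLabel n) (w : ℂ) : Polygons C :=
  ⟨C.faceOf x, discProj (turn (b.numSides (C.faceOf x)) (b.idx x + w))⟩

variable {b}

/-- The number of a side is only determined modulo the number of sides; any choice gives the same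
points. -/
theorem pt_of_side {f : C.Face} {m : ℕ} {x : SignedLabel n} (h : b.side f m = x) (w : ℂ) :
    b.pt x w = ⟨f, discProj (turn (b.numSides f) (m + w))⟩ := by
  obtain rfl : C.faceOf x = f := by rw [← h, faceOf_side]
  have h1 : b.idx x ≡ m [MOD b.numSides (C.faceOf x)] := by
    rw [← side_eq_side_iff, side_idx, h]
  rw [pt]
  congr 2
  rw [turn_eq_turn_iff (b.numSides_pos _)]
  obtain ⟨j, hj⟩ := h1.symm.dvd
  refine ⟨j, ?_⟩
  have : (b.idx x : ℂ) - m = b.numSides (C.faceOf x) * j := by exact_mod_cast hj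
  linear_combination this

variable (b)

theorem sidePoint_eq_pt (f : C.Face) (m : ℕ) (u : ℝ) :
    (⟨f, sidePoint (b.numSides f) m u⟩ : Polygons C) = b.pt (b.side f m) u := by
  rw [pt_of_side rfl, turn_natCast_add, discProj_coe]

theorem pt_add_one (x : SignedLabel n) (w : ℂ) : b.pt x (w + 1) = b.pt (C.succ x) w := by
  have h : b.side (C.faceOf x) (b.idx x + 1) = C.succ x := by
    rw [side, pow_succ', Equiv.Perm.mul_apply]
    exact congrArg _ (b.side_idx x)
  rw [pt_of_side h, pt]
  congr 3
  push_cast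
  ring

variable {b}

/-- The coordinates of a point are unique up to passing to the next side. -/
theorem pt_eq_pt {x y : SignedLabel n} {w w' : ℂ} (hw : w.im ≤ 0) (hw' : w'.im ≤ 0)
    (h : b.pt x w = b.pt y w') : ∃ j : ℤ, w = w' + j ∧ y = (C.succ ^ j) x := by
  have hf : C.faceOf x = C.faceOf y := congrArg Sigma.fst h
  rw [pt_of_side (b.side_idx y), pt_of_side ((congrArg (fun f => b.side f _) hf.symm).trans
    (b.side_idx x)), Sigma.mk.injEq, heq_eq_eq] at h
  have hN := b.numSides_pos (C.faceOf y)
  have h2 := congrArg Subtype.val h.2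
  rw [coe_discProj ((norm_turn_le hN).2 (by simpa using hw)),
    coe_discProj ((norm_turn_le hN).2 (by simpa using hw')), turn_eq_turn_iff hN] at h2
  obtain ⟨t, ht⟩ := h2
  refine ⟨b.idx y - b.idx x + t * b.numSides (C.faceOf y), ?_, ?_⟩
  · push_cast; linear_combination ht
  · have h3 : (C.succ ^ (t * b.numSides (C.faceOf y) : ℤ)) (b.1 (C.faceOf y)) = b.1 (C.faceOf y) := by
      rw [mul_comm, zpow_mul, zpow_natCast]
      have h4 : (C.succ ^ b.numSides (C.faceOf y)) (b.1 (C.faceOf y)) = b.1 (C.faceOf y) := by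
        rw [Equiv.Perm.coe_pow]
        exact Function.iterate_minimalPeriod
      exact Equiv.Perm.zpow_apply_eq_self_of_apply_eq_self h4 t
    have hx := b.side_idx x
    have hy := b.side_idx y
    rw [hf] at hx
    simp only [side] at hx hy
    have key : (C.succ ^ (b.idx y - b.idx x + t * b.numSides (C.faceOf y) : ℤ))
        ((C.succ ^ (b.idx x : ℤ)) (b.1 (C.faceOf y))) = y := by
      rw [← Equiv.Perm.mul_apply, ← zpow_add]
      have : (b.idx y : ℤ) - b.idx x + t * b.numSides (C.faceOf y) + b.idx x =
        b.idx y + t * b.numSides (C.faceOf y) := by ring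
      rw [this, zpow_add, Equiv.Perm.mul_apply, h3, zpow_natCast, hy]
    rw [zpow_natCast, hx] at key
    exact key.symm

theorem coe_pt {x : SignedLabel n} {w : ℂ} (hw : w.im ≤ 0) :
    ((b.pt x w).2 : ℂ) = turn (b.numSides (C.faceOf x)) (b.idx x + w) :=
  coe_discProj ((norm_turn_le (b.numSides_pos _)).2 (by simpa using hw))

theorem norm_pt_lt {x : SignedLabel n} {w : ℂ} (hw : w.im ≤ 0) :
    ‖((b.pt x w).2 : ℂ)‖ < 1 ↔ w.im < 0 := by
  rw [coe_pt hw, norm_turn_lt (b.numSides_pos _)]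
  simp

@[fun_prop] theorem continuous_pt (x : SignedLabel n) : Continuous (b.pt x) := by
  exact continuous_sigmaMk.comp
    (continuous_discProj.comp ((continuous_turn _).comp (continuous_const.add continuous_id)))

variable (b)

/-- The coordinate along a side is open as a map from the closed lower half plane. -/
theorem nhds_pt_le (x : SignedLabel n) {w : ℂ} (hw : w.im ≤ 0) :
    𝓝 (b.pt x w) ≤ map (b.pt x) (𝓝[{w | w.im ≤ 0}] w) := by
  intro A hA
  rw [mem_map, mem_nhdsWithin] at hA
  obtain ⟨V, hV, hwV, hA⟩ := hA
  have hN := b.numSides_pos (C.faceOf x)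
  rw [pt, Sigma.nhds_mk, mem_map, nhds_subtype, mem_comap]
  refine ⟨turn (b.numSides (C.faceOf x)) '' ((fun w => b.idx x + w) '' V), ?_, ?_⟩
  · rw [coe_discProj ((norm_turn_le hN).2 (by simpa using hw))]
    exact (isOpenMap_turn hN _ ((Homeomorph.addLeft (b.idx x : ℂ)).isOpenMap V hV)).mem_nhds
      ⟨_, ⟨w, hwV, rfl⟩, rfl⟩
  · rintro z ⟨_, ⟨v, hv, rfl⟩, hz⟩
    have hv' : v.im ≤ 0 := by
      have : ‖(z : ℂ)‖ ≤ 1 := mem_closedBall_zero_iff.1 z.2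
      rw [← hz, norm_turn_le hN] at this
      simpa using this
    have := hA ⟨hv, hv'⟩
    rw [Set.mem_preimage, pt, hz, discProj_coe] at this
    exact this

/-- Every point but the centres of the polygons has a coordinate along some side. -/
theorem exists_pt_eq (p : Polygons C) (hp : (p.2 : ℂ) ≠ 0) :
    ∃ (x : SignedLabel n) (w : ℂ), w.im ≤ 0 ∧ 0 < w.re ∧ w.re ≤ 1 ∧ p = b.pt x w := by
  obtain ⟨f, z⟩ := p
  have hN := b.numSides_pos f
  obtain ⟨t, ht⟩ := exists_turn_eq hN hp
  obtain ⟨m, j, hm⟩ : ∃ (m : ℕ) (j : ℤ), ⌈t.re⌉ - 1 = m + j * b.numSides f := by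
    refine ⟨((⌈t.re⌉ - 1) % b.numSides f).toNat, (⌈t.re⌉ - 1) / b.numSides f, ?_⟩
    rw [Int.toNat_of_nonneg (Int.emod_nonneg _ (by exact_mod_cast hN.ne'))]
    exact (Int.emod_add_ediv_mul _ _).symm
  have him : t.im ≤ 0 := by
    rw [← norm_turn_le hN, ht]
    exact mem_closedBall_zero_iff.1 z.2
  refine ⟨b.side f m, t - (⌈t.re⌉ - 1 : ℤ), by simpa using him, ?_, ?_, ?_⟩
  · simp only [Complex.sub_re, Complex.intCast_re]
    push_cast
    linarith [Int.ceil_lt_add_one t.re]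
  · simp only [Complex.sub_re, Complex.intCast_re]
    push_cast
    linarith [Int.le_ceil t.re]
  · rw [pt_of_side rfl]
    have : turn (b.numSides f) (m + (t - (⌈t.re⌉ - 1 : ℤ))) = z := by
      rw [← ht, turn_eq_turn_iff hN]
      refine ⟨-j, ?_⟩
      rw [hm]; push_cast; ring
    rw [this, discProj_coe]

/-! ### Identified points, and the topology of the complex -/

/-- The identifications made by the gluing: points inside a side with points of the side with the
opposite label, and the four corners that belong to a quadruple with one another. -/
inductive Rel (b : C.Start) : Polygons C → Polygons C → Prop
  | refl (p) : Rel b p p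
  | side (x : SignedLabel n) (u : ℝ) (h0 : 0 < u) (h1 : u < 1) :
      Rel b (b.pt x u) (b.pt x.flip (1 - u : ℝ))
  | corner (q : C.quads) (k k' : Fin 4) : Rel b (b.pt (q.1 k) 1) (b.pt (q.1 k') 1)

variable {b}

theorem exists_quad (C : PDCode n) (x : SignedLabel n) : ∃ (q : C.quads) (k : Fin 4), q.1 k = x :=
  ⟨_, _, C.endEquiv.apply_symm_apply x⟩

theorem quad_injective {q q' : C.quads} {k k' : Fin 4} (h : q.1 k = q'.1 k') : q = q' ∧ k = k' := by
  have := C.endEquiv.injective (a₁ := (q, k)) (a₂ := (q', k')) h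
  simpa using this

theorem eq_of_pt_eq {x y : SignedLabel n} {w w' : ℂ} (hw : w.im ≤ 0) (hw' : w'.im ≤ 0)
    (h : b.pt x w = b.pt y w') (h1 : w.re - w'.re < 1) (h2 : w'.re - w.re < 1) :
    x = y ∧ w = w' := by
  obtain ⟨j, rfl, rfl⟩ := pt_eq_pt hw hw' h
  simp only [Complex.add_re, Complex.intCast_re, add_sub_cancel_left, sub_add_cancel_left] at h1 h2
  have hj : j = 0 := by
    have h1 : j < 1 := by exact_mod_cast h1
    have h2 : -j < 1 := by exact_mod_cast h2
    omega
  subst hj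
  simp

theorem not_pt_eq_corner {x y : SignedLabel n} {u : ℝ} (h0 : 0 < u) (h1 : u < 1) :
    b.pt x u ≠ b.pt y 1 := by
  intro h
  have := (eq_of_pt_eq (by simp) (by simp) h (by simp; linarith) (by simp; linarith)).2
  have : u = 1 := by exact_mod_cast this
  linarith

theorem Rel.symm {p p' : Polygons C} (h : b.Rel p p') : b.Rel p' p := by
  cases h with
  | refl => exact .refl _
  | side x u h0 h1 =>
    have := Rel.side (b := b) x.flip (1 - u) (by linarith) (by linarith)
    simpa using this
  | corner q k k' => exact .corner q k' k

theorem Rel.trans {p p' p'' : Polygons C} (h : b.Rel p p') (h' : b.Rel p' p'') : b.Rel p p'' := by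
  cases h with
  | refl => exact h'
  | side x u h0 h1 =>
    generalize hp : b.pt x.flip (1 - u : ℝ) = p' at h'
    cases h' with
    | refl => rw [← hp]; exact .side x u h0 h1
    | side y v h0' h1' =>
      obtain ⟨rfl, hv⟩ := eq_of_pt_eq (by simp) (by simp) hp (by simp; linarith) (by simp; linarith)
      obtain rfl : v = 1 - u := by exact_mod_cast hv.symm
      simpa using Rel.refl _
    | corner q k k' => exact absurd hp (not_pt_eq_corner (by linarith) (by linarith))
  | corner q k k' =>
    generalize hp : b.pt (q.1 k') 1 = p' at h'
    cases h' with
    | refl => rw [← hp]; exact .corner q k k'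
    | side y v h0' h1' => exact absurd hp.symm (not_pt_eq_corner h0' h1')
    | corner q' l l' =>
      obtain ⟨h, -⟩ := eq_of_pt_eq (by simp) (by simp) hp (by simp) (by simp)
      obtain ⟨rfl, rfl⟩ := quad_injective h
      exact .corner q k l'

theorem succ_quad (q : C.quads) (k : Fin 4) : C.succ (q.1 k) = (q.1 (k + 1)).flip :=
  C.succ_apply q.2 k

/-- The beginning of a side is the corner of the end of the opposite side. -/
theorem rel_zero_one (b : C.Start) (x : SignedLabel n) : b.Rel (b.pt x 0) (b.pt x.flip 1) := by
  obtain ⟨q, k, hk⟩ := exists_quad C x.flip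
  obtain ⟨k, rfl⟩ : ∃ l, k = l + 1 := ⟨k - 1, by simp⟩
  have h : C.succ (q.1 k) = x := by rw [succ_quad, hk, flip_flip]
  have h1 : b.pt x 0 = b.pt (q.1 k) 1 := by rw [← h, ← pt_add_one, zero_add]
  rw [h1, ← hk]
  exact .corner q _ _

theorem rel_flip (b : C.Start) (x : SignedLabel n) {u : ℝ} (hu : u ∈ Set.Icc (0 : ℝ) 1) :
    b.Rel (b.pt x u) (b.pt x.flip (1 - u : ℝ)) := by
  rcases hu.1.eq_or_lt with rfl | h0
  · simpa using b.rel_zero_one x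
  rcases hu.2.eq_or_lt with rfl | h1
  · simpa using (b.rel_zero_one x.flip).symm
  exact .side x u h0 h1

/-- The quotient map from the polygons to the complex. -/
def proj (b : C.Start) (p : Polygons C) : b.Complex := Quot.mk _ p

theorem proj_pt_flip (b : C.Start) (x : SignedLabel n) {u : ℝ} (hu : u ∈ Set.Icc (0 : ℝ) 1) :
    b.proj (b.pt x.flip (1 - u : ℝ)) = b.proj (b.pt x u) := by
  have h1 := sidePoint_eq_pt b (C.faceOf x) (b.idx x) u
  have h2 := sidePoint_eq_pt b (C.faceOf x.flip) (b.idx x.flip) (1 - u)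
  rw [side_idx] at h1 h2
  rw [← h1, ← h2]
  exact (Quot.sound (.side _ _ _ _ (by rw [side_idx, side_idx]) u hu)).symm

theorem proj_corner_succ (b : C.Start) (q : C.quads) (k : Fin 4) :
    b.proj (b.pt (q.1 (k + 1)) 1) = b.proj (b.pt (q.1 k) 1) := by
  have h1 : b.pt (q.1 k) 1 = b.pt (q.1 (k + 1)).flip 0 := by
    rw [← succ_quad, ← pt_add_one, zero_add]
  have h2 := b.proj_pt_flip (q.1 (k + 1)).flip (u := 0) (by simp)
  rw [flip_flip] at h2
  rw [h1]
  simpa using h2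

theorem proj_corner (b : C.Start) (q : C.quads) (k k' : Fin 4) :
    b.proj (b.pt (q.1 k) 1) = b.proj (b.pt (q.1 k') 1) := by
  have h : ∀ k : Fin 4, b.proj (b.pt (q.1 k) 1) = b.proj (b.pt (q.1 0) 1) := by
    have h0 := b.proj_corner_succ q 0
    have h1 := b.proj_corner_succ q 1
    have h2 := b.proj_corner_succ q 2
    intro k
    fin_cases k
    · rfl
    · exact h0
    · exact h1.trans h0
    · exact h2.trans (h1.trans h0)
  rw [h, h k']

/-- The explicit relation is the equivalence relation generated by the gluing. -/
theorem proj_eq_iff {p p' : Polygons C} : b.proj p = b.proj p' ↔ b.Rel p p' := by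
  constructor
  · intro h
    have := Quot.eqvGen_exact h
    clear h
    induction this with
    | rel p p' h =>
      cases h with
      | side f f' m m' h u hu =>
        rw [sidePoint_eq_pt, sidePoint_eq_pt, h]
        exact b.rel_flip _ hu
    | refl => exact .refl _
    | symm _ _ _ h => exact h.symm
    | trans _ _ _ _ _ h h' => exact h.trans h'
  · intro h
    cases h with
    | refl => rfl
    | side x u h0 h1 => exact (b.proj_pt_flip x ⟨h0.le, h1.le⟩).symm
    | corner q k k' => exact b.proj_corner q k k'

theorem proj_surjective (b : C.Start) : Function.Surjective b.proj := Quot.mk_surjective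

theorem isQuotientMap_proj (b : C.Start) : IsQuotientMap b.proj := isQuotientMap_quot_mk

@[fun_prop] theorem continuous_proj (b : C.Start) : Continuous b.proj :=
  b.isQuotientMap_proj.continuous

/-- The identifications form a closed set, which makes the quotient map closed. -/
theorem isClosed_rel (b : C.Start) : IsClosed {p : Polygons C × Polygons C | b.Rel p.1 p.2} := by
  have h : {p : Polygons C × Polygons C | b.Rel p.1 p.2} = {p | p.1 = p.2} ∪
      (⋃ x : SignedLabel n, (fun u : ℝ => (b.pt x u, b.pt x.flip (1 - u : ℝ))) '' Set.Icc 0 1) ∪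
      ⋃ (a : C.quads × Fin 4 × Fin 4), {(b.pt (a.1.1 a.2.1) 1, b.pt (a.1.1 a.2.2) 1)} := by
    ext ⟨p, p'⟩
    simp only [Set.mem_ofPred_eq, Set.mem_union, Set.mem_iUnion, Set.mem_image, Prod.mk.injEq,
      Set.mem_singleton_iff]
    constructor
    · intro h
      cases h with
      | refl => exact Or.inl (Or.inl rfl)
      | side x u h0 h1 => exact Or.inl (Or.inr ⟨x, u, ⟨h0.le, h1.le⟩, rfl, rfl⟩)
      | corner q k k' => exact Or.inr ⟨(q, k, k'), rfl, rfl⟩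
    · rintro ((rfl | ⟨x, u, hu, rfl, rfl⟩) | ⟨⟨q, k, k'⟩, rfl, rfl⟩)
      · exact .refl _
      · exact b.rel_flip x hu
      · exact .corner q k k'
  rw [h]
  refine ((isClosed_eq continuous_fst continuous_snd).union ?_).union ?_
  · refine isClosed_iUnion_of_finite fun x => ?_
    refine (isCompact_Icc.image ?_).isClosed
    fun_prop
  · exact isClosed_iUnion_of_finite fun _ => isClosed_singleton

theorem isClosedMap_proj (b : C.Start) : IsClosedMap b.proj := by
  intro A hA
  rw [← b.isQuotientMap_proj.isClosed_preimage]
  have : b.proj ⁻¹' (b.proj '' A) = Prod.snd '' ({p : Polygons C × Polygons C | b.Rel p.1 p.2} ∩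
      Prod.fst ⁻¹' A) := by
    ext p
    simp only [Set.mem_preimage, Set.mem_image, Set.mem_inter_iff, Set.mem_ofPred_eq, Prod.exists,
      proj_eq_iff]
    constructor
    · rintro ⟨a, ha, h⟩; exact ⟨a, p, ⟨h, ha⟩, rfl⟩
    · rintro ⟨a, _, ⟨h, ha⟩, rfl⟩; exact ⟨a, ha, h⟩
  rw [this]
  exact isClosedMap_snd_of_compactSpace _ (b.isClosed_rel.inter (hA.preimage continuous_fst))

/-- Neighbourhoods in the complex can be recognized on the polygons. -/
theorem mem_nhds_proj {p : Polygons C} {N : Set b.Complex}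
    (h : ∀ p', b.Rel p p' → b.proj ⁻¹' N ∈ 𝓝 p') : N ∈ 𝓝 (b.proj p) := by
  have h1 : IsOpen (b.proj '' (interior (b.proj ⁻¹' N))ᶜ)ᶜ :=
    (b.isClosedMap_proj _ isOpen_interior.isClosed_compl).isOpen_compl
  refine mem_of_superset (h1.mem_nhds ?_) ?_
  · rintro ⟨p', hp', h2⟩
    exact hp' (mem_interior_iff_mem_nhds.2 (h p' (proj_eq_iff.1 h2).symm))
  · intro y hy
    obtain ⟨p', rfl⟩ := b.proj_surjective y
    by_contra h2
    exact hy ⟨p', fun h3 => h2 (interior_subset (s := b.proj ⁻¹' N) h3), rfl⟩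

instance (b : C.Start) : CompactSpace b.Complex :=
  inferInstanceAs (CompactSpace (Quot b.Glue))

instance (b : C.Start) : T2Space b.Complex where
  t2 := by
    intro y y' hy
    obtain ⟨p, rfl⟩ := b.proj_surjective y
    obtain ⟨p', rfl⟩ := b.proj_surjective y'
    have hc : ∀ y : b.Complex, IsClosed (b.proj ⁻¹' {y}) := by
      intro y
      obtain ⟨p, rfl⟩ := b.proj_surjective y
      refine IsClosed.preimage b.continuous_proj ?_
      rw [← Set.image_singleton]
      exact b.isClosedMap_proj _ isClosed_singleton
    obtain ⟨U, V, hU, hV, hpU, hpV, hUV⟩ := SeparatedNhds.of_isCompact_isCompact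
      (hc (b.proj p)).isCompact (hc (b.proj p')).isCompact
      (Disjoint.preimage _ (Set.disjoint_singleton.2 hy))
    refine ⟨(b.proj '' Uᶜ)ᶜ, (b.proj '' Vᶜ)ᶜ, (b.isClosedMap_proj _ hU.isClosed_compl).isOpen_compl,
      (b.isClosedMap_proj _ hV.isClosed_compl).isOpen_compl, ?_, ?_, ?_⟩
    · rintro ⟨a, ha, h⟩; exact ha (hpU h)
    · rintro ⟨a, ha, h⟩; exact ha (hpV h)
    · rw [Set.disjoint_left]
      intro y h1 h2
      obtain ⟨a, rfl⟩ := b.proj_surjective y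
      have h3 : a ∈ U := by by_contra h3; exact h1 ⟨a, h3, rfl⟩
      have h4 : a ∈ V := by by_contra h4; exact h2 ⟨a, h4, rfl⟩
      exact Set.disjoint_left.1 hUV h3 h4

end Start

end PDCode

/-! ### Parametrizations related by holomorphic coordinate changes -/

/-- Near `x`, the parametrization `φ` is the parametrization `ψ` (near `y`) after a holomorphic
coordinate change with nonzero derivative. -/
def GermEquiv {X : Type*} (φ : ℂ → X) (x : ℂ) (ψ : ℂ → X) (y : ℂ) : Prop :=
  ∃ τ : ℂ → ℂ, ContDiffAt ℂ ∞ τ x ∧ deriv τ x ≠ 0 ∧ τ x = y ∧ φ =ᶠ[𝓝 x] ψ ∘ τ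

namespace GermEquiv

variable {X : Type*} {φ ψ χ : ℂ → X} {x y z : ℂ}

theorem refl (φ : ℂ → X) (x : ℂ) : GermEquiv φ x φ x :=
  ⟨id, contDiffAt_id, by simp, rfl, EventuallyEq.rfl⟩

theorem apply_eq (h : GermEquiv φ x ψ y) : φ x = ψ y := by
  obtain ⟨τ, -, -, rfl, h⟩ := h
  exact h.eq_of_nhds

theorem of_hasDerivAt {τ : ℂ → ℂ} {τ' : ℂ} (hd : Differentiable ℂ τ) (h : HasDerivAt τ τ' x)
    (h0 : τ' ≠ 0) (hx : τ x = y) (he : φ =ᶠ[𝓝 x] ψ ∘ τ) : GermEquiv φ x ψ y :=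
  ⟨τ, hd.contDiff.contDiffAt, by rwa [h.deriv], hx, he⟩

theorem trans (h : GermEquiv φ x ψ y) (h' : GermEquiv ψ y χ z) : GermEquiv φ x χ z := by
  obtain ⟨τ, h1, h2, rfl, h3⟩ := h
  obtain ⟨σ, h1', h2', rfl, h3'⟩ := h'
  refine ⟨σ ∘ τ, h1'.comp x h1, ?_, rfl, ?_⟩
  · rw [deriv_comp _ (h1'.differentiableAt (by simp)) (h1.differentiableAt (by simp))]
    exact mul_ne_zero h2' h2
  · filter_upwards [h3, h1.continuousAt.eventually h3'] with a ha hb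
    rw [ha]
    exact hb

theorem symm (h : GermEquiv φ x ψ y) : GermEquiv ψ y φ x := by
  obtain ⟨τ, h1, h2, rfl, h3⟩ := h
  have hd : HasFDerivAt τ
      ((ContinuousLinearEquiv.unitsEquivAut ℂ (Units.mk0 _ h2) : ℂ ≃L[ℂ] ℂ) : ℂ →L[ℂ] ℂ) x := by
    have := (h1.differentiableAt (by simp)).hasDerivAt.hasFDerivAt
    convert! this using 1
  set e := h1.toOpenPartialHomeomorph τ hd (by simp) with he
  have hx : x ∈ e.source := h1.mem_toOpenPartialHomeomorph_source hd (by simp)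
  have hex : e.symm (τ x) = x := e.left_inv hx
  have hy : τ x ∈ e.target := e.map_source hx
  have hc : ContDiffAt ℂ ∞ e.symm (τ x) := h1.to_localInverse hd (by simp)
  refine ⟨e.symm, hc, ?_, hex, ?_⟩
  · have h4 : HasDerivAt e.symm (deriv τ x)⁻¹ (τ x) := by
      refine e.hasDerivAt_symm hy h2 ?_
      rw [hex]
      exact (h1.differentiableAt (by simp)).hasDerivAt
    rw [h4.deriv]
    exact inv_ne_zero h2
  · have h5 : Tendsto e.symm (𝓝 (τ x)) (𝓝 x) := by
      have := hc.continuousAt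
      rwa [ContinuousAt, hex] at this
    filter_upwards [h5.eventually h3, e.open_target.mem_nhds hy] with a ha hat
    have h6 : τ (e.symm a) = a := e.right_inv hat
    rw [Function.comp, ha, Function.comp, h6]

theorem map_nhds (h : GermEquiv φ x ψ y) : map φ (𝓝 x) = map ψ (𝓝 y) := by
  obtain ⟨τ, h1, h2, rfl, h3⟩ := h
  have h4 : HasStrictDerivAt τ (deriv τ x) x := h1.hasStrictDerivAt (by simp)
  rw [map_congr h3, ← map_map, h4.map_nhds_eq h2]

end GermEquiv

namespace PDCode

variable {μ : ℕ} {n : Fin μ → ℕ} {C : PDCode n}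

/-! ### Holomorphic parametrizations of the complex -/

/-- The open cells of the complex; the edges occur with both signs. They index the charts. -/
inductive Cell (C : PDCode n) : Type
  | face (f : C.Face)
  | edge (x : SignedLabel n)
  | vertex (q : C.quads)

theorem I_pow_three : Complex.I ^ 3 = -Complex.I := by
  rw [pow_succ, Complex.I_sq]; ring

/-- The number of the quadrant in which a complex number lies, where the quadrant `k` includes the
ray through `i ^ k`, but not the one through `i ^ (k + 1)`. -/
def quadrant (ζ : ℂ) : Fin 4 :=
  if 0 < ζ.re ∧ 0 ≤ ζ.im then 0 else if ζ.re ≤ 0 ∧ 0 < ζ.im then 1 else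
    if ζ.re < 0 ∧ ζ.im ≤ 0 then 2 else 3

theorem quadrant_I_pow_mul (k : Fin 4) {η : ℂ} (h0 : 0 < η.re) (h1 : 0 ≤ η.im) :
    quadrant (Complex.I ^ (k : ℕ) * η) = k := by
  have h2 : Complex.I ^ 2 = -1 := Complex.I_sq
  have h3 := I_pow_three
  fin_cases k <;> simp [quadrant, h2, h3, h0, h1, h0.not_ge, h1.not_gt, h0.le]

theorem exists_quadrant (ζ : ℂ) : ∃ (k : Fin 4) (η : ℂ), ζ = Complex.I ^ (k : ℕ) * η ∧
    0 ≤ η.im ∧ (0 < η.re ∨ η = 0) := by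
  have h2 : Complex.I ^ 2 = -1 := Complex.I_sq
  have h3 := I_pow_three
  rcases eq_or_ne ζ 0 with rfl | h
  · exact ⟨0, 0, by simp⟩
  have hI := Complex.I_mul_I
  by_cases a : 0 < ζ.re ∧ 0 ≤ ζ.im
  · exact ⟨0, ζ, by simp, a.2, Or.inl a.1⟩
  by_cases b : ζ.re ≤ 0 ∧ 0 < ζ.im
  · exact ⟨1, -Complex.I * ζ, by simp [← mul_assoc], by simpa using b.1, by simp [b.2]⟩
  by_cases c : ζ.re < 0 ∧ ζ.im ≤ 0
  · exact ⟨2, -ζ, by simp, by simpa using c.2, by simp [c.1]⟩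
  · refine ⟨3, Complex.I * ζ, by simp [h3, ← mul_assoc], ?_, Or.inl ?_⟩
    · simp only [Complex.mul_im, Complex.I_re, zero_mul, Complex.I_im, one_mul, zero_add]
      by_contra! h4
      rcases le_or_gt ζ.im 0 with h5 | h5
      · exact c ⟨h4, h5⟩
      · exact b ⟨h4.le, h5⟩
    · simp only [Complex.mul_re, Complex.I_re, zero_mul, Complex.I_im, one_mul, zero_sub]
      by_contra! h4
      have h4 : 0 ≤ ζ.im := by linarith
      have h5 : ζ.re ≤ 0 := by by_contra! h5; exact a ⟨h5, h4⟩
      have h6 : ζ.im = 0 := by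
        by_contra h6
        exact b ⟨h5, lt_of_le_of_ne h4 (Ne.symm h6)⟩
      have h7 : ζ.re = 0 := by
        by_contra h7
        exact c ⟨lt_of_le_of_ne h5 h7, h6.le⟩
      exact h (Complex.ext h7 h6)

theorem I_pow_fin_add_one (k : Fin 4) :
    Complex.I ^ ((k + 1 : Fin 4) : ℕ) = Complex.I ^ (k : ℕ) * Complex.I := by
  have h2 : Complex.I ^ 2 = -1 := Complex.I_sq
  have h3 := I_pow_three
  fin_cases k <;> simp [h2, h3]

theorem I_pow_fin_add_two (k : Fin 4) :
    Complex.I ^ ((k + 2 : Fin 4) : ℕ) = -Complex.I ^ (k : ℕ) := by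
  have : k + 2 = k + 1 + 1 := by rw [add_assoc]; rfl
  rw [this, I_pow_fin_add_one, I_pow_fin_add_one, mul_assoc, Complex.I_mul_I, mul_neg_one]

theorem norm_I_pow_mul (k : ℕ) (η : ℂ) : ‖Complex.I ^ k * η‖ = ‖η‖ := by simp

theorem neg_I_pow_mul (k : ℕ) (η : ℂ) : (-Complex.I) ^ k * (Complex.I ^ k * η) = η := by
  rw [← mul_assoc, ← mul_pow]; simp

/-- A complex number in the closed upper half plane has a square root in the first quadrant. -/
theorem exists_sq_eq {v : ℂ} (hv : 0 ≤ v.im) : ∃ η : ℂ, η ^ 2 = v ∧ 0 ≤ η.re ∧ 0 ≤ η.im := by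
  obtain ⟨η, hη⟩ := IsAlgClosed.exists_pow_nat_eq v (n := 2) two_pos
  have him : 0 ≤ 2 * η.re * η.im := by
    have : v.im = 2 * η.re * η.im := by rw [← hη, pow_two, Complex.mul_im]; ring
    rwa [← this]
  rcases lt_trichotomy η.re 0 with h | h | h
  · exact ⟨-η, by simpa using hη, by simpa using h.le, by simp; nlinarith⟩
  · rcases le_total 0 η.im with h1 | h1
    · exact ⟨η, hη, h.ge, h1⟩
    · exact ⟨-η, by simpa using hη, by simp [h], by simpa using h1⟩
  · exact ⟨η, hη, h.le, by nlinarith⟩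

namespace Start

variable (b : C.Start)

/-- The points of the complex in the coordinate `w` along the side with the label `x`. -/
def sec (x : SignedLabel n) (w : ℂ) : b.Complex := b.proj (b.pt x w)

/-- The parametrization of an open cell and of a neighbourhood of it: the open unit disc for a
face, the strip `0 < Re w < 1` for an edge, with the two adjacent polygons below and above the real
axis, and a disc around the origin for a vertex, whose four quadrants are bent by the square map
into half planes that parametrize the corners. -/
def param : Cell C → ℂ → b.Complex
  | .face f, z => b.proj ⟨f, discProj z⟩
  | .edge x, w => if w.im ≤ 0 then b.sec x w else b.sec x.flip (1 - w)
  | .vertex q, ζ => b.sec (q.1 (quadrant ζ)) (1 - ((-Complex.I) ^ (quadrant ζ : ℕ) * ζ) ^ 2)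

/-- The domains of the parametrizations. -/
def _root_.PDCode.Cell.dom : Cell C → Set ℂ
  | .face _ => Metric.ball 0 1
  | .edge _ => {w | 0 < w.re ∧ w.re < 1}
  | .vertex _ => Metric.ball 0 (1 / 2)

theorem _root_.PDCode.Cell.isOpen_dom (c : Cell C) : IsOpen c.dom := by
  cases c with
  | face f => exact Metric.isOpen_ball
  | edge x =>
    exact (isOpen_lt continuous_const Complex.continuous_re).inter
      (isOpen_lt Complex.continuous_re continuous_const)
  | vertex q => exact Metric.isOpen_ball

variable {b}

@[fun_prop] theorem continuous_sec (x : SignedLabel n) : Continuous (b.sec x) :=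
  b.continuous_proj.comp (continuous_pt x)

theorem sec_flip (x : SignedLabel n) {u : ℝ} (hu : u ∈ Set.Icc (0 : ℝ) 1) :
    b.sec x.flip (1 - u : ℝ) = b.sec x u :=
  b.proj_pt_flip x hu

theorem sec_quad (q : C.quads) (k k' : Fin 4) : b.sec (q.1 k) 1 = b.sec (q.1 k') 1 :=
  b.proj_corner q k k'

theorem param_edge_of_nonpos (x : SignedLabel n) {w : ℂ} (h : w.im ≤ 0) :
    b.param (.edge x) w = b.sec x w := if_pos h

theorem param_edge_of_nonneg (x : SignedLabel n) {w : ℂ} (hw : w ∈ (Cell.edge (C := C) x).dom)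
    (h : 0 ≤ w.im) : b.param (.edge x) w = b.sec x.flip (1 - w) := by
  rcases h.eq_or_lt with h | h
  · rw [param_edge_of_nonpos x h.ge]
    have : w = (w.re : ℝ) := Complex.ext (by simp) (by simp [← h])
    rw [this]
    exact_mod_cast (sec_flip x ⟨hw.1.le, hw.2.le⟩).symm
  · exact if_neg h.not_ge

theorem param_edge_flip (x : SignedLabel n) {w : ℂ} (hw : w ∈ (Cell.edge (C := C) x).dom) :
    b.param (.edge x.flip) (1 - w) = b.param (.edge x) w := by
  rcases le_total w.im 0 with h | h
  · rw [param_edge_of_nonpos x h, param_edge_of_nonneg _ _ (by simpa using h)]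
    · simp
    · have h1 := hw.1
      have h2 := hw.2
      constructor <;> simp <;> linarith
  · rw [param_edge_of_nonneg x hw h, param_edge_of_nonpos _ (by simpa using h)]

theorem param_vertex_zero (q : C.quads) (k : Fin 4) : b.param (.vertex q) 0 = b.sec (q.1 k) 1 := by
  simp only [param, mul_zero, ne_eq, OfNat.ofNat_ne_zero, not_false_eq_true, zero_pow, sub_zero]
  exact sec_quad q _ k

/-- The parametrization at a vertex on each of the four closed quadrants. -/
theorem param_vertex (q : C.quads) (k : Fin 4) {η : ℂ} (h0 : 0 ≤ η.re) (h1 : 0 ≤ η.im)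
    (h2 : ‖η‖ ≤ 1) : b.param (.vertex q) (Complex.I ^ (k : ℕ) * η) = b.sec (q.1 k) (1 - η ^ 2) := by
  have key : ∀ (k : Fin 4) {η : ℂ}, 0 < η.re → 0 ≤ η.im →
      b.param (.vertex q) (Complex.I ^ (k : ℕ) * η) = b.sec (q.1 k) (1 - η ^ 2) := by
    intro k η h0 h1
    simp only [param]
    rw [quadrant_I_pow_mul k h0 h1, neg_I_pow_mul]
  rcases h0.lt_or_eq with h0 | h0
  · exact key k h0 h1
  rcases h1.lt_or_eq with h1 | h1
  · have hη : η = Complex.I * (η.im : ℝ) := Complex.ext (by simp [← h0]) (by simp)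
    have h3 : Complex.I ^ (k : ℕ) * η = Complex.I ^ ((k + 1 : Fin 4) : ℕ) * (η.im : ℝ) := by
      rw [I_pow_fin_add_one, mul_assoc, ← hη]
    have h4 : η.im ≤ 1 := (Complex.im_le_norm η).trans h2
    rw [h3, key (k + 1) (by simpa using h1) (by simp)]
    have h5 := sec_flip (b := b) (q.1 (k + 1)).flip (u := η.im ^ 2) ⟨by positivity, by nlinarith⟩
    rw [flip_flip] at h5
    have h6 : (1 - η ^ 2 : ℂ) = (η.im ^ 2 : ℝ) + 1 := by
      conv_lhs => rw [hη]
      rw [mul_pow, Complex.I_sq]; push_cast; ring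
    have h7 : b.sec (q.1 k) ((η.im ^ 2 : ℝ) + 1) = b.sec (q.1 (k + 1)).flip (η.im ^ 2 : ℝ) := by
      rw [sec, pt_add_one, succ_quad, sec]
    rw [h6, h7, ← h5]
    push_cast
    rfl
  · obtain rfl : η = 0 := Complex.ext h0.symm h1.symm
    simpa using param_vertex_zero q k

/-! ### Coordinate changes -/

/-- One chart is singled out for every point, that of the open cell that contains it: the points of
faces, the real points of the strips for the positive edge labels, and the origin for vertices. -/
def _root_.PDCode.Cell.IsCanonical : Cell C → ℂ → Prop
  | .face _, z => ‖z‖ < 1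
  | .edge x, w => x.2 = 1 ∧ w.im = 0 ∧ 0 < w.re ∧ w.re < 1
  | .vertex _, ζ => ζ = 0

theorem germEquiv_edge_flip (x : SignedLabel n) {w : ℂ} (hw : w ∈ (Cell.edge (C := C) x).dom) :
    GermEquiv (b.param (.edge x)) w (b.param (.edge x.flip)) (1 - w) := by
  refine .of_hasDerivAt (τ := fun w => 1 - w) (by fun_prop) ((hasDerivAt_id w).const_sub 1)
    (by simp) rfl ?_
  filter_upwards [(Cell.isOpen_dom (C := C) (.edge x)).mem_nhds hw] with a ha
  exact (param_edge_flip x ha).symm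

theorem germEquiv_edge_face (x : SignedLabel n) {w : ℂ} (hw : w.im < 0) :
    GermEquiv (b.param (.edge x)) w (b.param (.face (C.faceOf x)))
      (turn (b.numSides (C.faceOf x)) (b.idx x + w)) := by
  have hN := b.numSides_pos (C.faceOf x)
  refine .of_hasDerivAt (τ := fun w => turn (b.numSides (C.faceOf x)) (b.idx x + w))
    ((differentiable_turn _).comp (by fun_prop)) ((hasDerivAt_turn _ _).comp_const_add _ _)
    ?_ rfl ?_
  · refine mul_ne_zero (Complex.exp_ne_zero _)
      (div_ne_zero (neg_ne_zero.2 Complex.two_pi_I_ne_zero) ?_)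
    exact_mod_cast hN.ne'
  · filter_upwards [(isOpen_lt Complex.continuous_im continuous_const).mem_nhds hw] with a ha
    exact param_edge_of_nonpos x (le_of_lt ha)

theorem exists_canonical_edge (x : SignedLabel n) {w : ℂ} (hw : w ∈ (Cell.edge (C := C) x).dom) :
    ∃ (c : Cell C) (y : ℂ), c.IsCanonical y ∧
      GermEquiv (b.param (.edge x)) w (b.param c) y := by
  have key : ∀ (x : SignedLabel n) {w : ℂ}, w.im < 0 → ∃ (c : Cell C) (y : ℂ), c.IsCanonical y ∧
      GermEquiv (b.param (.edge x)) w (b.param c) y := by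
    intro x w hw
    exact ⟨.face (C.faceOf x), _, (norm_turn_lt (b.numSides_pos _)).2 (by simpa using hw),
      germEquiv_edge_face x hw⟩
  rcases lt_trichotomy w.im 0 with h | h | h
  · exact key x h
  · rcases Int.units_eq_one_or x.2 with h1 | h1
    · exact ⟨.edge x, w, ⟨h1, h, hw⟩, .refl _ _⟩
    · refine ⟨.edge x.flip, 1 - w, ⟨?_, ?_, ?_, ?_⟩, germEquiv_edge_flip x hw⟩
      · simp [SignedLabel.flip, h1]
      · simp [h]
      · simpa using hw.2
      · simpa using hw.1
  · obtain ⟨c, y, hc, hy⟩ := key x.flip (w := 1 - w) (by simpa using h)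
    exact ⟨c, y, hc, (germEquiv_edge_flip x hw).trans hy⟩

theorem hasDerivAt_corner (k : ℕ) (ζ : ℂ) :
    HasDerivAt (fun ζ : ℂ => 1 - ((-Complex.I) ^ k * ζ) ^ 2)
      (-(2 * ((-Complex.I) ^ k * ζ) * (-Complex.I) ^ k)) ζ := by
  have h := (((hasDerivAt_id ζ).const_mul ((-Complex.I) ^ k)).pow 2).const_sub 1
  simpa using h

/-- On a half plane around the ray of the edge end `q k`, the parametrization at a vertex is the one
of the edge after a square map. -/
theorem param_vertex_eq_edge (q : C.quads) (k : Fin 4) {η : ℂ} (h0 : 0 < η.re)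
    (h2 : ‖η‖ ≤ 1) (hd : 1 - η ^ 2 ∈ (Cell.edge (C := C) (q.1 k)).dom) :
    b.param (.vertex q) (Complex.I ^ (k : ℕ) * η) = b.param (.edge (q.1 k)) (1 - η ^ 2) := by
  have him : (1 - η ^ 2).im = -(2 * η.re * η.im) := by simp [pow_two]; ring
  rcases le_total 0 η.im with h1 | h1
  · rw [param_vertex q k h0.le h1 h2, param_edge_of_nonpos]
    rw [him]; nlinarith
  · rw [param_edge_of_nonneg _ hd (by rw [him]; nlinarith)]
    obtain ⟨l, rfl⟩ : ∃ l, k = l + 1 := ⟨k - 1, by simp⟩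
    rw [I_pow_fin_add_one, mul_assoc, param_vertex q l (by simpa using h1) (by simpa using h0.le)
      (by simpa using h2), mul_pow, Complex.I_sq, ← succ_quad, sec, sec, ← pt_add_one]
    congr 2
    ring

/-- The point `t` on the ray of the edge end `q k` is the point of the edge with the coordinate
`1 - t ^ 2`, and this coordinate change is holomorphic near it. -/
theorem germEquiv_vertex_edge (q : C.quads) (k : Fin 4) {t : ℝ} (h0 : 0 < t) (h1 : t < 1) :
    GermEquiv (b.param (.vertex q)) (Complex.I ^ (k : ℕ) * t) (b.param (.edge (q.1 k)))
      (1 - t ^ 2) := by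
  refine .of_hasDerivAt (by fun_prop) (hasDerivAt_corner k _) ?_ ?_ ?_
  · rw [neg_I_pow_mul]
    simp [h0.ne']
  · simp only [neg_I_pow_mul]
  · have hc : Continuous fun ζ : ℂ => (-Complex.I) ^ (k : ℕ) * ζ := by fun_prop
    have h2 : Tendsto (fun ζ : ℂ => (-Complex.I) ^ (k : ℕ) * ζ) (𝓝 (Complex.I ^ (k : ℕ) * t))
        (𝓝 (t : ℂ)) := by
      have := hc.tendsto (Complex.I ^ (k : ℕ) * t)
      rwa [neg_I_pow_mul] at this
    have h3 : ∀ᶠ η : ℂ in 𝓝 (t : ℂ), 0 < η.re ∧ ‖η‖ < 1 ∧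
        1 - η ^ 2 ∈ (Cell.edge (C := C) (q.1 k)).dom := by
      refine (Continuous.tendsto Complex.continuous_re _ |>.eventually_const_lt (by simpa)).and
        ((continuous_norm.tendsto _ |>.eventually_lt_const ?_).and ?_)
      · simpa [abs_of_pos h0]
      · refine ((continuous_const.sub (continuous_pow 2)).tendsto (t : ℂ)).eventually
          ((Cell.isOpen_dom (C := C) (.edge (q.1 k))).mem_nhds ?_)
        have : (1 - (t : ℂ) ^ 2).re = 1 - t ^ 2 := by
          simp [pow_two]
        constructor
        · change 0 < (1 - (t : ℂ) ^ 2).re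
          rw [this]; nlinarith
        · change (1 - (t : ℂ) ^ 2).re < 1
          rw [this]; nlinarith
    filter_upwards [h2.eventually h3] with ζ hζ
    have h4 : ζ = Complex.I ^ (k : ℕ) * ((-Complex.I) ^ (k : ℕ) * ζ) := by
      rw [← mul_assoc, ← mul_pow]; simp
    conv_lhs => rw [h4]
    exact param_vertex_eq_edge q k hζ.1 hζ.2.1.le hζ.2.2

theorem germEquiv_vertex_face (q : C.quads) (k : Fin 4) {η : ℂ} (h0 : 0 < η.re) (h1 : 0 < η.im) :
    ∃ (c : Cell C) (y : ℂ), c.IsCanonical y ∧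
      GermEquiv (b.param (.vertex q)) (Complex.I ^ (k : ℕ) * η) (b.param c) y := by
  have him : (1 - η ^ 2).im < 0 := by
    have : (1 - η ^ 2).im = -(2 * η.re * η.im) := by simp [pow_two]; ring
    rw [this]; nlinarith [mul_pos h0 h1]
  suffices h : GermEquiv (b.param (.vertex q)) (Complex.I ^ (k : ℕ) * η)
      (b.param (.edge (q.1 k))) (1 - η ^ 2) from
    ⟨.face (C.faceOf (q.1 k)), _, (norm_turn_lt (b.numSides_pos _)).2 (by
      rw [Complex.add_im, Complex.natCast_im, zero_add]; exact him),
      h.trans (germEquiv_edge_face _ him)⟩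
  refine .of_hasDerivAt (by fun_prop) (hasDerivAt_corner k _) ?_ ?_ ?_
  · rw [neg_I_pow_mul]
    have : η ≠ 0 := fun h => by simp [h] at h0
    simp [this]
  · simp only [neg_I_pow_mul]
  · have hc : Continuous fun ζ : ℂ => (-Complex.I) ^ (k : ℕ) * ζ := by fun_prop
    have h2 : Tendsto (fun ζ : ℂ => (-Complex.I) ^ (k : ℕ) * ζ) (𝓝 (Complex.I ^ (k : ℕ) * η))
        (𝓝 η) := by
      have := hc.tendsto (Complex.I ^ (k : ℕ) * η)
      rwa [neg_I_pow_mul] at this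
    have h3 : ∀ᶠ η : ℂ in 𝓝 η, 0 < η.re ∧ 0 < η.im :=
      (Continuous.tendsto Complex.continuous_re _ |>.eventually_const_lt (by simpa)).and
        (Continuous.tendsto Complex.continuous_im _ |>.eventually_const_lt (by simpa))
    filter_upwards [h2.eventually h3] with ζ hζ
    have h4 : ζ = Complex.I ^ (k : ℕ) * ((-Complex.I) ^ (k : ℕ) * ζ) := by
      rw [← mul_assoc, ← mul_pow]; simp
    have h5 : quadrant ζ = k := by
      rw [h4]
      exact quadrant_I_pow_mul k hζ.1 hζ.2.le
    rw [Function.comp, param_edge_of_nonpos]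
    · simp only [param]
      rw [h5]
    · have : (1 - ((-Complex.I) ^ (k : ℕ) * ζ) ^ 2).im = -(2 * ((-Complex.I) ^ (k : ℕ) * ζ).re *
        ((-Complex.I) ^ (k : ℕ) * ζ).im) := by rw [pow_two, Complex.sub_im, Complex.mul_im]; simp; ring
      rw [this]
      nlinarith [mul_pos hζ.1 hζ.2]

/-- Every chart is, near every point of its domain, holomorphically related to the chart of the open
cell that contains the point. -/
theorem exists_canonical (c : Cell C) {x : ℂ} (hx : x ∈ c.dom) :
    ∃ (c' : Cell C) (y : ℂ), c'.IsCanonical y ∧ GermEquiv (b.param c) x (b.param c') y := by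
  cases c with
  | face f => exact ⟨.face f, x, mem_ball_zero_iff.1 hx, .refl _ _⟩
  | edge l => exact exists_canonical_edge l hx
  | vertex q =>
    obtain ⟨k, η, rfl, h1, h0 | rfl⟩ := exists_quadrant x
    · rcases h1.eq_or_lt with h1 | h1
      · have hη : η = (η.re : ℝ) := Complex.ext (by simp) (by simp [← h1])
        have hn : η.re < 1 := by
          have hx : ‖Complex.I ^ (k : ℕ) * η‖ < 1 / 2 := mem_ball_zero_iff.1 hx
          rw [norm_I_pow_mul] at hx
          linarith [Complex.re_le_norm η]
        have h := germEquiv_vertex_edge (b := b) q k h0 hn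
        obtain ⟨c, y, hc, hy⟩ := exists_canonical_edge (b := b) (q.1 k) (w := 1 - (η.re : ℂ) ^ 2) (by
          have : (1 - (η.re : ℂ) ^ 2).re = 1 - η.re ^ 2 := by simp [pow_two]
          constructor <;> rw [this] <;> nlinarith)
        rw [hη]
        exact ⟨c, y, hc, h.trans hy⟩
      · exact germEquiv_vertex_face q k h0 h1
    · exact ⟨.vertex q, _, by simp [Cell.IsCanonical], .refl _ _⟩

/-! ### Which points of the polygons are identified -/

theorem norm_pt_ofReal (x : SignedLabel n) (u : ℝ) : ¬ ‖((b.pt x u).2 : ℂ)‖ < 1 := by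
  rw [norm_pt_lt (by simp)]; simp

theorem Rel.eq_of_norm_lt {p p' : Polygons C} (h : b.Rel p p') (hp : ‖(p.2 : ℂ)‖ < 1) :
    p = p' := by
  cases h with
  | refl => rfl
  | side x u h0 h1 => exact absurd hp (norm_pt_ofReal _ _)
  | corner q k k' => exact absurd hp (by exact_mod_cast norm_pt_ofReal (b := b) (q.1 k) 1)

theorem rel_pt_pt {x y : SignedLabel n} {u v : ℝ} (hu : 0 < u ∧ u < 1) (hv : 0 < v ∧ v < 1)
    (h : b.Rel (b.pt x u) (b.pt y v)) : x = y ∧ u = v ∨ y = x.flip ∧ v = 1 - u := by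
  have key : ∀ {x y : SignedLabel n} {u v : ℝ}, 0 < u → u < 1 → 0 < v → v < 1 →
      b.pt x u = b.pt y v → x = y ∧ u = v := by
    intro x y u v h0 h1 h2 h3 h
    obtain ⟨rfl, h'⟩ := eq_of_pt_eq (by simp) (by simp) h (by simp; linarith) (by simp; linarith)
    exact ⟨rfl, Complex.ofReal_injective h'⟩
  generalize hp : b.pt x u = p at h
  generalize hp' : b.pt y v = p' at h
  cases h with
  | refl => exact Or.inl (key hu.1 hu.2 hv.1 hv.2 (hp.trans hp'.symm))
  | side z t h0 h1 =>
    obtain ⟨rfl, rfl⟩ := key hu.1 hu.2 h0 h1 hp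
    exact Or.inr (key hv.1 hv.2 (by linarith) (by linarith) hp')
  | corner q k k' => exact absurd hp (not_pt_eq_corner hu.1 hu.2)

theorem not_rel_pt_corner {x y : SignedLabel n} {u : ℝ} (hu : 0 < u ∧ u < 1) :
    ¬ b.Rel (b.pt x u) (b.pt y 1) := by
  intro h
  generalize hp : b.pt x u = p at h
  generalize hp' : b.pt y 1 = p' at h
  cases h with
  | refl => exact not_pt_eq_corner hu.1 hu.2 (hp.trans hp'.symm)
  | side z t h0 h1 => exact not_pt_eq_corner (by linarith) (by linarith) hp'.symm
  | corner q k k' => exact not_pt_eq_corner hu.1 hu.2 hp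

theorem rel_corner_corner {q q' : C.quads} {k k' : Fin 4}
    (h : b.Rel (b.pt (q.1 k) 1) (b.pt (q'.1 k') 1)) : q = q' := by
  have key : ∀ {q q' : C.quads} {k k' : Fin 4},
      b.pt (q.1 k) 1 = b.pt (q'.1 k') 1 → q = q' := by
    intro q q' k k' h
    exact (quad_injective (eq_of_pt_eq (by simp) (by simp) h (by simp) (by simp)).1).1
  generalize hp : b.pt (q.1 k) 1 = p at h
  generalize hp' : b.pt (q'.1 k') 1 = p' at h
  cases h with
  | refl => exact key (hp.trans hp'.symm)
  | side z t h0 h1 => exact absurd hp.symm (not_pt_eq_corner h0 h1)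
  | corner q k k' => exact (key hp).trans (key hp').symm

/-- Every point of the complex has a canonical chart. -/
theorem exists_canonical_eq (b : C.Start) (p : b.Complex) :
    ∃ (c : Cell C) (x : ℂ), c.IsCanonical x ∧ b.param c x = p := by
  obtain ⟨p, rfl⟩ := b.proj_surjective p
  by_cases hp : ‖(p.2 : ℂ)‖ < 1
  · exact ⟨.face p.1, p.2, hp, by simp [param]⟩
  obtain ⟨x, w, him, h0, h1, rfl⟩ := b.exists_pt_eq p (fun h => hp (by simp [h]))
  rw [norm_pt_lt him, not_lt] at hp
  obtain ⟨u, rfl⟩ : ∃ u : ℝ, w = u :=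
    ⟨w.re, Complex.ext (by simp) (by simpa using le_antisymm him hp)⟩
  simp only [Complex.ofReal_re] at h0 h1
  rcases h1.lt_or_eq with h1 | rfl
  · rcases Int.units_eq_one_or x.2 with hx | hx
    · exact ⟨.edge x, u, ⟨hx, by simp, by simpa, by simpa⟩, param_edge_of_nonpos x (by simp)⟩
    · refine ⟨.edge x.flip, (1 - u : ℝ), ⟨by simp [SignedLabel.flip, hx], by simp,
        by simpa using h1, by simpa using h0⟩, ?_⟩
      rw [param_edge_of_nonpos _ (by simp)]
      exact sec_flip x ⟨h0.le, h1.le⟩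
  · obtain ⟨q, k, rfl⟩ := exists_quad C x
    exact ⟨.vertex q, 0, rfl, by
      rw [Complex.ofReal_one]; exact param_vertex_zero q k⟩

/-- The canonical charts of a point are unique, since the open cells are disjoint and embedded. -/
theorem canonical_unique {c c' : Cell C} {x x' : ℂ} (hc : c.IsCanonical x) (hc' : c'.IsCanonical x')
    (h : b.param c x = b.param c' x') : c = c' ∧ x = x' := by
  have hedge : ∀ {l : SignedLabel n} {w : ℂ}, (Cell.edge (C := C) l).IsCanonical w →
      ∃ u : ℝ, w = u ∧ (0 < u ∧ u < 1) ∧ b.param (.edge l) w = b.proj (b.pt l u) := by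
    intro l w hw
    have : w = (w.re : ℝ) := Complex.ext (by simp) (by simpa using hw.2.1)
    refine ⟨w.re, this, hw.2.2, ?_⟩
    rw [param_edge_of_nonpos l hw.2.1.le, sec]
    conv_lhs => rw [this]
  have hvert : ∀ (q : C.quads) (k : Fin 4),
      b.param (.vertex q) 0 = b.proj (b.pt (q.1 k) 1) := param_vertex_zero
  have hface : ∀ {f : C.Face} {z : ℂ} {p : Polygons C}, ‖z‖ < 1 →
      b.proj ⟨f, discProj z⟩ = b.proj p → (⟨f, discProj z⟩ : Polygons C) = p := by
    intro f z p hz h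
    refine (proj_eq_iff.1 h).eq_of_norm_lt ?_
    rwa [coe_discProj hz.le]
  have hface' : ∀ {f : C.Face} {z : ℂ} {l : SignedLabel n} {u : ℝ}, ‖z‖ < 1 →
      b.proj ⟨f, discProj z⟩ ≠ b.proj (b.pt l u) := by
    intro f z l u hz h
    refine norm_pt_ofReal (b := b) l u ?_
    rw [← hface hz h, coe_discProj hz.le]
    exact hz
  have hone : ∀ l : SignedLabel n, b.pt l 1 = b.pt l ((1 : ℝ) : ℂ) := by simp
  cases c with
  | face f =>
    cases c' with
    | face f' =>
      have h1 := hface hc h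
      obtain ⟨rfl, h2⟩ := Sigma.mk.inj h1
      refine ⟨rfl, ?_⟩
      have h3 := congrArg Subtype.val (eq_of_heq h2)
      rwa [coe_discProj (le_of_lt hc), coe_discProj (le_of_lt hc')] at h3
    | edge l' =>
      obtain ⟨u, -, -, h'⟩ := hedge hc'
      exact absurd (h.trans h') (hface' hc)
    | vertex q' =>
      obtain rfl : x' = 0 := hc'
      rw [hvert q' 0, hone] at h
      exact absurd h (hface' hc)
  | edge l =>
    obtain ⟨u, rfl, hu, h1⟩ := hedge hc
    cases c' with
    | face f' => exact absurd (h.symm.trans h1) (hface' hc')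
    | edge l' =>
      obtain ⟨u', rfl, hu', h2⟩ := hedge hc'
      rw [h1, h2, proj_eq_iff] at h
      rcases rel_pt_pt hu hu' h with ⟨rfl, rfl⟩ | ⟨rfl, -⟩
      · exact ⟨rfl, rfl⟩
      · have h3 := hc.1
        have h4 := hc'.1
        simp [SignedLabel.flip, h3] at h4
    | vertex q' =>
      obtain rfl : x' = 0 := hc'
      rw [h1, hvert q' 0, proj_eq_iff] at h
      exact absurd h (not_rel_pt_corner hu)
  | vertex q =>
    obtain rfl : x = 0 := hc
    cases c' with
    | face f' =>
      rw [hvert q 0, hone] at h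
      exact absurd h.symm (hface' hc')
    | edge l' =>
      obtain ⟨u, -, hu, h'⟩ := hedge hc'
      rw [h', hvert q 0, eq_comm, proj_eq_iff] at h
      exact absurd h (not_rel_pt_corner hu)
    | vertex q' =>
      obtain rfl : x' = 0 := hc'
      rw [hvert q 0, hvert q' 0, proj_eq_iff] at h
      obtain rfl := rel_corner_corner h
      exact ⟨rfl, rfl⟩

theorem mem_dom_of_canonical {c : Cell C} {x : ℂ} (h : c.IsCanonical x) : x ∈ c.dom := by
  cases c with
  | face f => exact mem_ball_zero_iff.2 h
  | edge l => exact h.2.2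
  | vertex q =>
    obtain rfl : x = 0 := h
    simp [Cell.dom]

/-! ### The parametrizations are injective, continuous and open -/

/-- Inside the strips, the only identifications are those of the two sides of an edge. -/
theorem sec_eq_sec {x y : SignedLabel n} {w w' : ℂ} (hx : w ∈ (Cell.edge (C := C) x).dom)
    (hy : w' ∈ (Cell.edge (C := C) y).dom) (hw : w.im ≤ 0) (hw' : w'.im ≤ 0)
    (h : b.sec x w = b.sec y w') : (x = y ∧ w = w') ∨ (y = x.flip ∧ w' = 1 - w) := by
  have hx1 := hx.1
  have hx2 := hx.2
  have hy1 := hy.1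
  have hy2 := hy.2
  have h' := proj_eq_iff.1 h
  generalize hp : b.pt x w = p at h'
  generalize hp' : b.pt y w' = p' at h'
  cases h' with
  | refl => exact Or.inl (eq_of_pt_eq hw hw' (hp.trans hp'.symm) (by linarith) (by linarith))
  | side z t h0 h1 =>
    obtain ⟨rfl, rfl⟩ := eq_of_pt_eq hw (by simp) hp (by simp; linarith) (by simp; linarith)
    obtain ⟨rfl, rfl⟩ := eq_of_pt_eq hw' (by simp) hp' (by simp; linarith) (by simp; linarith)
    exact Or.inr ⟨rfl, by simp⟩
  | corner q k k' =>
    obtain ⟨rfl, rfl⟩ := eq_of_pt_eq hw (by simp) hp (by simp; linarith) (by simp; linarith)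
    simp at hx2

theorem injOn_param_edge (x : SignedLabel n) :
    Set.InjOn (b.param (.edge x)) (Cell.edge (C := C) x).dom := by
  have key : ∀ (x : SignedLabel n) {w w' : ℂ}, w ∈ (Cell.edge (C := C) x).dom →
      w' ∈ (Cell.edge (C := C) x).dom → w.im ≤ 0 →
      b.param (.edge x) w = b.param (.edge x) w' → w = w' := by
    intro x w w' hw hw' h0 h
    rw [param_edge_of_nonpos x h0] at h
    rcases le_total w'.im 0 with h1 | h1
    · rw [param_edge_of_nonpos x h1] at h
      rcases sec_eq_sec hw hw' h0 h1 h with h2 | h2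
      · exact h2.2
      · exact absurd h2.1.symm (flip_ne x)
    · rw [param_edge_of_nonneg x hw' h1] at h
      have h3 : 1 - w' ∈ (Cell.edge (C := C) x.flip).dom := by
        have := hw'.1
        have := hw'.2
        constructor <;> simp <;> linarith
      rcases sec_eq_sec hw h3 h0 (by simpa using h1) h with h2 | h2
      · exact absurd h2.1.symm (flip_ne x)
      · linear_combination h2.2
  intro w hw w' hw' h
  rcases le_total w.im 0 with h0 | h0
  · exact key x hw hw' h0 h
  · rw [← param_edge_flip x hw, ← param_edge_flip x hw'] at h
    have h3 : ∀ {w : ℂ}, w ∈ (Cell.edge (C := C) x).dom →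
        1 - w ∈ (Cell.edge (C := C) x.flip).dom := by
      intro w hw
      have := hw.1
      have := hw.2
      constructor <;> simp <;> linarith
    have := key x.flip (h3 hw) (h3 hw') (by simpa using h0) h
    linear_combination -this

theorem injOn_param_vertex (q : C.quads) :
    Set.InjOn (b.param (.vertex q)) (Cell.vertex q).dom := by
  intro ζ hζ ζ' hζ' h
  obtain ⟨k, η, rfl, h1, h0⟩ := exists_quadrant ζ
  obtain ⟨k', η', rfl, h1', h0'⟩ := exists_quadrant ζ'
  replace hζ : ‖η‖ < 1 / 2 := by
    rw [← norm_I_pow_mul k η]; exact mem_ball_zero_iff.1 hζ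
  replace hζ' : ‖η'‖ < 1 / 2 := by
    rw [← norm_I_pow_mul k' η']; exact mem_ball_zero_iff.1 hζ'
  have hre : 0 ≤ η.re := by rcases h0 with h | h <;> simp [h, le_of_lt]
  have hre' : 0 ≤ η'.re := by rcases h0' with h | h <;> simp [h, le_of_lt]
  rw [param_vertex q k hre h1 (by linarith), param_vertex q k' hre' h1' (by linarith), sec, sec,
    proj_eq_iff] at h
  have him : ∀ {η : ℂ}, 0 ≤ η.re → 0 ≤ η.im → (1 - η ^ 2).im ≤ 0 := by
    intro η h0 h1
    have : (1 - η ^ 2).im = -(2 * η.re * η.im) := by simp [pow_two]; ring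
    rw [this]; nlinarith [mul_nonneg h0 h1]
  have hsq : ∀ {η : ℂ}, ‖η‖ < 1 / 2 → |(η ^ 2).re| < 1 / 4 := by
    intro η h
    refine (Complex.abs_re_le_norm _).trans_lt ?_
    rw [norm_pow]
    nlinarith [norm_nonneg η]
  have hs := abs_lt.1 (hsq hζ)
  have hs' := abs_lt.1 (hsq hζ')
  have hcor : ∀ {x y : SignedLabel n} {η : ℂ}, 0 ≤ η.re → 0 ≤ η.im → ‖η‖ < 1 / 2 →
      b.pt x (1 - η ^ 2) = b.pt y 1 → η = 0 := by
    intro x y η h0 h1 h2 h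
    have hs := abs_lt.1 (hsq h2)
    have := (eq_of_pt_eq (him h0 h1) (by simp) h (by simp; linarith) (by simp; linarith)).2
    simpa using this
  -- A point strictly inside a side has a coordinate near `1`, hence not near `0`.
  have hside : ∀ {x y : SignedLabel n} {η : ℂ} {u : ℝ}, 0 ≤ η.re → 0 ≤ η.im → 0 < η.re ∨ η = 0 →
      ‖η‖ < 1 / 2 → 0 < u → u < 1 → b.pt x (1 - η ^ 2) = b.pt y u → 1 / 2 < u := by
    intro x y η u hr h1 h0 h2 hu hu' h
    have hs := abs_lt.1 (hsq h2)
    obtain ⟨j, hj, -⟩ := pt_eq_pt (him hr h1) (by simp) h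
    have hj1 := congrArg Complex.re hj
    have hj2 := congrArg Complex.im hj
    simp only [Complex.sub_re, Complex.one_re, Complex.add_re, Complex.ofReal_re,
      Complex.intCast_re] at hj1
    have him0 : η.im = 0 := by
      have h5 : (η ^ 2).im = 2 * η.re * η.im := by rw [pow_two, Complex.mul_im]; ring
      simp only [Complex.sub_im, Complex.one_im, Complex.add_im, Complex.ofReal_im,
        Complex.intCast_im, h5] at hj2
      rcases h0 with h0 | h0
      · by_contra h6
        have : 0 < η.im := lt_of_le_of_ne h1 (Ne.symm h6)
        nlinarith [mul_pos h0 this]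
      · simp [h0]
    have hpos : 0 ≤ (η ^ 2).re := by
      rw [pow_two, Complex.mul_re, him0]; nlinarith
    have hj3 : j = 0 := by
      have h6 : (j : ℝ) < 1 := by linarith
      have h7 : -1 < (j : ℝ) := by linarith
      have h6' : j < 1 := by exact_mod_cast h6
      have h7' : -1 < j := by exact_mod_cast h7
      omega
    rw [hj3] at hj1
    push_cast at hj1
    linarith
  generalize hp : b.pt (q.1 k) (1 - η ^ 2) = p at h
  generalize hp' : b.pt (q.1 k') (1 - η' ^ 2) = p' at h
  cases h with
  | refl =>
    obtain ⟨h2, h3⟩ := eq_of_pt_eq (him hre h1) (him hre' h1') (hp.trans hp'.symm)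
      (by simp; linarith) (by simp; linarith)
    obtain ⟨-, rfl⟩ := quad_injective h2
    have h4 : (η - η') * (η + η') = 0 := by linear_combination -h3
    rcases mul_eq_zero.1 h4 with h4 | h4
    · rw [sub_eq_zero.1 h4]
    · have h5 := congrArg Complex.re h4
      have h6 := congrArg Complex.im h4
      simp only [Complex.add_re, Complex.add_im, Complex.zero_re, Complex.zero_im] at h5 h6
      have : η = η' := Complex.ext (by linarith) (by linarith)
      rw [this]
  | side z u hu hu' =>
    have h2 := hside hre h1 h0 hζ hu hu' hp
    have h3 := hside hre' h1' h0' hζ' (by linarith) (by linarith) hp'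
    linarith
  | corner q' l l' =>
    rw [hcor hre h1 hζ hp, hcor hre' h1' hζ' hp']
    simp

theorem injOn_param (c : Cell C) : Set.InjOn (b.param c) c.dom := by
  cases c with
  | face f =>
    intro z hz z' hz' h
    exact (canonical_unique (c := .face f) (c' := .face f) (mem_ball_zero_iff.1 hz)
      (mem_ball_zero_iff.1 hz') h).2
  | edge x => exact injOn_param_edge x
  | vertex q => exact injOn_param_vertex q

theorem tendsto_param_of_canonical {c : Cell C} {x : ℂ} (h : c.IsCanonical x) :
    Tendsto (b.param c) (𝓝 x) (𝓝 (b.param c x)) := by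
  cases c with
  | face f =>
    exact (b.continuous_proj.comp (continuous_sigmaMk.comp continuous_discProj)).tendsto x
  | edge l =>
    rw [param_edge_of_nonpos l h.2.1.le]
    refine Tendsto.if ?_ ?_
    · exact ((continuous_sec l).tendsto x).mono_left inf_le_left
    · have h1 : b.sec l x = b.sec l.flip (1 - x) := by
        rw [← param_edge_of_nonpos l h.2.1.le, param_edge_of_nonneg l h.2.2 h.2.1.ge]
      rw [h1]
      exact (((continuous_sec l.flip).comp (continuous_const.sub continuous_id)).tendsto
        x).mono_left inf_le_left
  | vertex q =>
    obtain rfl : x = 0 := h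
    refine tendsto_def.2 fun A hA => ?_
    have h1 : ∀ k : Fin 4, ∀ᶠ ζ in 𝓝 (0 : ℂ),
        b.sec (q.1 k) (1 - ((-Complex.I) ^ (k : ℕ) * ζ) ^ 2) ∈ A := by
      intro k
      have hc : Continuous fun ζ : ℂ => b.sec (q.1 k) (1 - ((-Complex.I) ^ (k : ℕ) * ζ) ^ 2) :=
        (continuous_sec _).comp (by fun_prop)
      refine hc.tendsto 0 ?_
      rw [param_vertex_zero q k] at hA
      simpa using hA
    filter_upwards [eventually_all.2 h1] with ζ hζ
    exact hζ _

/-- Openness is checked at all points of the polygons over the given point, of which there are one,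
two or four. -/
theorem nhds_param_le_of_canonical {c : Cell C} {x : ℂ} (h : c.IsCanonical x) :
    𝓝 (b.param c x) ≤ map (b.param c) (𝓝 x) := by
  intro A hA
  rw [mem_map] at hA
  cases c with
  | face f =>
    refine mem_nhds_proj fun p' hp' => ?_
    obtain rfl := hp'.eq_of_norm_lt (by rwa [coe_discProj (le_of_lt h)])
    rw [Sigma.nhds_mk, mem_map, nhds_subtype, mem_comap]
    refine ⟨_, by rwa [coe_discProj (le_of_lt h)], fun z hz => ?_⟩
    have : b.param (.face f) z ∈ A := hz
    simpa [param] using this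
  | edge l =>
    obtain ⟨u, rfl⟩ : ∃ u : ℝ, x = u := ⟨x.re, Complex.ext (by simp) (by simpa using h.2.1)⟩
    have hu : 0 < u ∧ u < 1 := by simpa using h.2.2
    rw [param_edge_of_nonpos l (by simp)]
    refine mem_nhds_proj fun p' hp' => ?_
    have h1 : b.proj ⁻¹' A ∈ 𝓝 (b.pt l u) := by
      refine nhds_pt_le b l (by simp) ?_
      rw [mem_map]
      filter_upwards [mem_nhdsWithin_of_mem_nhds hA, self_mem_nhdsWithin] with w hw hw'
      rw [Set.mem_preimage, param_edge_of_nonpos l hw'] at hw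
      exact hw
    have h2 : b.proj ⁻¹' A ∈ 𝓝 (b.pt l.flip (1 - u : ℝ)) := by
      refine nhds_pt_le b l.flip (by simp) ?_
      rw [mem_map]
      have h3 : Tendsto (fun w : ℂ => 1 - w) (𝓝 ((1 - u : ℝ) : ℂ)) (𝓝 (u : ℂ)) := by
        have : Tendsto (fun w : ℂ => 1 - w) (𝓝 ((1 - u : ℝ) : ℂ)) (𝓝 (1 - ((1 - u : ℝ) : ℂ))) :=
          (continuous_const.sub continuous_id).tendsto _
        have h9 : 1 - ((1 - u : ℝ) : ℂ) = u := by simp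
        rwa [h9] at this
      have h4 : (Cell.edge (C := C) l.flip).dom ∈ 𝓝 ((1 - u : ℝ) : ℂ) :=
        (Cell.isOpen_dom _).mem_nhds ⟨by simpa using hu.2, by simpa using hu.1⟩
      filter_upwards [mem_nhdsWithin_of_mem_nhds (h3 hA), self_mem_nhdsWithin,
        mem_nhdsWithin_of_mem_nhds h4] with w hw hw' hw''
      have h5 := param_edge_flip (b := b) l.flip hw''
      rw [flip_flip, param_edge_of_nonpos l.flip hw'] at h5
      have h6 : b.param (.edge l) (1 - w) ∈ A := hw
      rw [h5] at h6
      exact h6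
    generalize hp : b.pt l u = p at hp' h1
    cases hp' with
    | refl => exact h1
    | side y v h0' h1' =>
      obtain ⟨rfl, hv⟩ := eq_of_pt_eq (by simp) (by simp) hp (by simp; linarith) (by simp; linarith)
      obtain rfl : u = v := by exact_mod_cast hv
      exact h2
    | corner q k k' => exact absurd hp (not_pt_eq_corner hu.1 hu.2)
  | vertex q =>
    obtain rfl : x = 0 := h
    rw [param_vertex_zero q 0]
    refine mem_nhds_proj fun p' hp' => ?_
    have h1 : ∀ k : Fin 4, b.proj ⁻¹' A ∈ 𝓝 (b.pt (q.1 k) 1) := by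
      intro k
      refine nhds_pt_le b (q.1 k) (by simp) ?_
      rw [mem_map]
      obtain ⟨ε, hε, hA⟩ := Metric.mem_nhds_iff.1 hA
      have h2 : Metric.ball (1 : ℂ) (min 1 (ε ^ 2)) ∈ 𝓝 (1 : ℂ) :=
        Metric.ball_mem_nhds _ (by positivity)
      filter_upwards [mem_nhdsWithin_of_mem_nhds h2, self_mem_nhdsWithin] with w hw hw'
      obtain ⟨η, hη, h3, h4⟩ := exists_sq_eq (v := 1 - w) (by simpa using hw')
      rw [Metric.mem_ball_comm, Metric.mem_ball, dist_eq_norm, ← hη, norm_pow, lt_min_iff] at hw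
      have h5 : ‖η‖ < 1 := by nlinarith [norm_nonneg η, hw.1]
      have h6 : ‖η‖ < ε := lt_of_pow_lt_pow_left₀ 2 hε.le hw.2
      have h7 : Complex.I ^ (k : ℕ) * η ∈ b.param (.vertex q) ⁻¹' A :=
        hA (by rwa [mem_ball_zero_iff, norm_I_pow_mul])
      rw [Set.mem_preimage, param_vertex q k h3 h4 h5.le, hη, sub_sub_cancel] at h7
      exact h7
    generalize hp : b.pt (q.1 0) 1 = p at hp'
    cases hp' with
    | refl => rw [← hp]; exact h1 0
    | side y v h0' h1' => exact absurd hp.symm (not_pt_eq_corner h0' h1')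
    | corner q' k k' =>
      obtain ⟨h2, -⟩ := eq_of_pt_eq (by simp) (by simp) hp (by simp) (by simp)
      obtain ⟨rfl, -⟩ := quad_injective h2
      exact h1 k'

/-- The parametrizations are local homeomorphisms. -/
theorem map_nhds_param (c : Cell C) {x : ℂ} (hx : x ∈ c.dom) :
    map (b.param c) (𝓝 x) = 𝓝 (b.param c x) := by
  obtain ⟨c', y, hc, h⟩ := exists_canonical (b := b) c hx
  rw [h.map_nhds, h.apply_eq]
  exact le_antisymm (tendsto_param_of_canonical hc) (nhds_param_le_of_canonical hc)

end Start

end PDCode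

/-! ### Determinants in the plane -/

/-- The identification of the complex plane with the Euclidean plane. -/
def planeEquiv : ℂ ≃L[ℝ] EuclideanSpace ℝ (Fin 2) :=
  Complex.orthonormalBasisOneI.repr.toContinuousLinearEquiv

@[simp] theorem planeEquiv_zero (z : ℂ) : planeEquiv z 0 = z.re := by
  change Complex.orthonormalBasisOneI.repr z 0 = _
  rw [Complex.orthonormalBasisOneI_repr_apply]; rfl

@[simp] theorem planeEquiv_one (z : ℂ) : planeEquiv z 1 = z.im := by
  change Complex.orthonormalBasisOneI.repr z 1 = _
  rw [Complex.orthonormalBasisOneI_repr_apply]; rfl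

theorem det2_planeEquiv (z w : ℂ) :
    det2 (planeEquiv z) (planeEquiv w) = z.re * w.im - z.im * w.re := by
  simp [det2]

theorem det2_map (A : EuclideanSpace ℝ (Fin 2) →L[ℝ] EuclideanSpace ℝ (Fin 2))
    (v w : EuclideanSpace ℝ (Fin 2)) : det2 (A v) (A w) = A.det * det2 v w := by
  have hA : A.det = A (EuclideanSpace.single 0 1) 0 * A (EuclideanSpace.single 1 1) 1 -
      A (EuclideanSpace.single 0 1) 1 * A (EuclideanSpace.single 1 1) 0 := by
    rw [ContinuousLinearMap.det, ← LinearMap.det_toMatrix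
      (EuclideanSpace.basisFun (Fin 2) ℝ).toBasis, Matrix.det_fin_two]
    simp [LinearMap.toMatrix_apply]
    ring
  have hv : ∀ v : EuclideanSpace ℝ (Fin 2),
      A v = v 0 • A (EuclideanSpace.single 0 1) + v 1 • A (EuclideanSpace.single 1 1) := by
    intro v
    rw [← map_smul, ← map_smul, ← map_add]
    congr 1
    ext i
    fin_cases i <;> simp
  rw [hA, hv v, hv w]
  simp only [det2, PiLp.add_apply, PiLp.smul_apply, smul_eq_mul]
  ring

/-- Holomorphic coordinate changes preserve the orientation. -/
theorem det_fderiv_pos {τ : ℂ → ℂ} {y : EuclideanSpace ℝ (Fin 2)}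
    (h : DifferentiableAt ℂ τ (planeEquiv.symm y)) (h0 : deriv τ (planeEquiv.symm y) ≠ 0)
    {F : EuclideanSpace ℝ (Fin 2) → EuclideanSpace ℝ (Fin 2)}
    (hF : F =ᶠ[𝓝 y] planeEquiv ∘ τ ∘ planeEquiv.symm) : 0 < (fderiv ℝ F y).det := by
  set c := deriv τ (planeEquiv.symm y) with hc
  have h1 : HasFDerivAt F ((planeEquiv : ℂ →L[ℝ] EuclideanSpace ℝ (Fin 2)).comp
      (((ContinuousLinearMap.toSpanSingleton ℂ c).restrictScalars ℝ).comp
        (planeEquiv.symm : EuclideanSpace ℝ (Fin 2) →L[ℝ] ℂ))) y := by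
    refine HasFDerivAt.congr_of_eventuallyEq ?_ hF
    refine planeEquiv.hasFDerivAt.comp y (HasFDerivAt.comp y ?_ planeEquiv.symm.hasFDerivAt)
    exact h.hasDerivAt.hasFDerivAt.restrictScalars ℝ
  rw [h1.fderiv]
  set A := ((planeEquiv : ℂ →L[ℝ] EuclideanSpace ℝ (Fin 2)).comp
      (((ContinuousLinearMap.toSpanSingleton ℂ c).restrictScalars ℝ).comp
        (planeEquiv.symm : EuclideanSpace ℝ (Fin 2) →L[ℝ] ℂ)))
  have h2 := det2_map A (planeEquiv 1) (planeEquiv Complex.I)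
  have h3 : ∀ z, A (planeEquiv z) = planeEquiv (z * c) := by
    intro z
    simp [A]
  rw [h3, h3, det2_planeEquiv, det2_planeEquiv] at h2
  simp at h2
  rw [← h2]
  have : 0 < Complex.normSq c := Complex.normSq_pos.2 h0
  rw [Complex.normSq_apply] at this
  exact this

namespace PDCode

variable {μ : ℕ} {n : Fin μ → ℕ} {C : PDCode n}

namespace Start

/-! ### The smooth structure of the complex -/

/-- The parametrizations as homeomorphisms onto open subsets of the complex. -/
def paramHomeo (b : C.Start) (c : Cell C) : OpenPartialHomeomorph ℂ b.Complex :=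
  OpenPartialHomeomorph.ofContinuousOpenRestrict ((injOn_param (b := b) c).toPartialEquiv)
    (fun x hx => ContinuousAt.continuousWithinAt (map_nhds_param c hx).le)
    (by
      have hd : IsOpen ((injOn_param (b := b) c).toPartialEquiv).source := c.isOpen_dom
      refine IsOpenMap.of_nhds_le fun x => ?_
      have h1 := map_nhds_param (b := b) c x.2
      have h2 : map (Subtype.val) (𝓝 x) = 𝓝 x.1 := hd.isOpenEmbedding_subtypeVal.map_nhds_eq x
      rw [← h2, map_map] at h1
      exact h1.ge)
    c.isOpen_dom

/-- The charts of the complex. -/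
def chart (b : C.Start) (c : Cell C) : OpenPartialHomeomorph b.Complex (EuclideanSpace ℝ (Fin 2)) :=
  (b.paramHomeo c).symm.transHomeomorph planeEquiv.toHomeomorph

variable {b : C.Start}

theorem chart_param {c : Cell C} {x : ℂ} (hx : x ∈ c.dom) :
    b.chart c (b.param c x) = planeEquiv x :=
  congrArg planeEquiv ((b.paramHomeo c).left_inv hx)

theorem chart_symm (c : Cell C) (y : EuclideanSpace ℝ (Fin 2)) :
    (b.chart c).symm y = b.param c (planeEquiv.symm y) := rfl

theorem chart_target (c : Cell C) : (b.chart c).target = planeEquiv.symm ⁻¹' c.dom := rfl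

/-- The open cell that contains a point. -/
def cellOf (p : b.Complex) : Cell C := (b.exists_canonical_eq p).choose

theorem cellOf_param {c : Cell C} {x : ℂ} (h : c.IsCanonical x) :
    cellOf (b.param c x) = c := by
  obtain ⟨y, hy, h2⟩ := (b.exists_canonical_eq (b.param c x)).choose_spec
  exact (canonical_unique hy h h2).1

instance (b : C.Start) : ChartedSpace (EuclideanSpace ℝ (Fin 2)) b.Complex where
  atlas := Set.range b.chart
  chartAt p := b.chart (cellOf p)
  mem_chart_source p := by
    obtain ⟨y, hy, h2⟩ := (b.exists_canonical_eq p).choose_spec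
    exact ⟨y, mem_dom_of_canonical hy, h2⟩
  chart_mem_atlas _ := ⟨_, rfl⟩

theorem chartAt_param {c : Cell C} {x : ℂ} (h : c.IsCanonical x) :
    chartAt (EuclideanSpace ℝ (Fin 2)) (b.param c x) = b.chart c :=
  congrArg b.chart (cellOf_param h)

/-- Any two charts are holomorphically related. -/
theorem germEquiv_param {c c' : Cell C} {x x' : ℂ} (hx : x ∈ c.dom) (hx' : x' ∈ c'.dom)
    (h : b.param c x = b.param c' x') : GermEquiv (b.param c) x (b.param c') x' := by
  obtain ⟨d, y, hd, hy⟩ := exists_canonical (b := b) c hx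
  obtain ⟨d', y', hd', hy'⟩ := exists_canonical (b := b) c' hx'
  obtain ⟨rfl, rfl⟩ := canonical_unique hd hd' (hy.apply_eq.symm.trans (h.trans hy'.apply_eq))
  exact hy.trans hy'.symm

/-- Coordinate changes are holomorphic with nonzero derivative. -/
theorem exists_transition {c c' : Cell C} {y : EuclideanSpace ℝ (Fin 2)}
    (hy : y ∈ ((b.chart c).symm.trans (b.chart c')).source) :
    ∃ τ : ℂ → ℂ, ContDiffAt ℂ ∞ τ (planeEquiv.symm y) ∧ deriv τ (planeEquiv.symm y) ≠ 0 ∧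
      (b.chart c).symm.trans (b.chart c') =ᶠ[𝓝 y] planeEquiv ∘ τ ∘ planeEquiv.symm := by
  rw [OpenPartialHomeomorph.trans_source, OpenPartialHomeomorph.symm_source] at hy
  obtain ⟨h1, x', hx', h2⟩ := hy
  rw [chart_symm] at h2
  obtain ⟨τ, h3, h4, h5, h6⟩ := germEquiv_param (c := c) h1 hx' h2.symm
  refine ⟨τ, h3, h4, ?_⟩
  have hc : Tendsto planeEquiv.symm (𝓝 y) (𝓝 (planeEquiv.symm y)) :=
    planeEquiv.symm.continuous.tendsto y
  have h7 : ∀ᶠ x in 𝓝 (planeEquiv.symm y), τ x ∈ c'.dom :=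
    h3.continuousAt.eventually (c'.isOpen_dom.mem_nhds (by rwa [h5]))
  filter_upwards [hc.eventually h6, hc.eventually h7] with a ha ha'
  change b.chart c' ((b.chart c).symm a) = planeEquiv (τ (planeEquiv.symm a))
  rw [chart_symm, ha]
  exact chart_param ha'

instance (b : C.Start) : IsManifold (𝓡 2) ∞ b.Complex := by
  refine isManifold_of_contDiffOn _ _ _ ?_
  rintro _ _ ⟨c, rfl⟩ ⟨c', rfl⟩ y hy
  obtain ⟨τ, h1, -, h2⟩ := exists_transition (b := b) (by simpa using hy)
  refine ContDiffAt.contDiffWithinAt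
    (ContDiffAt.congr_of_eventuallyEq (f := planeEquiv ∘ τ ∘ planeEquiv.symm) ?_ h2)
  exact planeEquiv.contDiff.contDiffAt.comp y
    ((h1.restrict_scalars ℝ).comp y planeEquiv.symm.contDiff.contDiffAt)

/-- The complex as a smooth closed oriented surface. -/
def surface (b : C.Start) : ClosedOrientedSurface where
  carrier := b.Complex
  oriented := by
    rintro _ ⟨c, rfl⟩ _ ⟨c', rfl⟩ y hy
    obtain ⟨τ, h1, h0, h2⟩ := exists_transition (b := b) hy
    exact det_fderiv_pos (h1.differentiableAt (by simp)) h0 h2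

theorem contMDiffOn_param (b : C.Start) (c : Cell C) :
    ContMDiffOn 𝓘(ℝ, ℂ) (𝓡 2) ∞ (b.param c) c.dom := by
  have h1 : ContMDiffOn (𝓡 2) (𝓡 2) ∞ (b.chart c).symm (b.chart c).target :=
    contMDiffOn_symm_of_mem_maximalAtlas (IsManifold.subset_maximalAtlas ⟨c, rfl⟩)
  have h2 : ContMDiff 𝓘(ℝ, ℂ) (𝓡 2) ∞ planeEquiv := planeEquiv.contDiff.contMDiff
  have h3 := h1.comp (s := c.dom) h2.contMDiffOn (fun x hx => by
    rw [chart_target]; simpa using hx)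
  refine h3.congr fun x hx => ?_
  simp [chart_symm]

/-- In the canonical charts, the derivatives of the parametrizations are the identity. -/
theorem hasMFDerivAt_param {c : Cell C} {x : ℂ} (h : c.IsCanonical x) :
    HasMFDerivAt 𝓘(ℝ, ℂ) (𝓡 2) (b.param c) x
      (planeEquiv : ℂ →L[ℝ] EuclideanSpace ℝ (Fin 2)) := by
  have hx := mem_dom_of_canonical h
  have key : HasFDerivAt
      (fun a => chartAt (EuclideanSpace ℝ (Fin 2)) (b.param c x) (b.param c a))
      (planeEquiv : ℂ →L[ℝ] EuclideanSpace ℝ (Fin 2)) x := by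
    refine planeEquiv.hasFDerivAt.congr_of_eventuallyEq ?_
    filter_upwards [c.isOpen_dom.mem_nhds hx] with a ha
    rw [chartAt_param h]
    exact chart_param ha
  exact ⟨(map_nhds_param c hx).le, key.hasFDerivWithinAt⟩

end Start

end PDCode

/-! ### Smooth maps on the circle -/

/-- A map on the circle is smooth if it is smooth in the angle. -/
theorem contMDiff_of_comp_circleExp {E H M : Type*} [NormedAddCommGroup E] [NormedSpace ℝ E]
    [TopologicalSpace H] {I : ModelWithCorners ℝ E H} [TopologicalSpace M] [ChartedSpace H M]
    {f : Circle → M} (h : ContMDiff 𝓘(ℝ, ℝ) I ∞ fun t : ℝ => f (Circle.exp t)) :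
    ContMDiff (𝓡 1) I ∞ f := by
  have : Fact (Module.finrank ℝ ℂ = 1 + 1) := ⟨Complex.finrank_real_complex⟩
  intro z
  obtain ⟨s, rfl⟩ : ∃ s, Circle.exp s = z := ⟨_, Circle.exp_arg z⟩
  -- a smooth local inverse of the exponential map
  let L : Circle → ℝ := fun w => s + (Complex.log ((w : ℂ) * Complex.exp (-(s * Complex.I)))).im
  have hL : ∀ w, Circle.exp (L w) = w := by
    intro w
    apply Circle.ext
    have h1 : (w : ℂ) * Complex.exp (-(s * Complex.I)) =
        (w * Circle.exp (-s) : Circle) := by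
      rw [Circle.coe_mul, Circle.coe_exp]; push_cast; ring_nf
    have h2 : Circle.exp (L w) =
        Circle.exp s * Circle.exp (Complex.arg (w * Circle.exp (-s) : Circle)) := by
      rw [← Circle.exp_add]
      congr 1
      change s + (Complex.log ((w : ℂ) * Complex.exp (-(s * Complex.I)))).im = _
      rw [h1, Complex.log_im]
    rw [h2, Circle.exp_arg, mul_comm w, ← mul_assoc, ← Circle.exp_add]
    simp
  have hs : ContMDiffAt (𝓡 1) 𝓘(ℝ, ℝ) ∞ L (Circle.exp s) := by
    have h1 : ContMDiffAt (𝓡 1) 𝓘(ℝ, ℂ) ∞ (fun w : Circle => (w : ℂ)) (Circle.exp s) :=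
      (contMDiff_coe_sphere (n := 1) (E := ℂ)).contMDiffAt
    have h2 : ContDiffAt ℝ ∞
        (fun z : ℂ => s + (Complex.log (z * Complex.exp (-(s * Complex.I)))).im)
        ((Circle.exp s : Circle) : ℂ) := by
      have h3 : ((Circle.exp s : Circle) : ℂ) * Complex.exp (-(s * Complex.I)) = 1 := by
        rw [Circle.coe_exp, ← Complex.exp_add]; simp
      have h4 : ContDiffAt ℂ ∞ Complex.log
          (((Circle.exp s : Circle) : ℂ) * Complex.exp (-(s * Complex.I))) := by
        rw [h3]
        exact Complex.contDiffAt_log (by simp)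
      have h5 : ContDiffAt ℝ ∞ (fun z : ℂ => Complex.log (z * Complex.exp (-(s * Complex.I))))
          ((Circle.exp s : Circle) : ℂ) :=
        (h4.restrict_scalars ℝ).comp ((Circle.exp s : Circle) : ℂ)
          (contDiffAt_id.mul contDiffAt_const)
      exact contDiffAt_const.add
        (Complex.imCLM.contDiff.contDiffAt.comp ((Circle.exp s : Circle) : ℂ) h5)
    exact h2.contMDiffAt.comp _ h1
  have := (h.contMDiffAt (x := L (Circle.exp s))).comp _ hs
  refine this.congr_of_eventuallyEq (Eventually.of_forall fun w => ?_)
  simp only [Function.comp, hL]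

theorem linearIndependent_of_det2_ne_zero {v w : EuclideanSpace ℝ (Fin 2)} (h : det2 v w ≠ 0) :
    LinearIndependent ℝ ![v, w] := by
  rw [LinearIndependent.pair_iff]
  intro s t hst
  have h0 := congrArg (fun x : EuclideanSpace ℝ (Fin 2) => x 0) hst
  have h1 := congrArg (fun x : EuclideanSpace ℝ (Fin 2) => x 1) hst
  simp only [PiLp.add_apply, PiLp.smul_apply, smul_eq_mul, PiLp.zero_apply] at h0 h1
  constructor
  · refine (mul_eq_zero.1 (?_ : s * det2 v w = 0)).resolve_right h
    rw [det2]; linear_combination w 1 * h0 - w 0 * h1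
  · refine (mul_eq_zero.1 (?_ : t * det2 v w = 0)).resolve_right h
    rw [det2]; linear_combination v 0 * h1 - v 1 * h0

namespace PDCode

variable {μ : ℕ} {n : Fin μ → ℕ}

/-! ### The components of the diagram as curves -/

/-- The edge label `(i, k mod n i)`. -/
def lab (C : PDCode n) (i : Fin μ) (k : ℤ) : EdgeLabel n :=
  ⟨i, ⟨(k % n i).toNat, by
    have h : (0 : ℤ) < n i := by exact_mod_cast C.pos i
    have h1 := Int.emod_lt_of_pos k h
    have h2 := Int.emod_nonneg k h.ne'
    omega⟩⟩

theorem lab_eq_lab {C : PDCode n} {i : Fin μ} {k k' : ℤ} :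
    C.lab i k = C.lab i k' ↔ k ≡ k' [ZMOD n i] := by
  have h : (n i : ℤ) ≠ 0 := by exact_mod_cast (C.pos i).ne'
  have h1 := Int.emod_nonneg k h
  have h2 := Int.emod_nonneg k' h
  simp only [lab, Sigma.mk.injEq, heq_eq_eq, true_and, Fin.mk.injEq]
  rw [Int.ModEq]
  omega

theorem lab_self (C : PDCode n) (l : EdgeLabel n) : C.lab l.1 (l.2 : ℕ) = l := by
  obtain ⟨i, j⟩ := l
  simp only [lab]
  congr 1
  apply Fin.ext
  simp only
  rw [Int.emod_eq_of_lt (by positivity) (by exact_mod_cast j.2)]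
  rfl

theorem lab_add_one (C : PDCode n) (i : Fin μ) (k : ℤ) : C.lab i (k + 1) = (C.lab i k).next := by
  simp only [lab, EdgeLabel.next]
  congr 1
  have h : ∀ (N : ℕ) (a b : Fin N), (b : ℕ) = (a + 1) % N → b = finRotate N a := by
    intro N a b hab
    cases N with
    | zero => exact a.elim0
    | succ N =>
      rw [finRotate_apply]
      apply Fin.ext
      rw [hab, Fin.val_add]
      simp
  apply h
  have h : (0 : ℤ) < n i := by exact_mod_cast C.pos i
  have h1 := Int.emod_nonneg k h.ne'
  have h2 := Int.emod_nonneg (k + 1) h.ne'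
  simp only
  zify
  rw [Int.toNat_of_nonneg h1, Int.toNat_of_nonneg h2, Int.emod_add_emod]

theorem next_injective : Function.Injective (EdgeLabel.next (n := n)) := by
  rintro ⟨i, j⟩ ⟨i', j'⟩ h
  obtain ⟨rfl, h⟩ := Sigma.mk.inj h
  obtain rfl : j = j' := (finRotate (n i)).injective (eq_of_heq h)
  rfl

/-- Opposite a positive edge end, the next edge of the component goes out. -/
theorem quad_add_two {C : PDCode n} {q : C.quads} {k : Fin 4} {i : Fin μ} {m : ℤ}
    (hk : q.1 k = (C.lab i (m - 1), 1)) : q.1 (k + 2) = SignedLabel.flip (C.lab i m, 1) := by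
  have h1 := (C.opposite q.1 q.2 k).1
  have h2 := (C.opposite q.1 q.2 k).2 (by rw [hk])
  rw [hk] at h1 h2
  refine Prod.ext ?_ h1
  rw [h2, ← lab_add_one, sub_add_cancel]
  rfl

/-- The signs of the entries of a quadruple: the non-adjacent entries have opposite signs. -/
theorem signs_quad {C : PDCode n} (q : C.quads) :
    (q.1 0).2 = 1 ∧ (q.1 2).2 = -1 ∧ (q.1 3).2 = -(q.1 1).2 := by
  have h0 := (C.signs q.1 q.2).2.2
  refine ⟨h0, ?_, (C.opposite q.1 q.2 1).1⟩
  rw [← h0]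
  exact (C.opposite q.1 q.2 0).1

/-- Exactly two entries of a quadruple are positive, the first one and one of its neighbours. -/
theorem exists_pos_iff {C : PDCode n} (q : C.quads) :
    ∃ k₁ : Fin 4, (k₁ = 1 ∨ k₁ = 3) ∧ ∀ k, (q.1 k).2 = 1 ↔ k = 0 ∨ k = k₁ := by
  obtain ⟨h0, h2, h3⟩ := signs_quad q
  have hne : (-1 : ℤˣ) ≠ 1 := by decide
  rcases Int.units_eq_one_or (q.1 1).2 with h1 | h1
  · rw [h1] at h3
    refine ⟨1, Or.inl rfl, fun k => ?_⟩
    fin_cases k <;> simp [h0, h1, h2, h3, hne]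
  · rw [h1, neg_neg] at h3
    refine ⟨3, Or.inr rfl, fun k => ?_⟩
    fin_cases k <;> simp [h0, h1, h2, h3, hne]

namespace Start

variable {C : PDCode n} (b : C.Start)

/-- The `i`-th component, with the edge `(i, k mod n i)` between the times `k` and `k + 1`. The
parameter `sin² (πτ/2)` on the edges makes it smooth at the crossings: in the coordinate there, it is
`sin (πτ/2)`. -/
def curve (i : Fin μ) (τ : ℝ) : b.Complex :=
  b.sec (C.lab i ⌊τ⌋, 1) ((Real.sin (Real.pi / 2 * Int.fract τ) ^ 2 : ℝ) : ℂ)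

/-- The crossing that belongs to a quadruple. -/
def crossing (q : C.quads) : b.Complex := b.sec (q.1 0) 1

variable {b}

theorem sec_quad_one (q : C.quads) (k : Fin 4) : b.sec (q.1 k) 1 = b.crossing q := sec_quad q k 0

theorem curve_of_mem_Ico {i : Fin μ} {m : ℤ} {τ : ℝ} (h0 : m ≤ τ) (h1 : τ < m + 1) :
    b.curve i τ = b.sec (C.lab i m, 1) ((Real.sin (Real.pi / 2 * (τ - m)) ^ 2 : ℝ) : ℂ) := by
  have h2 : ⌊τ⌋ = m := Int.floor_eq_iff.2 ⟨h0, h1⟩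
  rw [curve, Int.fract, h2]

/-- At an integral time, the component is at the crossing at which the preceding edge ends. -/
theorem curve_intCast (i : Fin μ) (m : ℤ) : b.curve i m = b.sec (C.lab i (m - 1), 1) 1 := by
  obtain ⟨q, k, hk⟩ := exists_quad C (C.lab i (m - 1), 1)
  have h3 := quad_add_two hk
  have h4 := sec_flip (b := b) (C.lab i m, 1) (u := 0) (by simp)
  rw [← h3] at h4
  rw [curve_of_mem_Ico le_rfl (by linarith), ← hk, sec_quad q k (k + 2)]
  simpa using h4.symm

theorem curve_of_mem_Icc {i : Fin μ} {m : ℤ} {τ : ℝ} (h0 : m ≤ τ) (h1 : τ ≤ m + 1) :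
    b.curve i τ = b.sec (C.lab i m, 1) ((Real.sin (Real.pi / 2 * (τ - m)) ^ 2 : ℝ) : ℂ) := by
  rcases h1.lt_or_eq with h1 | rfl
  · exact curve_of_mem_Ico h0 h1
  · have h2 := curve_intCast (b := b) i (m + 1)
    push_cast at h2
    rw [h2]
    simp

theorem sin_sq_mem {v : ℝ} (h0 : 0 < v) (h1 : v < 1) :
    0 < Real.sin (Real.pi / 2 * v) ^ 2 ∧ Real.sin (Real.pi / 2 * v) ^ 2 < 1 := by
  have hpi := Real.pi_pos
  have h2 : 0 < Real.sin (Real.pi / 2 * v) :=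
    Real.sin_pos_of_pos_of_lt_pi (by positivity) (by nlinarith)
  have h3 : 0 < Real.cos (Real.pi / 2 * v) :=
    Real.cos_pos_of_mem_Ioo ⟨by nlinarith, by nlinarith⟩
  have h4 := Real.sin_sq_add_cos_sq (Real.pi / 2 * v)
  constructor
  · positivity
  · nlinarith

theorem curve_eq_proj {i : Fin μ} {τ : ℝ} (h : Int.fract τ ≠ 0) :
    ∃ u : ℝ, (0 < u ∧ u < 1) ∧ u = Real.sin (Real.pi / 2 * Int.fract τ) ^ 2 ∧
      b.curve i τ = b.proj (b.pt (C.lab i ⌊τ⌋, 1) u) :=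
  ⟨_, sin_sq_mem (lt_of_le_of_ne (Int.fract_nonneg τ) h.symm) (Int.fract_lt_one τ), rfl, rfl⟩

theorem curve_ne_crossing {i : Fin μ} {τ : ℝ} (h : Int.fract τ ≠ 0) (q : C.quads) :
    b.curve i τ ≠ b.crossing q := by
  obtain ⟨u, hu, -, h1⟩ := curve_eq_proj (b := b) (i := i) h
  rw [h1]
  intro h2
  exact not_rel_pt_corner hu (proj_eq_iff.1 h2)

/-- A component passes only once through an inner point of an edge. -/
theorem curve_eq_curve {i j : Fin μ} {τ τ' : ℝ} (h : Int.fract τ ≠ 0)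
    (he : b.curve i τ = b.curve j τ') :
    C.lab i ⌊τ⌋ = C.lab j ⌊τ'⌋ ∧ Int.fract τ = Int.fract τ' := by
  by_cases h' : Int.fract τ' = 0
  · exfalso
    obtain ⟨q, k, hk⟩ := exists_quad C (C.lab j (⌊τ'⌋ - 1), 1)
    refine curve_ne_crossing h q (he.trans ?_)
    rw [← sec_quad_one q k, hk, ← curve_intCast]
    congr 1
    rw [Int.fract] at h'
    linarith
  · obtain ⟨u, hu, hu', h1⟩ := curve_eq_proj (b := b) (i := i) h
    obtain ⟨v, hv, hv', h2⟩ := curve_eq_proj (b := b) (i := j) h'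
    rw [h1, h2] at he
    rcases rel_pt_pt hu hv (proj_eq_iff.1 he) with ⟨h3, h4⟩ | ⟨h3, -⟩
    · refine ⟨congrArg Prod.fst h3, ?_⟩
      rw [hu', hv'] at h4
      have hpi := Real.pi_pos
      have h5 : ∀ τ : ℝ, Real.pi / 2 * Int.fract τ ∈ Set.Icc (-(Real.pi / 2)) (Real.pi / 2) := by
        intro τ
        have h6 := Int.fract_nonneg τ
        have h7 := Int.fract_lt_one τ
        constructor <;> nlinarith
      have h8 : ∀ τ : ℝ, 0 ≤ Real.sin (Real.pi / 2 * Int.fract τ) := fun τ =>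
        Real.sin_nonneg_of_nonneg_of_le_pi (by have := Int.fract_nonneg τ; positivity)
          (by linarith [(h5 τ).2])
      have h9 := Real.injOn_sin (h5 τ) (h5 τ') ((sq_eq_sq₀ (h8 τ) (h8 τ')).1 h4)
      exact mul_left_cancel₀ (by positivity) h9
    · have := congrArg Prod.snd h3
      simp [SignedLabel.flip] at this

/-- Near an integral time, the component is a straight line in the coordinate at the crossing. -/
theorem curve_near_crossing {i : Fin μ} {m : ℤ} {q : C.quads} {k : Fin 4}
    (hk : q.1 k = (C.lab i (m - 1), 1)) {τ : ℝ} (h0 : m - 1 ≤ τ) (h1 : τ ≤ m + 1) :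
    b.curve i τ = b.param (.vertex q)
      (-(Complex.I ^ (k : ℕ) * (Real.sin (Real.pi / 2 * (τ - m)) : ℝ))) := by
  have hpi := Real.pi_pos
  rcases le_total τ m with h | h
  · have h2 : b.curve i τ = _ := curve_of_mem_Icc (b := b) (i := i) (m := m - 1) (τ := τ)
      (by push_cast; exact h0) (by push_cast; linarith)
    have h3 : 0 ≤ -Real.sin (Real.pi / 2 * (τ - m)) := by
      have := Real.sin_nonpos_of_nonpos_of_neg_pi_le (x := Real.pi / 2 * (τ - m)) (by nlinarith)
        (by nlinarith)
      linarith
    have h4 := param_vertex (b := b) q k (η := ((-Real.sin (Real.pi / 2 * (τ - m)) : ℝ) : ℂ))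
      (by rwa [Complex.ofReal_re]) (by rw [Complex.ofReal_im]) (by
        rw [Complex.norm_real, Real.norm_eq_abs, abs_neg]; exact Real.abs_sin_le_one _)
    rw [← mul_neg, ← Complex.ofReal_neg, h4, h2, hk]
    congr 1
    have h5 : Real.pi / 2 * (τ - (m - 1 : ℤ)) = Real.pi / 2 * (τ - m) + Real.pi / 2 := by
      push_cast; ring
    rw [h5, Real.sin_add_pi_div_two, Real.cos_sq']
    push_cast
    ring
  · have h2 : b.curve i τ = _ := curve_of_mem_Icc (b := b) (i := i) (m := m) (τ := τ) h h1
    have h3 : 0 ≤ Real.sin (Real.pi / 2 * (τ - m)) :=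
      Real.sin_nonneg_of_nonneg_of_le_pi (by have := sub_nonneg.2 h; positivity) (by nlinarith)
    have h4 := param_vertex (b := b) q (k + 2) (η := ((Real.sin (Real.pi / 2 * (τ - m)) : ℝ) : ℂ))
      (by rwa [Complex.ofReal_re]) (by rw [Complex.ofReal_im]) (by
        rw [Complex.norm_real, Real.norm_eq_abs]; exact Real.abs_sin_le_one _)
    rw [← neg_mul, ← I_pow_fin_add_two, h4, h2]
    have h7 := sec_flip (b := b) (C.lab i m, 1) (u := Real.sin (Real.pi / 2 * (τ - m)) ^ 2)
      ⟨by positivity, Real.sin_sq_le_one _⟩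
    rw [quad_add_two hk, ← h7]
    push_cast
    rfl

theorem curve_add (i : Fin μ) (τ : ℝ) (j : ℤ) : b.curve i (τ + j * n i) = b.curve i τ := by
  have h : τ + j * n i = τ + ((j * n i : ℤ) : ℝ) := by push_cast; ring
  have h2 : C.lab i (⌊τ⌋ + j * n i) = C.lab i ⌊τ⌋ := by
    rw [lab_eq_lab]
    simp [Int.ModEq]
  rw [curve, h, Int.floor_add_intCast, Int.fract_add_intCast, h2, curve]

/-- In the canonical chart at each of its points, a component is a smooth curve with nonzero
velocity. -/
theorem exists_curve_germ (i : Fin μ) (τ : ℝ) : ∃ (c : Cell C) (σ : ℝ → ℂ) (σ' : ℂ),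
    c.IsCanonical (σ τ) ∧ ContDiff ℝ ∞ σ ∧ HasDerivAt σ σ' τ ∧ σ' ≠ 0 ∧
      b.curve i =ᶠ[𝓝 τ] b.param c ∘ σ := by
  have hpi := Real.pi_pos
  by_cases h : Int.fract τ = 0
  · obtain ⟨m, rfl⟩ : ∃ m : ℤ, (m : ℝ) = τ := ⟨⌊τ⌋, by rw [Int.fract] at h; linarith⟩
    obtain ⟨q, k, hk⟩ := exists_quad C (C.lab i (m - 1), 1)
    refine ⟨.vertex q, fun τ => -(Complex.I ^ (k : ℕ) * (Real.sin (Real.pi / 2 * (τ - m)) : ℝ)),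
      -(Complex.I ^ (k : ℕ) * (Real.pi / 2 : ℝ)), ?_, ?_, ?_, ?_, ?_⟩
    · simp [Cell.IsCanonical]
    · refine (contDiff_const.mul (Complex.ofRealCLM.contDiff.comp (Real.contDiff_sin.comp ?_))).neg
      fun_prop
    · have h1 : HasDerivAt (fun τ : ℝ => Real.sin (Real.pi / 2 * (τ - m))) (Real.pi / 2) m := by
        have := ((((hasDerivAt_id (m : ℝ)).sub_const (m : ℝ)).const_mul (Real.pi / 2)).sin)
        simpa using this
      exact (h1.ofReal_comp.const_mul _).neg
    · simp [hpi.ne']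
    · filter_upwards [Icc_mem_nhds (sub_one_lt (m : ℝ)) (lt_add_one (m : ℝ))] with t ht
      exact curve_near_crossing hk ht.1 ht.2
  · have h0 : 0 < Int.fract τ := lt_of_le_of_ne (Int.fract_nonneg τ) (Ne.symm h)
    have h1 := Int.fract_lt_one τ
    have h2 := sin_sq_mem h0 h1
    set m := ⌊τ⌋ with hm
    have h3 : Int.fract τ = τ - m := rfl
    rw [h3] at h0 h1 h2
    refine ⟨.edge (C.lab i m, 1), fun τ => ((Real.sin (Real.pi / 2 * (τ - m)) ^ 2 : ℝ) : ℂ),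
      ((2 * Real.sin (Real.pi / 2 * (τ - m)) * (Real.cos (Real.pi / 2 * (τ - m)) * (Real.pi / 2)) :
        ℝ) : ℂ), ?_, ?_, ?_, ?_, ?_⟩
    · exact ⟨rfl, by simp only [Complex.ofReal_im], by simpa only [Complex.ofReal_re] using h2.1,
        by simpa only [Complex.ofReal_re] using h2.2⟩
    · refine Complex.ofRealCLM.contDiff.comp ((Real.contDiff_sin.comp ?_).pow 2)
      fun_prop
    · have h4 : HasDerivAt (fun τ : ℝ => Real.sin (Real.pi / 2 * (τ - m)) ^ 2)
          (2 * Real.sin (Real.pi / 2 * (τ - m)) *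
            (Real.cos (Real.pi / 2 * (τ - m)) * (Real.pi / 2))) τ := by
        have := ((((hasDerivAt_id τ).sub_const (m : ℝ)).const_mul (Real.pi / 2)).sin).pow 2
        refine (this.congr_of_eventuallyEq (Eventually.of_forall fun t => ?_)).congr_deriv ?_
        · simp
        · simp
      exact h4.ofReal_comp
    · have h5 : 0 < Real.sin (Real.pi / 2 * (τ - m)) :=
        Real.sin_pos_of_pos_of_lt_pi (by positivity) (by nlinarith)
      have h6 : 0 < Real.cos (Real.pi / 2 * (τ - m)) :=
        Real.cos_pos_of_mem_Ioo ⟨by nlinarith, by nlinarith⟩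
      exact_mod_cast (by positivity : 0 < 2 * Real.sin (Real.pi / 2 * (τ - m)) *
        (Real.cos (Real.pi / 2 * (τ - m)) * (Real.pi / 2))).ne'
    · filter_upwards [Icc_mem_nhds (by linarith : (m : ℝ) < τ) (by linarith : τ < (m : ℝ) + 1)]
        with t ht
      rw [Function.comp, param_edge_of_nonpos _ (by simp only [Complex.ofReal_im]; rfl)]
      exact curve_of_mem_Icc ht.1 ht.2

theorem contMDiff_curve (i : Fin μ) : ContMDiff 𝓘(ℝ, ℝ) (𝓡 2) ∞ (b.curve i) := by
  intro τ
  obtain ⟨c, σ, σ', h1, h2, -, -, h5⟩ := exists_curve_germ (b := b) i τ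
  refine ContMDiffAt.congr_of_eventuallyEq ?_ h5
  exact (((contMDiffOn_param b c).contMDiffAt (c.isOpen_dom.mem_nhds (mem_dom_of_canonical h1)))).comp
    τ h2.contMDiff.contMDiffAt

variable (b)

/-- The component `i` as a map on the circle, with equal times for all edges. -/
def component (i : Fin μ) (z : Circle) : b.Complex :=
  b.curve i (n i * Complex.arg z / (2 * Real.pi))

/-- The point on the `i`-th circle at which the component is at the time `τ`. -/
def pass (n : Fin μ → ℕ) (i : Fin μ) (τ : ℝ) : Fin μ × Circle :=
  (i, Circle.exp (2 * Real.pi * τ / n i))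

variable {b}

theorem component_exp (i : Fin μ) (t : ℝ) :
    b.component i (Circle.exp t) = b.curve i (n i * t / (2 * Real.pi)) := by
  obtain ⟨j, hj⟩ := Circle.exp_eq_exp.1 (Circle.exp_arg (Circle.exp t))
  have hpi := Real.pi_pos
  rw [component, hj, ← curve_add i (n i * t / (2 * Real.pi)) j]
  congr 1
  field_simp

theorem component_pass (i : Fin μ) (τ : ℝ) :
    b.component (pass n i τ).1 (pass n i τ).2 = b.curve i τ := by
  have hn : (n i : ℝ) ≠ 0 := by exact_mod_cast (C.pos i).ne'
  have hpi := Real.pi_pos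
  rw [pass, component_exp]
  congr 1
  field_simp

theorem exists_pass (C : PDCode n) (a : Fin μ × Circle) : ∃ τ, a = pass n a.1 τ := by
  have hn : (n a.1 : ℝ) ≠ 0 := by exact_mod_cast (C.pos a.1).ne'
  have hpi := Real.pi_pos
  refine ⟨n a.1 * Complex.arg a.2 / (2 * Real.pi), Prod.ext rfl ?_⟩
  simp only [pass]
  conv_lhs => rw [← Circle.exp_arg a.2]
  congr 1
  field_simp

theorem pass_eq_pass {i j : Fin μ} {k k' : ℤ} {τ τ' : ℝ} (h : C.lab i k = C.lab j k')
    (hτ : τ - k = τ' - k') : pass n i τ = pass n j τ' := by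
  obtain rfl : i = j := congrArg Sigma.fst h
  have hn : (n i : ℝ) ≠ 0 := by exact_mod_cast (C.pos i).ne'
  obtain ⟨t, ht⟩ := (lab_eq_lab.1 h).symm.dvd
  have ht' : (k : ℝ) - k' = n i * t := by exact_mod_cast ht
  refine Prod.ext rfl ?_
  simp only [pass]
  rw [Circle.exp_eq_exp]
  refine ⟨t, ?_⟩
  have : τ = τ' + n i * t := by linarith
  rw [this]
  field_simp

theorem pass_ne_pass {i j : Fin μ} {k k' : ℤ} (h : C.lab i k ≠ C.lab j k') :
    pass n i (k + 1) ≠ pass n j (k' + 1) := by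
  intro he
  obtain rfl : i = j := congrArg Prod.fst he
  have hn : (n i : ℝ) ≠ 0 := by exact_mod_cast (C.pos i).ne'
  have hpi := Real.pi_pos
  obtain ⟨t, ht⟩ := Circle.exp_eq_exp.1 (congrArg Prod.snd he)
  refine h (lab_eq_lab.2 (Int.ModEq.symm (Int.modEq_iff_dvd.2 ⟨t, ?_⟩)))
  have : (k : ℝ) - k' = n i * t := by
    field_simp at ht
    linarith
  exact_mod_cast this

/-! ### The crossings -/

theorem crossing_injective : Function.Injective b.crossing := fun _ _ h =>
  rel_corner_corner (proj_eq_iff.1 h)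

theorem curve_eq_crossing_iff {i : Fin μ} {τ : ℝ} {q : C.quads} :
    b.curve i τ = b.crossing q ↔
      ∃ (m : ℤ) (k : Fin 4), τ = m ∧ q.1 k = (C.lab i (m - 1), 1) := by
  constructor
  · intro h
    obtain ⟨m, rfl⟩ : ∃ m : ℤ, τ = m := by
      refine ⟨⌊τ⌋, ?_⟩
      by_contra h1
      refine curve_ne_crossing (fun h2 => h1 ?_) q h
      rw [Int.fract] at h2
      linarith
    obtain ⟨q', k, hk⟩ := exists_quad C (C.lab i (m - 1), 1)
    rw [curve_intCast, ← hk, sec_quad_one] at h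
    obtain rfl := crossing_injective h
    exact ⟨m, k, rfl, hk⟩
  · rintro ⟨m, k, rfl, hk⟩
    rw [curve_intCast, ← hk, sec_quad_one]

theorem exists_crossing_eq (i : Fin μ) (m : ℤ) : ∃ q, b.curve i m = b.crossing q := by
  obtain ⟨q, k, hk⟩ := exists_quad C (C.lab i (m - 1), 1)
  exact ⟨q, curve_eq_crossing_iff.2 ⟨m, k, rfl, hk⟩⟩

/-- A point that is passed twice is passed at integral times. -/
theorem eq_intCast_of_curve_eq {i j : Fin μ} {τ τ' : ℝ} (h : b.curve i τ = b.curve j τ')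
    (hne : pass n i τ ≠ pass n j τ') : ∃ m : ℤ, τ = m := by
  refine ⟨⌊τ⌋, ?_⟩
  by_contra h1
  obtain ⟨h2, h3⟩ := curve_eq_curve (fun h2 => h1 (by rw [Int.fract] at h2; linarith)) h
  exact hne (pass_eq_pass h2 h3)

/-- Every crossing is passed twice because its quadruple has two positive entries. -/
theorem selfIntersections_eq : selfIntersections b.component = Set.range b.crossing := by
  ext p
  constructor
  · rintro ⟨a, a', hne, rfl, h2⟩
    obtain ⟨τ, hτ⟩ := exists_pass C a
    obtain ⟨τ', hτ'⟩ := exists_pass C a'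
    rw [hτ, hτ'] at h2 hne
    rw [component_pass, component_pass] at h2
    obtain ⟨m, rfl⟩ := eq_intCast_of_curve_eq h2.symm hne
    obtain ⟨q, hq⟩ := exists_crossing_eq (b := b) a.1 m
    refine ⟨q, ?_⟩
    rw [hτ, component_pass, hq]
  · rintro ⟨q, rfl⟩
    obtain ⟨k₁, hk₁, h⟩ := exists_pos_iff q
    have hk : (0 : Fin 4) ≠ k₁ := by rcases hk₁ with rfl | rfl <;> decide
    have key : ∀ k, (q.1 k).2 = 1 →
        q.1 k = (C.lab (q.1 k).1.1 ((((q.1 k).1.2 : ℕ) : ℤ) + 1 - 1), 1) := by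
      intro k h1
      rw [add_sub_cancel_right, lab_self, ← h1]
    have key' : ∀ k, (q.1 k).2 = 1 →
        b.curve (q.1 k).1.1 ((((q.1 k).1.2 : ℕ) : ℤ) + 1 : ℝ) = b.crossing q := by
      intro k h1
      exact curve_eq_crossing_iff.2 ⟨_, k, by push_cast; rfl, key k h1⟩
    refine ⟨pass n (q.1 0).1.1 ((((q.1 0).1.2 : ℕ) : ℤ) + 1),
      pass n (q.1 k₁).1.1 ((((q.1 k₁).1.2 : ℕ) : ℤ) + 1), ?_, ?_, ?_⟩
    · refine pass_ne_pass (C := C) fun h1 => hk ?_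
      rw [lab_self, lab_self] at h1
      refine (quad_injective (q := q) (q' := q) (Prod.ext h1 ?_)).2
      rw [(h 0).2 (Or.inl rfl), (h k₁).2 (Or.inr rfl)]
    · rw [component_pass, key' 0 ((h 0).2 (Or.inl rfl))]
    · rw [component_pass, key' k₁ ((h k₁).2 (Or.inr rfl))]

/-- No point is passed three times: the passages through a crossing correspond to the positive
entries of its quadruple, of which there are only two. -/
theorem pass_eq_of_curve_eq {i₁ i₂ i₃ : Fin μ} {τ₁ τ₂ τ₃ : ℝ} (h : b.curve i₁ τ₁ = b.curve i₂ τ₂)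
    (h' : b.curve i₂ τ₂ = b.curve i₃ τ₃) : pass n i₁ τ₁ = pass n i₂ τ₂ ∨
      pass n i₂ τ₂ = pass n i₃ τ₃ ∨ pass n i₁ τ₁ = pass n i₃ τ₃ := by
  by_contra! hne
  obtain ⟨m₁, hm⟩ := eq_intCast_of_curve_eq h hne.1
  obtain ⟨q, hq⟩ := exists_crossing_eq (b := b) i₁ m₁
  rw [← hm] at hq
  obtain ⟨m₁, k₁, rfl, hk₁⟩ := curve_eq_crossing_iff.1 hq
  obtain ⟨m₂, k₂, rfl, hk₂⟩ := curve_eq_crossing_iff.1 (h.symm.trans hq)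
  obtain ⟨m₃, k₃, rfl, hk₃⟩ := curve_eq_crossing_iff.1 (h'.symm.trans (h.symm.trans hq))
  have key : ∀ {i j : Fin μ} {m m' : ℤ} {k : Fin 4}, q.1 k = (C.lab i (m - 1), 1) →
      q.1 k = (C.lab j (m' - 1), 1) → pass n i m = pass n j m' := by
    intro i j m m' k h1 h2
    refine pass_eq_pass (C := C) (congrArg Prod.fst (h1.symm.trans h2)) ?_
    push_cast; ring
  obtain ⟨k, -, hk⟩ := exists_pos_iff q
  have h1 := (hk k₁).1 (by rw [hk₁])
  have h2 := (hk k₂).1 (by rw [hk₂])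
  have h3 := (hk k₃).1 (by rw [hk₃])
  obtain ⟨n1, n2, n3⟩ := hne
  rcases h1 with rfl | rfl <;> rcases h2 with rfl | rfl
  · exact n1 (key hk₁ hk₂)
  · rcases h3 with rfl | rfl
    · exact n3 (key hk₁ hk₃)
    · exact n2 (key hk₂ hk₃)
  · rcases h3 with rfl | rfl
    · exact n2 (key hk₂ hk₃)
    · exact n3 (key hk₁ hk₃)
  · exact n1 (key hk₁ hk₂)

/-! ### Velocities -/

theorem hasMFDerivAt_component {i : Fin μ} {c : Cell C} {σ : ℝ → ℂ} {σ' : ℂ} {t : ℝ}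
    (hc : c.IsCanonical (σ (n i * t / (2 * Real.pi))))
    (hσ : HasDerivAt σ σ' (n i * t / (2 * Real.pi)))
    (h : b.curve i =ᶠ[𝓝 (n i * t / (2 * Real.pi))] b.param c ∘ σ) :
    HasMFDerivAt 𝓘(ℝ, ℝ) (𝓡 2) (fun s => b.component i (Circle.exp s)) t
      ((planeEquiv : ℂ →L[ℝ] EuclideanSpace ℝ (Fin 2)).comp
        (ContinuousLinearMap.toSpanSingleton ℝ ((n i / (2 * Real.pi) : ℝ) • σ'))) := by
  have h1 : HasDerivAt (fun t : ℝ => n i * t / (2 * Real.pi)) (n i / (2 * Real.pi)) t := by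
    have := ((hasDerivAt_id t).const_mul (n i : ℝ)).div_const (2 * Real.pi)
    simpa using this
  have h2 : HasDerivAt (fun t : ℝ => σ (n i * t / (2 * Real.pi)))
      ((n i / (2 * Real.pi) : ℝ) • σ') t := hσ.scomp t h1
  have h3 : HasMFDerivAt 𝓘(ℝ, ℝ) 𝓘(ℝ, ℂ) (fun t : ℝ => σ (n i * t / (2 * Real.pi))) t
      (ContinuousLinearMap.toSpanSingleton ℝ ((n i / (2 * Real.pi) : ℝ) • σ')) :=
    h2.hasFDerivAt.hasMFDerivAt
  have h4 := (hasMFDerivAt_param (b := b) hc).comp t h3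
  refine h4.congr_of_eventuallyEq ?_
  filter_upwards [h1.continuousAt.eventually h] with s hs
  rw [component_exp, hs]
  rfl

theorem circleVelocity_component {i : Fin μ} {c : Cell C} {σ : ℝ → ℂ} {σ' : ℂ} {t : ℝ}
    (hc : c.IsCanonical (σ (n i * t / (2 * Real.pi))))
    (hσ : HasDerivAt σ σ' (n i * t / (2 * Real.pi)))
    (h : b.curve i =ᶠ[𝓝 (n i * t / (2 * Real.pi))] b.param c ∘ σ) :
    circleVelocity (S := b.surface) (b.component i) t =
      planeEquiv ((n i / (2 * Real.pi) : ℝ) • σ') := by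
  have h1 : mfderiv 𝓘(ℝ, ℝ) (𝓡 2) (fun s => b.component i (Circle.exp s)) t = _ :=
    (hasMFDerivAt_component hc hσ h).mfderiv
  have h2 := congrArg (fun L : ℝ →L[ℝ] EuclideanSpace ℝ (Fin 2) => L 1) h1
  exact h2.trans (congrArg planeEquiv (one_smul ℝ ((n i / (2 * Real.pi) : ℝ) • σ')))

theorem circleVelocity_ne_zero (i : Fin μ) (t : ℝ) :
    circleVelocity (S := b.surface) (b.component i) t ≠ 0 := by
  obtain ⟨c, σ, σ', h1, -, h3, h4, h5⟩ := exists_curve_germ (b := b) i (n i * t / (2 * Real.pi))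
  rw [circleVelocity_component h1 h3 h5]
  have hpi := Real.pi_pos
  simp [h4, (C.pos i).ne', hpi.ne']

/-- A component that arrives at a crossing along the ray of `q k` moves in the opposite
direction. -/
theorem circleVelocity_crossing {i : Fin μ} {m : ℤ} {q : C.quads} {k : Fin 4} {t : ℝ}
    (hk : q.1 k = (C.lab i (m - 1), 1)) (ht : n i * t / (2 * Real.pi) = m) :
    circleVelocity (S := b.surface) (b.component i) t =
      planeEquiv (-((n i / 4 : ℝ) • Complex.I ^ (k : ℕ))) := by
  have hpi := Real.pi_pos
  have h1 : HasDerivAt (fun τ : ℝ => Real.sin (Real.pi / 2 * (τ - m))) (Real.pi / 2) m := by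
    have := ((((hasDerivAt_id (m : ℝ)).sub_const (m : ℝ)).const_mul (Real.pi / 2)).sin)
    simpa using this
  have h2 := (h1.ofReal_comp.const_mul (Complex.I ^ (k : ℕ))).neg
  rw [← ht] at h2
  rw [circleVelocity_component (c := .vertex q) (σ' := -(Complex.I ^ (k : ℕ) * (Real.pi / 2 : ℝ)))
    ?_ h2 ?_]
  · congr 1
    rw [smul_neg, Complex.real_smul, Complex.real_smul]
    push_cast
    field_simp
    norm_num
  · rw [ht]
    simp [Cell.IsCanonical]
  · rw [ht]
    filter_upwards [Icc_mem_nhds (sub_one_lt (m : ℝ)) (lt_add_one (m : ℝ))] with s hs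
    exact curve_near_crossing hk hs.1 hs.2

theorem contMDiff_component (i : Fin μ) : ContMDiff (𝓡 1) (𝓡 2) ∞ (b.component i) := by
  refine contMDiff_of_comp_circleExp ?_
  simp only [component_exp]
  refine (contMDiff_curve i).comp (ContDiff.contMDiff ?_)
  fun_prop

theorem injective_mfderiv_component (i : Fin μ) (z : Circle) :
    Function.Injective (mfderiv (𝓡 1) (𝓡 2) (b.component i) z) := by
  obtain ⟨t, rfl⟩ : ∃ s, Circle.exp s = z := ⟨_, Circle.exp_arg z⟩
  have h1 : mfderiv 𝓘(ℝ, ℝ) (𝓡 2) (b.component i ∘ Circle.exp) t = _ :=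
    mfderiv_comp t ((contMDiff_component i).mdifferentiableAt (by simp))
      ((contMDiff_circleExp (m := ∞)).mdifferentiableAt (by simp))
  set L : EuclideanSpace ℝ (Fin 1) →L[ℝ] EuclideanSpace ℝ (Fin 2) :=
    mfderiv (𝓡 1) (𝓡 2) (b.component i) (Circle.exp t) with hL
  set v : EuclideanSpace ℝ (Fin 1) := mfderiv 𝓘(ℝ, ℝ) (𝓡 1) Circle.exp t (1 : ℝ) with hv
  have h2 : L v ≠ 0 := by
    have h3 := circleVelocity_ne_zero (b := b) i t
    have h4 : circleVelocity (S := b.surface) (b.component i) t = L v :=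
      congrArg (fun L : ℝ →L[ℝ] EuclideanSpace ℝ (Fin 2) => L 1) h1
    rwa [h4] at h3
  have h3 : v ≠ 0 := fun h => h2 (by rw [h, map_zero])
  change Function.Injective L
  rw [injective_iff_map_eq_zero]
  intro w hw
  obtain ⟨r, rfl⟩ := exists_smul_eq_of_finrank_eq_one (K := ℝ)
    (by simp : Module.finrank ℝ (EuclideanSpace ℝ (Fin 1)) = 1) h3 w
  rw [map_smul] at hw
  rw [(smul_eq_zero.1 hw).resolve_right h2, zero_smul]

/-! ### The diagram -/

variable (b)

/-- The crossings of the components are the quadruples of the code. -/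
def crossingEquiv : C.quads ≃ selfIntersections b.component :=
  (Equiv.ofInjective b.crossing crossing_injective).trans (Equiv.setCongr selfIntersections_eq.symm)

theorem component_exp_mark (i : Fin μ) (τ : ℝ) :
    b.component i (Circle.exp (2 * Real.pi * τ / n i)) = b.curve i τ :=
  component_pass i τ

/-- The link diagram that consists of the edges of the complex. -/
def diagram : LinkDiagram b.surface n where
  map := b.component
  smooth := contMDiff_component
  immersion := injective_mfderiv_component
  finite := (congrArg Set.Finite selfIntersections_eq).mpr (Set.finite_range b.crossing)
  double a a' a'' h h' := by
    obtain ⟨τ, hτ⟩ := exists_pass C a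
    obtain ⟨τ', hτ'⟩ := exists_pass C a'
    obtain ⟨τ'', hτ''⟩ := exists_pass C a''
    rw [hτ, hτ', component_pass, component_pass] at h
    rw [hτ', hτ'', component_pass, component_pass] at h'
    rw [hτ, hτ', hτ'']
    exact pass_eq_of_curve_eq h h'
  transverse i j s t hne h := by
    have hpi := Real.pi_pos
    have hpos : ∀ i, (0 : ℝ) < n i := fun i => by exact_mod_cast C.pos i
    have hpass : ∀ i s, (i, Circle.exp s) = pass n i (n i * s / (2 * Real.pi)) := by
      intro i s
      have := hpos i
      refine Prod.ext rfl (congrArg Circle.exp ?_)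
      field_simp
    rw [component_exp, component_exp] at h
    rw [hpass, hpass j] at hne
    obtain ⟨m, hm⟩ := eq_intCast_of_curve_eq h hne
    obtain ⟨q, hq⟩ := exists_crossing_eq (b := b) i m
    rw [← hm] at hq
    obtain ⟨m, k, hm, hk⟩ := curve_eq_crossing_iff.1 hq
    obtain ⟨m', k', hm', hk'⟩ := curve_eq_crossing_iff.1 (h.symm.trans hq)
    have hkk : k ≠ k' := by
      rintro rfl
      refine hne (pass_eq_pass (C := C) (congrArg Prod.fst (hk.symm.trans hk')) ?_)
      rw [hm, hm']
      push_cast; ring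
    refine linearIndependent_of_det2_ne_zero ?_
    have e1 := circleVelocity_crossing (b := b) hk hm
    have e2 := circleVelocity_crossing (b := b) hk' hm'
    rw [e1, e2, det2_planeEquiv]
    obtain ⟨k₁, hk₁, hpos'⟩ := exists_pos_iff q
    have a1 := (hpos' k).1 (by rw [hk])
    have a2 := (hpos' k').1 (by rw [hk'])
    have hi := (hpos i).ne'
    have hj := (hpos j).ne'
    have h3 := I_pow_three
    rcases hk₁ with rfl | rfl <;> rcases a1 with rfl | rfl <;> rcases a2 with rfl | rfl <;>
      first
      | exact absurd rfl hkk
      | simp [h3, hi, hj]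
  mark i k := 2 * Real.pi * k / n i
  mark_strictMono i := by
    have hn : (0 : ℝ) < n i := by exact_mod_cast C.pos i
    have hpi := Real.pi_pos
    intro k k' h
    have : (k : ℝ) < k' := by exact_mod_cast h
    change 2 * Real.pi * (k : ℝ) / n i < 2 * Real.pi * (k' : ℝ) / n i
    gcongr
  mark_add i k := by
    have hn : (0 : ℝ) < n i := by exact_mod_cast C.pos i
    push_cast
    field_simp
  mark_range i t := by
    have hn : (0 : ℝ) < n i := by exact_mod_cast C.pos i
    have hpi := Real.pi_pos
    refine (congrArg (b.component i (Circle.exp t) ∈ ·) selfIntersections_eq).to_iff.trans ?_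
    rw [component_exp]
    constructor
    · rintro ⟨q, hq⟩
      obtain ⟨m, -, hm, -⟩ := curve_eq_crossing_iff.1 hq.symm
      refine ⟨m, ?_⟩
      simp only
      rw [← hm]
      field_simp
    · rintro ⟨m, rfl⟩
      obtain ⟨q, hq⟩ := exists_crossing_eq (b := b) i m
      refine ⟨q, ?_⟩
      rw [← hq]
      congr 1
      field_simp
  sign p := if ((b.crossingEquiv.symm p).1 1).2 = -1 then 1 else -1

theorem curve_endTime (x : SignedLabel n) :
    b.component x.1.1 (Circle.exp (b.diagram.endTime x)) = b.sec x 1 := by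
  rcases Int.units_eq_one_or x.2 with hx | hx
  · rw [LinkDiagram.endTime, if_pos hx]
    change b.component _ (Circle.exp (2 * Real.pi * (((x.1.2 : ℕ) : ℤ) + 1 : ℤ) / n x.1.1)) = _
    rw [component_exp_mark, curve_intCast, add_sub_cancel_right, lab_self, ← hx]
  · rw [LinkDiagram.endTime, if_neg (by rw [hx]; decide)]
    change b.component _ (Circle.exp (2 * Real.pi * (((x.1.2 : ℕ) : ℤ) : ℤ) / n x.1.1)) = _
    rw [component_exp_mark, curve_of_mem_Ico le_rfl (by linarith), lab_self]
    have h := sec_flip (b := b) (x.1, 1) (u := 0) (by simp)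
    have h2 : SignedLabel.flip (x.1, 1) = x := Prod.ext rfl hx.symm
    rw [h2] at h
    simpa using h.symm

/-- The edge end `q k` leaves the crossing in the direction `i ^ k`. -/
theorem outward_diagram (q : C.quads) (k : Fin 4) :
    b.diagram.outward (q.1 k) =
      planeEquiv ((n (q.1 k).1.1 / 4 : ℝ) • Complex.I ^ (k : ℕ)) := by
  have hn : (0 : ℝ) < n (q.1 k).1.1 := by exact_mod_cast C.pos _
  have hpi := Real.pi_pos
  rcases Int.units_eq_one_or (q.1 k).2 with hx | hx
  · rw [LinkDiagram.outward, if_pos hx, LinkDiagram.endTime, if_pos hx]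
    have h1 : q.1 k = (C.lab (q.1 k).1.1 ((((q.1 k).1.2 : ℕ) : ℤ) + 1 - 1), 1) := by
      rw [add_sub_cancel_right, lab_self, ← hx]
    have h2 := circleVelocity_crossing (b := b)
      (t := 2 * Real.pi * (((((q.1 k).1.2 : ℕ) : ℤ) + 1 : ℤ) : ℝ) / n (q.1 k).1.1) h1 (by field_simp)
    refine (congrArg Neg.neg h2).trans ?_
    rw [map_neg, neg_neg]
  · rw [LinkDiagram.outward, if_neg (by rw [hx]; decide), LinkDiagram.endTime,
      if_neg (by rw [hx]; decide)]
    have hk2 : k + 2 + 2 = k := by fin_cases k <;> rfl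
    have h3 := C.opposite q.1 q.2 (k + 2)
    rw [hk2, hx] at h3
    have h4 : (q.1 (k + 2)).2 = 1 := by
      have := congrArg Neg.neg h3.1
      simpa using this.symm
    have h5 := h3.2 h4
    have h1 : q.1 (k + 2) = (C.lab (q.1 k).1.1 ((((q.1 k).1.2 : ℕ) : ℤ) - 1), 1) := by
      refine Prod.ext (next_injective ?_) h4
      rw [← h5, ← lab_add_one, sub_add_cancel, lab_self]
    have h2 := circleVelocity_crossing (b := b)
      (t := 2 * Real.pi * (((((q.1 k).1.2 : ℕ) : ℤ) : ℤ) : ℝ) / n (q.1 k).1.1) h1 (by field_simp)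
    refine h2.trans ?_
    rw [I_pow_fin_add_two, smul_neg, neg_neg]

/-- The diagram on the complex is obtained from the complex. -/
def presentation : Presentation b b.diagram where
  homeo := Homeomorph.refl _
  vertex := b.crossingEquiv
  face f := by
    refine ⟨b.param (.face f), fun z => ?_, contMDiffOn_param b (.face f), fun z hz => ?_⟩
    · simp only [param, discProj_coe]; rfl
    · have h1 : mfderiv 𝓘(ℝ, ℂ) (𝓡 2) (b.param (.face f)) z = _ :=
        (hasMFDerivAt_param (c := .face f) (mem_ball_zero_iff.1 hz)).mfderiv
      have h2 : ∀ v : ℂ, (mfderiv 𝓘(ℝ, ℂ) (𝓡 2) (b.param (.face f)) z :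
          ℂ →L[ℝ] EuclideanSpace ℝ (Fin 2)) v = planeEquiv v := fun v =>
        congrArg (fun L : ℂ →L[ℝ] EuclideanSpace ℝ (Fin 2) => L v) h1
      refine lt_of_lt_of_eq (b := det2 (planeEquiv 1) (planeEquiv Complex.I)) ?_
        (congrArg₂ det2 (h2 1).symm (h2 Complex.I).symm)
      rw [det2_planeEquiv]
      simp
  edge l := by
    have hn : (0 : ℝ) < n l.1 := by exact_mod_cast C.pos l.1
    have hpi := Real.pi_pos
    -- the inverse of the parametrization `u = sin² (πv/2)` of the edges
    refine ⟨fun u => 2 * Real.pi * (((l.2 : ℕ) : ℝ) + 2 / Real.pi * Real.arcsin (Real.sqrt u)) /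
      n l.1, ?_, ?_, ?_, ?_, ?_⟩
    · refine Continuous.continuousOn ?_
      have := Real.continuous_arcsin
      fun_prop
    · intro u hu v hv huv
      have h1 : Real.arcsin (Real.sqrt u) < Real.arcsin (Real.sqrt v) := by
        refine Real.strictMonoOn_arcsin ⟨?_, ?_⟩ ⟨?_, ?_⟩ (Real.sqrt_lt_sqrt hu.1 huv)
        · linarith [Real.sqrt_nonneg u]
        · exact Real.sqrt_le_one.2 hu.2
        · linarith [Real.sqrt_nonneg v]
        · exact Real.sqrt_le_one.2 hv.2
      simp only
      gcongr
    · simp [diagram]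
    · simp only [diagram, Real.sqrt_one, Real.arcsin_one]
      push_cast
      field_simp
    · intro f m hm u hu
      have h1 : b.cell f (sidePoint (b.numSides f) m u) = b.sec (l, 1) u := by
        rw [← hm]
        exact congrArg b.proj (sidePoint_eq_pt b f m u)
      have h2 := component_exp_mark b l.1
        (((l.2 : ℕ) : ℝ) + 2 / Real.pi * Real.arcsin (Real.sqrt u))
      refine Eq.trans h1 (Eq.trans ?_ h2.symm)
      have h3 : 0 ≤ Real.arcsin (Real.sqrt u) := Real.arcsin_nonneg.2 (Real.sqrt_nonneg u)
      have h4 : Real.arcsin (Real.sqrt u) ≤ Real.pi / 2 := Real.arcsin_le_pi_div_two _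
      have h5 : 2 / Real.pi * Real.arcsin (Real.sqrt u) ≤ 1 := by
        rw [div_mul_eq_mul_div, div_le_one hpi]; linarith
      rw [curve_of_mem_Icc (m := ((l.2 : ℕ) : ℤ))
        (by push_cast; linarith [mul_nonneg (div_nonneg zero_le_two hpi.le) h3]) (by push_cast; linarith),
      lab_self]
      congr 2
      have h6 : Real.pi / 2 * (((l.2 : ℕ) : ℝ) + 2 / Real.pi * Real.arcsin (Real.sqrt u) -
          ((((l.2 : ℕ) : ℤ)) : ℝ)) = Real.arcsin (Real.sqrt u) := by
        push_cast; field_simp; ring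
      rw [h6, Real.sin_arcsin (by linarith [Real.sqrt_nonneg u]) (Real.sqrt_le_one.2 hu.2),
        Real.sq_sqrt hu.1]
  corner q k f m hm := by
    have h1 := sidePoint_eq_pt b f m 1
    rw [hm, Complex.ofReal_one] at h1
    exact (congrArg b.proj h1).trans (sec_quad_one q k)
  incident q k := (b.curve_endTime (q.1 k)).trans (sec_quad_one q k)
  cyclic q k := by
    have h1 : (0 : ℝ) < n (q.1 k).1.1 := by exact_mod_cast C.pos _
    have h2 : (0 : ℝ) < n (q.1 (k + 1)).1.1 := by exact_mod_cast C.pos _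
    rw [outward_diagram, outward_diagram, det2_planeEquiv, I_pow_fin_add_one]
    have h3 := I_pow_three
    have h4 : 0 < (n (q.1 k).1.1 / 4 : ℝ) * (n (q.1 (k + 1)).1.1 / 4) := by positivity
    simp only [Complex.smul_re, Complex.smul_im, smul_eq_mul, Complex.mul_re, Complex.mul_im,
      Complex.I_re, Complex.I_im]
    have h5 : (Complex.I ^ (k : ℕ)).re ^ 2 + (Complex.I ^ (k : ℕ)).im ^ 2 = 1 := by
      fin_cases k <;> simp [h3]
    nlinarith
  sign_pos q _ h _ _ := by
    change (if ((b.crossingEquiv.symm (b.crossingEquiv q)).1 1).2 = -1 then (1 : ℤˣ) else -1) = 1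
    rw [Equiv.symm_apply_apply, if_pos h]
  sign_neg q _ h _ _ := by
    change (if ((b.crossingEquiv.symm (b.crossingEquiv q)).1 1).2 = -1 then (1 : ℤˣ) else -1) = -1
    rw [Equiv.symm_apply_apply, if_neg (by rw [h]; decide)]

end Start

end PDCode

namespace PDCode

variable {μ : ℕ} {n : Fin μ → ℕ} {C : PDCode n}

namespace Start

/-! ### Independence of the numbering of the sides -/

theorem exists_shift (b b' : C.Start) (f : C.Face) : ∃ j, b'.side f j = b.1 f := by
  have h := b'.side_idx (b.1 f)
  rw [faceOf_start] at h
  exact ⟨_, h⟩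

/-- The number in `b'` of the side at which the numbering in `b` starts. -/
def shift (b b' : C.Start) (f : C.Face) : ℕ := (exists_shift b b' f).choose

theorem side_shift (b b' : C.Start) (f : C.Face) (m : ℕ) :
    b'.side f (m + shift b b' f) = b.side f m := by
  have h : b'.side f (shift b b' f) = b.1 f := (exists_shift b b' f).choose_spec
  rw [side, pow_add, Equiv.Perm.mul_apply]
  exact congrArg _ h

theorem numSides_eq (b b' : C.Start) (f : C.Face) : b.numSides f = b'.numSides f := by
  have h : b'.side f (shift b b' f) = b.1 f := (exists_shift b b' f).choose_spec
  rw [numSides, numSides, ← h, side, Equiv.Perm.coe_pow]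
  exact Function.minimalPeriod_apply_iterate (C.succ.injective.mem_periodicPts _) _

/-- The rotation of the polygon `f` that matches the two numberings of its sides. -/
def rotation (b b' : C.Start) (f : C.Face) : ℂ := turn (b.numSides f) (shift b b' f)

theorem norm_rotation (b b' : C.Start) (f : C.Face) : ‖rotation b b' f‖ = 1 := by
  rw [rotation, norm_turn]
  simp

/-- The rotations of all polygons. -/
def rotate (b b' : C.Start) (p : Polygons C) : Polygons C :=
  ⟨p.1, discProj (p.2 * rotation b b' p.1)⟩

theorem continuous_rotate (b b' : C.Start) : Continuous (rotate b b') := by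
  refine continuous_sigma fun f => continuous_sigmaMk.comp (continuous_discProj.comp ?_)
  fun_prop

theorem rotate_pt (b b' : C.Start) (x : SignedLabel n) {w : ℂ} (hw : w.im ≤ 0) :
    rotate b b' (b.pt x w) = b'.pt x w := by
  have h := side_shift b b' (C.faceOf x) (b.idx x)
  rw [side_idx] at h
  rw [pt_of_side h, rotate, coe_pt hw, ← numSides_eq b b']
  refine congrArg (Sigma.mk _) (congrArg discProj ?_)
  change turn (b.numSides (C.faceOf x)) _ *
    turn (b.numSides (C.faceOf x)) (shift b b' (C.faceOf x)) = _
  rw [turn, turn, turn, ← Complex.exp_add]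
  congr 1
  push_cast
  ring

theorem rotate_rotate (b b' : C.Start) (p : Polygons C) : rotate b' b (rotate b b' p) = p := by
  by_cases hp : (p.2 : ℂ) = 0
  · obtain ⟨f, z⟩ := p
    obtain rfl : z = discProj 0 := Subtype.ext (by rw [coe_discProj (by simp)]; exact hp)
    have h : ∀ b b' : C.Start, rotate b b' ⟨f, discProj 0⟩ = ⟨f, discProj 0⟩ := by
      intro b b'
      rw [rotate, coe_discProj (by simp), zero_mul]
    rw [h, h]
  · obtain ⟨x, w, hw, -, -, rfl⟩ := b.exists_pt_eq p hp
    rw [rotate_pt b b' x hw, rotate_pt b' b x hw]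

theorem Rel.rotate {b : C.Start} (b' : C.Start) {p p' : Polygons C} (h : b.Rel p p') :
    b'.Rel (rotate b b' p) (rotate b b' p') := by
  cases h with
  | refl => exact .refl _
  | side x u h0 h1 =>
    rw [rotate_pt b b' _ (by simp), rotate_pt b b' _ (by simp)]
    exact .side x u h0 h1
  | corner q k k' =>
    rw [rotate_pt b b' _ (by simp), rotate_pt b b' _ (by simp)]
    exact .corner q k k'

/-- The map that the rotations induce on the complexes. -/
def changeMap (b b' : C.Start) : b.Complex → b'.Complex :=
  Quot.lift (fun p => b'.proj (rotate b b' p)) fun p p' h =>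
    proj_eq_iff.2 (Rel.rotate b' (proj_eq_iff.1 (Quot.sound h : b.proj p = b.proj p')))

theorem changeMap_changeMap (b b' : C.Start) (y : b.Complex) :
    changeMap b' b (changeMap b b' y) = y := by
  obtain ⟨p, rfl⟩ := b.proj_surjective y
  exact congrArg b.proj (rotate_rotate b b' p)

/-- The complexes of two numberings of the sides are homeomorphic. -/
def changeHomeo (b b' : C.Start) : b.Complex ≃ₜ b'.Complex where
  toFun := changeMap b b'
  invFun := changeMap b' b
  left_inv := changeMap_changeMap b b'
  right_inv := changeMap_changeMap b' b
  continuous_toFun := continuous_quot_lift _ (b'.continuous_proj.comp (continuous_rotate b b'))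
  continuous_invFun := continuous_quot_lift _ (b.continuous_proj.comp (continuous_rotate b' b))

theorem changeHomeo_sec (b b' : C.Start) (x : SignedLabel n) {w : ℂ} (hw : w.im ≤ 0) :
    changeHomeo b b' (b.sec x w) = b'.sec x w :=
  congrArg b'.proj (rotate_pt b b' x hw)

end Start

end PDCode

/-! ### Smoothness off the diagram -/

/-- A map is smooth at a point if it is smooth after composition with a local diffeomorphism. -/
theorem contMDiffAt_of_comp {S S' : ClosedOrientedSurface} {h : S → S'} {g : ℂ → S} {G : ℂ → S'}
    {z : ℂ} (hg : ContMDiffAt 𝓘(ℝ, ℂ) (𝓡 2) ∞ g z) (hG : ContMDiffAt 𝓘(ℝ, ℂ) (𝓡 2) ∞ G z)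
    (hd : det2 (mfderiv 𝓘(ℝ, ℂ) (𝓡 2) g z (1 : ℂ)) (mfderiv 𝓘(ℝ, ℂ) (𝓡 2) g z Complex.I) ≠ 0)
    (hh : ∀ᶠ y in 𝓝 z, h (g y) = G y) : ContMDiffAt (𝓡 2) (𝓡 2) ∞ h (g z) := by
  set e := extChartAt (𝓡 2) (g z) with he
  set A : ℂ →L[ℝ] EuclideanSpace ℝ (Fin 2) := mfderiv 𝓘(ℝ, ℂ) (𝓡 2) g z with hA
  have hF : ContDiffAt ℝ ∞ (e ∘ g) z := by
    have h1 : ContMDiffAt (𝓡 2) 𝓘(ℝ, EuclideanSpace ℝ (Fin 2)) ∞ e (g z) := contMDiffAt_extChartAt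
    exact (h1.comp z hg).contDiffAt
  have hF' : HasFDerivAt (e ∘ g) A z := by
    have h1 := (hg.mdifferentiableAt (by simp)).hasMFDerivAt.2
    have h2 : HasFDerivWithinAt (e ∘ g) A (Set.range (id : ℂ → ℂ)) z := h1
    rwa [Set.range_id, hasFDerivWithinAt_univ] at h2
  -- the derivative is invertible
  obtain ⟨B, hB⟩ : ∃ B : ℂ ≃L[ℝ] EuclideanSpace ℝ (Fin 2),
      (B : ℂ →L[ℝ] EuclideanSpace ℝ (Fin 2)) = A := by
    have h1 : (A.comp (planeEquiv.symm : EuclideanSpace ℝ (Fin 2) →L[ℝ] ℂ)).det ≠ 0 := by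
      intro h0
      have h2 := det2_map (A.comp (planeEquiv.symm : EuclideanSpace ℝ (Fin 2) →L[ℝ] ℂ))
        (planeEquiv 1) (planeEquiv Complex.I)
      rw [h0, zero_mul] at h2
      have h3 : det2 (A 1) (A Complex.I) = 0 := by simpa using h2
      exact hd h3
    refine ⟨planeEquiv.trans
      (ContinuousLinearMap.toContinuousLinearEquivOfDetNeZero _ h1), ?_⟩
    ext v
    simp
  rw [← hB] at hF'
  set L := hF.toOpenPartialHomeomorph (e ∘ g) hF' (by simp) with hL
  have hz : z ∈ L.source := hF.mem_toOpenPartialHomeomorph_source hF' (by simp)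
  have hLz : L.symm (e (g z)) = z := L.left_inv hz
  have hLt : e (g z) ∈ L.target := L.map_source hz
  have hLs : ContDiffAt ℝ ∞ L.symm (e (g z)) := hF.to_localInverse hF' (by simp)
  have hec : ContMDiffAt (𝓡 2) 𝓘(ℝ, EuclideanSpace ℝ (Fin 2)) ∞ e (g z) := contMDiffAt_extChartAt
  have hLe : ContMDiffAt (𝓡 2) 𝓘(ℝ, ℂ) ∞ (fun p => L.symm (e p)) (g z) :=
    hLs.contMDiffAt.comp (g z) hec
  have hLe' : Tendsto (fun p => L.symm (e p)) (𝓝 (g z)) (𝓝 z) := by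
    have := hLe.continuousAt
    rwa [ContinuousAt, hLz] at this
  have hcomp : ContMDiffAt (𝓡 2) (𝓡 2) ∞ (fun p => G (L.symm (e p))) (g z) := by
    refine ContMDiffAt.comp (I' := 𝓘(ℝ, ℂ)) (g z) ?_ hLe
    rw [hLz]
    exact hG
  refine hcomp.congr_of_eventuallyEq ?_
  filter_upwards [hLe'.eventually hh,
    hLe'.eventually (hg.continuousAt.eventually (extChartAt_source_mem_nhds (I := 𝓡 2) (g z))),
    extChartAt_source_mem_nhds (I := 𝓡 2) (g z),
    hec.continuousAt.eventually (L.open_target.mem_nhds hLt)] with p h1 h2 h3 h4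
  have h5 : e (g (L.symm (e p))) = e p := L.right_inv h4
  have h6 : g (L.symm (e p)) = p := e.injOn h2 h3 h5
  rw [← h1, h6]

/-- The Jacobian determinant of a map is positive at a point if it relates two positively oriented
parametrizations. -/
theorem det_mfderiv_pos {S S' : ClosedOrientedSurface} {h : S → S'} {g : ℂ → S} {g' : ℂ → S'}
    {z c : ℂ} (hc : c ≠ 0) (hg : MDifferentiableAt 𝓘(ℝ, ℂ) (𝓡 2) g z)
    (hg' : MDifferentiableAt 𝓘(ℝ, ℂ) (𝓡 2) g' (z * c))
    (hmd : MDifferentiableAt (𝓡 2) (𝓡 2) h (g z))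
    (hd : 0 < det2 (mfderiv 𝓘(ℝ, ℂ) (𝓡 2) g z (1 : ℂ)) (mfderiv 𝓘(ℝ, ℂ) (𝓡 2) g z Complex.I))
    (hd' : 0 < det2 (mfderiv 𝓘(ℝ, ℂ) (𝓡 2) g' (z * c) (1 : ℂ))
      (mfderiv 𝓘(ℝ, ℂ) (𝓡 2) g' (z * c) Complex.I))
    (hh : ∀ᶠ y in 𝓝 z, h (g y) = g' (y * c)) :
    0 < (mfderiv (𝓡 2) (𝓡 2) h (g z) :
      EuclideanSpace ℝ (Fin 2) →L[ℝ] EuclideanSpace ℝ (Fin 2)).det := by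
  set A : ℂ →L[ℝ] EuclideanSpace ℝ (Fin 2) := mfderiv 𝓘(ℝ, ℂ) (𝓡 2) g z with hA
  set B : ℂ →L[ℝ] EuclideanSpace ℝ (Fin 2) := mfderiv 𝓘(ℝ, ℂ) (𝓡 2) g' (z * c) with hB
  set H : EuclideanSpace ℝ (Fin 2) →L[ℝ] EuclideanSpace ℝ (Fin 2) :=
    mfderiv (𝓡 2) (𝓡 2) h (g z) with hH
  have h1 : HasMFDerivAt 𝓘(ℝ, ℂ) (𝓡 2) (fun y => h (g y)) z (H.comp A) :=
    HasMFDerivAt.comp z hmd.hasMFDerivAt hg.hasMFDerivAt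
  have h2 : HasMFDerivAt 𝓘(ℝ, ℂ) 𝓘(ℝ, ℂ) (fun y : ℂ => y * c) z
      ((ContinuousLinearMap.mul ℝ ℂ).flip c) :=
    ((ContinuousLinearMap.mul ℝ ℂ).flip c).hasFDerivAt.hasMFDerivAt
  have h3 : HasMFDerivAt 𝓘(ℝ, ℂ) (𝓡 2) (fun y => g' (y * c)) z
      (B.comp ((ContinuousLinearMap.mul ℝ ℂ).flip c)) :=
    HasMFDerivAt.comp z hg'.hasMFDerivAt h2
  have h4 : HasMFDerivAt 𝓘(ℝ, ℂ) (𝓡 2) (fun y => h (g y)) z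
      (B.comp ((ContinuousLinearMap.mul ℝ ℂ).flip c)) := h3.congr_of_eventuallyEq hh
  have h5 : ∀ v : ℂ, H (A v) = B (v * c) := by
    intro v
    have h6 : H.comp A = B.comp ((ContinuousLinearMap.mul ℝ ℂ).flip c) :=
      hasMFDerivAt_unique h1 h4
    exact congrArg (fun L : ℂ →L[ℝ] EuclideanSpace ℝ (Fin 2) => L v) h6
  have h6 := det2_map H (A 1) (A Complex.I)
  rw [h5, h5] at h6
  have h7 : ∀ v : ℂ, B v = v.re • B 1 + v.im • B Complex.I := by
    intro v
    rw [← map_smul, ← map_smul, ← map_add]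
    congr 1
    exact Complex.ext (by simp) (by simp)
  have h8 : det2 (B (1 * c)) (B (Complex.I * c)) =
      Complex.normSq c * det2 (B 1) (B Complex.I) := by
    rw [h7 (1 * c), h7 (Complex.I * c), Complex.normSq_apply]
    simp only [det2, PiLp.add_apply, PiLp.smul_apply, smul_eq_mul, one_mul, Complex.mul_re,
      Complex.mul_im, Complex.I_re, Complex.I_im, zero_mul, zero_sub, zero_add]
    ring
  rw [h8] at h6
  have h9 : 0 < Complex.normSq c * det2 (B 1) (B Complex.I) :=
    mul_pos (Complex.normSq_pos.2 hc) hd'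
  rw [h6] at h9
  exact pos_of_mul_pos_left h9 hd.le

/-! ### Two presentations give equivalent diagrams -/

namespace Presentation

open PDCode PDCode.Start

variable {μ : ℕ} {n : Fin μ → ℕ} {C : PDCode n} {b b' : C.Start} {S S' : ClosedOrientedSurface}
  {D : LinkDiagram S n} {D' : LinkDiagram S' n}

/-- The homeomorphism of the surfaces that is determined by two presentations. -/
def surfaceHomeo (P : Presentation b D) (P' : Presentation b' D') : S ≃ₜ S' :=
  P.homeo.symm.trans ((changeHomeo b b').trans P'.homeo)

theorem surfaceHomeo_homeo (P : Presentation b D) (P' : Presentation b' D') (y : b.Complex) :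
    P.surfaceHomeo P' (P.homeo y) = P'.homeo (changeHomeo b b' y) :=
  congrArg (fun y => P'.homeo (changeHomeo b b' y)) (P.homeo.symm_apply_apply y)

/-- The parametrization of the edge `l` of a presentation. -/
def edgeTime (P : Presentation b D) (l : EdgeLabel n) : ℝ → ℝ := (P.edge l).choose

theorem homeo_sec (P : Presentation b D) (l : EdgeLabel n) {u : ℝ} (hu : u ∈ Set.Icc (0 : ℝ) 1) :
    P.homeo (b.sec (l, 1) u) = D.map l.1 (Circle.exp (P.edgeTime l u)) := by
  have h := (P.edge l).choose_spec.2.2.2.2 _ _ (b.side_idx (l, 1)) u hu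
  refine Eq.trans (congrArg P.homeo ?_) h
  have h2 := sidePoint_eq_pt b (C.faceOf (l, 1)) (b.idx (l, 1)) u
  rw [side_idx] at h2
  exact congrArg b.proj h2.symm

theorem homeo_corner (P : Presentation b D) (q : C.quads) (k : Fin 4) :
    P.homeo (b.sec (q.1 k) 1) = P.vertex q := by
  refine Eq.trans (congrArg P.homeo ?_) (P.corner q k _ _ (b.side_idx (q.1 k)))
  have h2 := sidePoint_eq_pt b (C.faceOf (q.1 k)) (b.idx (q.1 k)) 1
  rw [side_idx, Complex.ofReal_one] at h2
  exact congrArg b.proj h2.symm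

/-- The edges and vertices of the complex lie on the diagram, so that its complement consists of
interior points of polygons. -/
theorem exists_homeo_eq_of_notMem_image (P : Presentation b D) {p : S} (hp : p ∉ D.image) :
    ∃ (f : C.Face) (z : ℂ), ‖z‖ < 1 ∧ P.homeo (b.proj ⟨f, discProj z⟩) = p := by
  obtain ⟨y, rfl⟩ := P.homeo.surjective p
  obtain ⟨c, x, hc, rfl⟩ := b.exists_canonical_eq y
  cases c with
  | face f => exact ⟨f, x, hc, rfl⟩
  | edge l =>
    exfalso
    obtain ⟨u, rfl⟩ : ∃ u : ℝ, x = u := ⟨x.re, Complex.ext (by simp) (by simpa using hc.2.1)⟩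
    have hu : u ∈ Set.Icc (0 : ℝ) 1 := by
      have h1 := hc.2.2.1
      have h2 := hc.2.2.2
      rw [Complex.ofReal_re] at h1 h2
      exact ⟨h1.le, h2.le⟩
    obtain ⟨l, s⟩ := l
    obtain rfl : s = 1 := hc.1
    refine hp ?_
    rw [param_edge_of_nonpos _ (by simp), P.homeo_sec l hu]
    exact Set.mem_iUnion.2 ⟨_, _, rfl⟩
  | vertex q =>
    exfalso
    obtain rfl : x = 0 := hc
    refine hp ?_
    rw [param_vertex_zero q 0, P.homeo_corner q 0, ← P.incident q 0]
    exact Set.mem_iUnion.2 ⟨_, _, rfl⟩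

theorem surfaceHomeo_smooth (P : Presentation b D) (P' : Presentation b' D') {p : S}
    (hp : p ∉ D.image) : ContMDiffAt (𝓡 2) (𝓡 2) ∞ (P.surfaceHomeo P') p ∧
      0 < (mfderiv (𝓡 2) (𝓡 2) (P.surfaceHomeo P') p :
        EuclideanSpace ℝ (Fin 2) →L[ℝ] EuclideanSpace ℝ (Fin 2)).det := by
  obtain ⟨f, z, hz, rfl⟩ := P.exists_homeo_eq_of_notMem_image hp
  obtain ⟨g, hg1, hg2, hg3⟩ := P.face f
  obtain ⟨g', hg1', hg2', hg3'⟩ := P'.face f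
  set c := rotation b b' f with hc
  have hc1 : ‖c‖ = 1 := norm_rotation b b' f
  have hc0 : c ≠ 0 := by rw [← norm_pos_iff, hc1]; exact one_pos
  have hzb : z ∈ Metric.ball (0 : ℂ) 1 := mem_ball_zero_iff.2 hz
  have hzc : z * c ∈ Metric.ball (0 : ℂ) 1 := by
    rw [mem_ball_zero_iff, norm_mul, hc1, mul_one]; exact hz
  have hgz : ∀ y : ℂ, ‖y‖ < 1 → g y = P.homeo (b.proj ⟨f, discProj y⟩) := by
    intro y hy
    have := hg1 (discProj y)
    rwa [coe_discProj hy.le] at this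
  have hgz' : ∀ y : ℂ, ‖y‖ < 1 → g' y = P'.homeo (b'.proj ⟨f, discProj y⟩) := by
    intro y hy
    have := hg1' (discProj y)
    rwa [coe_discProj hy.le] at this
  have hh : ∀ᶠ y in 𝓝 z, P.surfaceHomeo P' (g y) = g' (y * c) := by
    filter_upwards [Metric.isOpen_ball.mem_nhds hzb] with y hy
    have hy1 : ‖y‖ < 1 := mem_ball_zero_iff.1 hy
    rw [hgz y hy1, surfaceHomeo_homeo, hgz' (y * c) (by rwa [norm_mul, hc1, mul_one])]
    refine congrArg P'.homeo ?_
    change b'.proj (rotate b b' ⟨f, discProj y⟩) = _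
    rw [rotate, coe_discProj hy1.le]
  have hgs : ContMDiffAt 𝓘(ℝ, ℂ) (𝓡 2) ∞ g z := hg2.contMDiffAt (Metric.isOpen_ball.mem_nhds hzb)
  have hgs' : ContMDiffAt 𝓘(ℝ, ℂ) (𝓡 2) ∞ g' (z * c) :=
    hg2'.contMDiffAt (Metric.isOpen_ball.mem_nhds hzc)
  have hG : ContMDiffAt 𝓘(ℝ, ℂ) (𝓡 2) ∞ (fun y => g' (y * c)) z := by
    refine ContMDiffAt.comp (I' := 𝓘(ℝ, ℂ)) z hgs' (ContDiffAt.contMDiffAt ?_)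
    fun_prop
  rw [← hgz z hz]
  have hs := contMDiffAt_of_comp hgs hG (hg3 z hzb).ne' hh
  exact ⟨hs, det_mfderiv_pos hc0 (hgs.mdifferentiableAt (by simp))
    (hgs'.mdifferentiableAt (by simp)) (hs.mdifferentiableAt (by simp)) (hg3 z hzb)
    (hg3' _ hzc) hh⟩

/-! ### Reparametrization of the components -/

/-- The times of the `i`-th component of the diagram, as a function of the parameter for which the
edge `(i, k mod n i)` corresponds to the interval `[k, k + 1]`. -/
def time (P : Presentation b D) (i : Fin μ) (x : ℝ) : ℝ :=
  P.edgeTime (C.lab i ⌊x⌋) (Int.fract x) + 2 * Real.pi * (⌊x⌋ / n i : ℤ)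

theorem mark_add_mul (D : LinkDiagram S n) (i : Fin μ) (k j : ℤ) :
    D.mark i (k + j * n i) = D.mark i k + 2 * Real.pi * j := by
  induction j with
  | zero => simp
  | succ j ih =>
    rw [add_mul, one_mul, ← add_assoc, D.mark_add, ih]
    push_cast; ring
  | pred j ih =>
    have h := D.mark_add i (k + (-j - 1) * n i)
    have h2 : k + (-(j : ℤ) - 1) * n i + n i = k + -j * n i := by ring
    rw [h2, ih] at h
    push_cast at h ⊢
    linarith

/-- Passing from `m` to its residue modulo `n i` shifts the times by full turns. -/
theorem mark_lab (C : PDCode n) (D : LinkDiagram S n) (i : Fin μ) (m r : ℤ) :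
    D.mark i (((C.lab i m).2 : ℕ) + r) + 2 * Real.pi * (m / n i : ℤ) = D.mark i (m + r) := by
  have h : (0 : ℤ) < n i := by exact_mod_cast C.pos i
  rw [← mark_add_mul]
  congr 1
  simp only [lab]
  rw [Int.toNat_of_nonneg (Int.emod_nonneg _ h.ne')]
  have := Int.emod_add_ediv_mul m (n i)
  linarith

theorem edgeTime_spec (P : Presentation b D) (l : EdgeLabel n) :
    ContinuousOn (P.edgeTime l) (Set.Icc 0 1) ∧ StrictMonoOn (P.edgeTime l) (Set.Icc 0 1) ∧
      P.edgeTime l 0 = D.mark l.1 (l.2 : ℕ) ∧ P.edgeTime l 1 = D.mark l.1 ((l.2 : ℕ) + 1) :=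
  ⟨(P.edge l).choose_spec.1, (P.edge l).choose_spec.2.1, (P.edge l).choose_spec.2.2.1,
    (P.edge l).choose_spec.2.2.2.1⟩

theorem time_intCast (P : Presentation b D) (i : Fin μ) (m : ℤ) : P.time i m = D.mark i m := by
  have h := mark_lab C D i m 0
  simp only [add_zero] at h
  rw [time, Int.floor_intCast, Int.fract_intCast, (P.edgeTime_spec _).2.2.1]
  exact h

theorem time_of_mem_Icc (P : Presentation b D) (i : Fin μ) {m : ℤ} {x : ℝ} (h0 : m ≤ x)
    (h1 : x ≤ m + 1) :
    P.time i x = P.edgeTime (C.lab i m) (x - m) + 2 * Real.pi * (m / n i : ℤ) := by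
  rcases h1.lt_or_eq with h1 | rfl
  · rw [time, Int.fract, Int.floor_eq_iff.2 ⟨h0, h1⟩]
  · have h := time_intCast P i (m + 1)
    push_cast at h
    rw [h, add_sub_cancel_left, (P.edgeTime_spec _).2.2.2]
    exact (mark_lab C D i m 1).symm

theorem time_strictMonoOn (P : Presentation b D) (i : Fin μ) (m : ℤ) :
    StrictMonoOn (P.time i) (Set.Icc m (m + 1)) := by
  intro x hx y hy hxy
  rw [time_of_mem_Icc P i hx.1 hx.2, time_of_mem_Icc P i hy.1 hy.2, add_lt_add_iff_right]
  exact (P.edgeTime_spec _).2.1 ⟨by linarith [hx.1], by linarith [hx.2]⟩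
    ⟨by linarith [hy.1], by linarith [hy.2]⟩ (by linarith)

theorem time_strictMono (P : Presentation b D) (i : Fin μ) : StrictMono (P.time i) := by
  intro x y hxy
  have hx0 := Int.floor_le x
  have hx1 := Int.lt_floor_add_one x
  have hy0 := Int.floor_le y
  have hy1 := Int.lt_floor_add_one y
  rcases (Int.floor_mono hxy.le).eq_or_lt with h | h
  · exact time_strictMonoOn P i ⌊x⌋ ⟨hx0, hx1.le⟩ ⟨by rw [h]; exact hy0, by rw [h]; exact hy1.le⟩ hxy
  · have h1 : P.time i x < P.time i ((⌊x⌋ + 1 : ℤ) : ℝ) :=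
      time_strictMonoOn P i ⌊x⌋ ⟨hx0, hx1.le⟩ ⟨by push_cast; linarith, by push_cast; linarith⟩
        (by push_cast; linarith)
    have h2 : P.time i ((⌊x⌋ + 1 : ℤ) : ℝ) ≤ P.time i (⌊y⌋ : ℝ) := by
      rw [time_intCast, time_intCast]
      exact (D.mark_strictMono i).monotone h
    have h3 : P.time i (⌊y⌋ : ℝ) ≤ P.time i y :=
      (time_strictMonoOn P i ⌊y⌋).monotoneOn ⟨le_rfl, by linarith⟩ ⟨hy0, hy1.le⟩ hy0
    linarith

theorem time_surjective (P : Presentation b D) (i : Fin μ) : Function.Surjective (P.time i) := by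
  intro y
  have hpi := Real.pi_pos
  have hn : (0 : ℤ) < n i := by exact_mod_cast C.pos i
  obtain ⟨m, hm, hmax⟩ : ∃ m : ℤ, D.mark i m ≤ y ∧ ∀ k, D.mark i k ≤ y → k ≤ m := by
    refine Int.exists_greatest_of_bdd ?_ ?_
    · refine ⟨(⌊(y - D.mark i 0) / (2 * Real.pi)⌋ + 1) * n i, fun k hk => ?_⟩
      by_contra! h
      have h1 := D.mark_strictMono i h
      have h2 := mark_add_mul D i 0 (⌊(y - D.mark i 0) / (2 * Real.pi)⌋ + 1)
      rw [zero_add] at h2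
      have h3 := Int.lt_floor_add_one ((y - D.mark i 0) / (2 * Real.pi))
      rw [div_lt_iff₀ (by positivity)] at h3
      push_cast at h2
      linarith
    · refine ⟨⌊(y - D.mark i 0) / (2 * Real.pi)⌋ * n i, ?_⟩
      have h2 := mark_add_mul D i 0 ⌊(y - D.mark i 0) / (2 * Real.pi)⌋
      rw [zero_add] at h2
      have h3 := Int.floor_le ((y - D.mark i 0) / (2 * Real.pi))
      rw [le_div_iff₀ (by positivity)] at h3
      linarith
  have hlt : y < D.mark i (m + 1) := by
    by_contra! h
    have := hmax _ h
    omega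
  have hc : ContinuousOn (P.time i) (Set.Icc (m : ℝ) (m + 1)) := by
    have h1 : ContinuousOn (fun x : ℝ => P.edgeTime (C.lab i m) (x - m) +
        2 * Real.pi * (m / n i : ℤ)) (Set.Icc (m : ℝ) (m + 1)) := by
      refine ContinuousOn.add ?_ continuousOn_const
      refine (P.edgeTime_spec _).1.comp (by fun_prop) fun x hx => ?_
      exact ⟨by linarith [hx.1], by linarith [hx.2]⟩
    exact h1.congr fun x hx => time_of_mem_Icc P i hx.1 hx.2
  have h1 := time_intCast P i (m + 1)
  push_cast at h1
  obtain ⟨x, -, hx⟩ := intermediate_value_Icc (by linarith) hc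
    (⟨by rwa [time_intCast], by rw [h1]; exact hlt.le⟩ :
      y ∈ Set.Icc (P.time i (m : ℝ)) (P.time i ((m : ℝ) + 1)))
  exact ⟨x, hx⟩

theorem time_add (P : Presentation b D) (i : Fin μ) (x : ℝ) :
    P.time i (x + n i) = P.time i x + 2 * Real.pi := by
  have hn : (n i : ℤ) ≠ 0 := by exact_mod_cast (C.pos i).ne'
  have h : x + n i = x + ((n i : ℤ) : ℝ) := by push_cast; rfl
  have h2 : C.lab i (⌊x⌋ + n i) = C.lab i ⌊x⌋ := by
    rw [lab_eq_lab]
    simp [Int.ModEq]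
  rw [time, time, h, Int.floor_add_intCast, Int.fract_add_intCast, h2,
    Int.add_ediv_of_dvd_right (dvd_refl _), Int.ediv_self hn]
  push_cast
  ring

/-- In terms of the parameter of `time`, the diagram does not depend on its presentation. -/
theorem map_exp_time (P : Presentation b D) (i : Fin μ) (x : ℝ) :
    D.map i (Circle.exp (P.time i x)) = P.homeo (b.sec (C.lab i ⌊x⌋, 1) (Int.fract x : ℝ)) := by
  rw [P.homeo_sec _ ⟨Int.fract_nonneg x, (Int.fract_lt_one x).le⟩]
  have h : Circle.exp (P.time i x) = Circle.exp (P.edgeTime (C.lab i ⌊x⌋) (Int.fract x)) := by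
    rw [Circle.exp_eq_exp]
    exact ⟨⌊x⌋ / n i, by rw [time]; ring⟩
  rw [h]
  rfl

/-- The times of a component as an order isomorphism. -/
def timeIso (P : Presentation b D) (i : Fin μ) : ℝ ≃o ℝ :=
  (P.time_strictMono i).orderIsoOfSurjective _ (P.time_surjective i)

theorem timeIso_apply (P : Presentation b D) (i : Fin μ) (x : ℝ) : P.timeIso i x = P.time i x := rfl

theorem sign_eq (P : Presentation b D) (P' : Presentation b' D') (q : C.quads) :
    D'.sign (P'.vertex q) = D.sign (P.vertex q) := by
  obtain ⟨h0, h2, h3⟩ := signs_quad q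
  rcases Int.units_eq_one_or (q.1 1).2 with h1 | h1
  · rw [h1] at h3
    rw [P.sign_neg q h0 h1 h2 h3, P'.sign_neg q h0 h1 h2 h3]
  · rw [h1, neg_neg] at h3
    rw [P.sign_pos q h0 h1 h2 h3, P'.sign_pos q h0 h1 h2 h3]

/-- Two diagrams obtained from the same code are equivalent. -/
theorem equivalent (P : Presentation b D) (P' : Presentation b' D') : D.Equivalent D' := by
  refine ⟨P.surfaceHomeo P', fun i x => P'.timeIso i ((P.timeIso i).symm x),
    fun i => ⟨?_, ?_, ?_⟩, ?_, ?_, ?_, ?_, ?_, fun p hp => (P.surfaceHomeo_smooth P' hp).2⟩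
  · exact (P'.timeIso i).continuous.comp (P.timeIso i).symm.continuous
  · exact (P'.timeIso i).strictMono.comp (P.timeIso i).symm.strictMono
  · intro t
    obtain ⟨x, rfl⟩ := (P.timeIso i).surjective t
    have h : P.timeIso i x + 2 * Real.pi = P.timeIso i (x + n i) := (P.time_add i x).symm
    simp only [h, OrderIso.symm_apply_apply]
    exact P'.time_add i x
  · intro i t
    obtain ⟨x, rfl⟩ := (P.timeIso i).surjective t
    simp only [OrderIso.symm_apply_apply]
    rw [timeIso_apply, timeIso_apply, map_exp_time, map_exp_time,
      surfaceHomeo_homeo, changeHomeo_sec b b' _ (by simp)]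
  · intro i k
    have h : D.mark i k = P.timeIso i k := (P.time_intCast i k).symm
    simp only [h, OrderIso.symm_apply_apply]
    exact P'.time_intCast i k
  · intro p p' hp
    obtain ⟨q, rfl⟩ := P.vertex.surjective p
    obtain rfl : p' = P'.vertex q := by
      refine Subtype.ext (hp.symm.trans ?_)
      rw [← P.homeo_corner q 0, surfaceHomeo_homeo, changeHomeo_sec b b' _ (by simp),
        P'.homeo_corner]
    exact P.sign_eq P' q
  · exact fun p hp => (P.surfaceHomeo_smooth P' hp).1.contMDiffWithinAt
  · exact fun p hp => (P'.surfaceHomeo_smooth P hp).1.contMDiffWithinAt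

end Presentation

end

theorem mainTheorem4 {μ : ℕ} {n : Fin μ → ℕ} (C : PDCode n) :
    (∀ b : C.Start, ∃ (S : ClosedOrientedSurface) (D : LinkDiagram S n),
      Nonempty (Presentation b D)) ∧
    (∀ (b b' : C.Start) (S S' : ClosedOrientedSurface) (D : LinkDiagram S n)
      (D' : LinkDiagram S' n), Nonempty (Presentation b D) → Nonempty (Presentation b' D') →
      D.Equivalent D') :=
  ⟨fun b => ⟨b.surface, b.diagram, ⟨b.presentation⟩⟩,
    fun _ _ _ _ _ _ ⟨P⟩ ⟨P'⟩ => P.equivalent P'⟩
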